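/- Let $(\Sigma_g,\alpha,\beta)$ be a Heegaard diagram of genus $g$: $\alpha$ and $\beta$ are multicurves with $g$ components each on the closed oriented surface $\Sigma_g$, and cutting $\Sigma_g$ along either of them gives a sphere with $2g$ punctures. It is given by a tuple $(T,E_T(\alpha),N_T(\beta))$, where $T$ is an oriented generalized triangulation of $\Sigma_g$, stored with constant-time pointers between vertices, edges and triangles; $\alpha$ is contained in the 1-skeleton of $T$, and $E_T(\alpha)$ lists, for each component, the edges that it runs through in order (different components share no edge and do not cross at shared vertices); and $\beta$ is normal in $T$ (transverse to the edges, disjoint from the vertices, and meeting each triangle in arcs that join distinct sides), with $N_T(\beta)=(N_T(b))_{b\in\beta}$, where $N_T(b)\in\mathbb N^{E}$ counts the intersections of $b$ with each edge. Let $T'$ be the result of a Pachner move of type $(2,2)$, $(1,3)$ or $(3,1)$ on $T$ that deletes no edge of $E_T(\alpha)$; in the case of a move $(3,1)$ assume also that $\beta$ is normal in $T'$, so that $N_{T'}(\beta)$ is defined. Then the tuple $(T',E_{T'}(\alpha),N_{T'}(\beta'))$ of a Heegaard diagram of genus $g$ can be computed from $(T,E_T(\alpha),N_T(\beta))$, where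 $\alpha$ is unchanged and $\beta'$ is the image of $\beta$, component by component, under an isotopy supported in the interior of the polygon that the move retriangulates. More precisely, there are a single program and an absolute constant $C$ such that on every input the program updates the stored data in at most $C\,(1+k)$ steps and enlarges the memory in use by at most $C\,(1+k)$ cells, where $k$ is the number of stored coordinate vectors. Thus the time is $O(1)$ if $\beta$ is stored as the single vector $\sum_{b\in\beta}N_T(b)$ ($k=1$), and $O(1)$ for each component, that is, $C(1+g)$ in total, if the vectors of the $g$ components are stored separately ($k=g$). The machine is a unit-cost random access machine whose bit-size is, up to an additive constant, the logarithm of the number of intersections of $\beta$ with the edges plus the number of memory cells in use. After a move $(1,3)$, which joins a new vertex to the three corners of a triangle, the coordinates of the new edges are corner coordinates: if $e,f$ are the sides of the triangle that meet at a corner and $h$ is the third side, the edge from this corner to the new vertex gets the value $\tfrac12\,[e(b)+f(b)-h(b)]$ for each component $b$ of $\beta$. -/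

import Mathlib

/-! ## Oriented generalized triangulations of closed surfaces -/

/-- A generalized triangulation of a closed oriented surface, as a half-edge structure.  An element
of `D` (a *dart*) is a side of a triangle, directed so that the triangle lies to its left.  `next`
goes to the following side of the same triangle, `twin` to the side of the (same or another)
triangle glued to this one, with the opposite direction.  Triangles, edges and vertices are the
orbits of `next`, of `twin` and of `rot` (below).  Several sides or corners of a triangle may be
identified. -/
structure Tri (D : Type) where
  next : D → D
  twin : D → D
  next_next_next : ∀ x, next (next (next x)) = x
  next_ne : ∀ x, next x ≠ x
  twin_twin : ∀ x, twin (twin x) = x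
  twin_ne : ∀ x, twin x ≠ x

namespace Tri

variable {D : Type}

/-- The side of the triangle that precedes `x`. -/
def prev (T : Tri D) (x : D) : D := T.next (T.next x)

/-- The dart that follows `x` in the cyclic order of the darts that start at the origin of `x`.
The corner of the triangle of `x` at the origin of `x` lies between `x` and `rot x`; it is called
the corner of `x`. -/
def rot (T : Tri D) (x : D) : D := T.twin (T.prev x)

/-- `x` and `y` start at the same vertex. -/
def SameVertex (T : Tri D) : D → D → Prop := Relation.EqvGen (fun a b => b = T.rot a)

noncomputable def numVertices (T : Tri D) : ℕ := Nat.card (Quot (fun a b => b = T.rot a))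

noncomputable def numEdges (T : Tri D) : ℕ := Nat.card (Quot (fun a b => b = T.twin a))

noncomputable def numFaces (T : Tri D) : ℕ := Nat.card (Quot (fun a b => b = T.next a))

/-- The triangulated surface is connected (and not empty). -/
def Connected (T : Tri D) : Prop :=
  Nonempty D ∧ ∀ x y, Relation.EqvGen (fun a b => b = T.next a ∨ b = T.twin a) x y

/-- The triangulated surface is the closed connected oriented surface of genus `g`. -/
def HasGenus (T : Tri D) (g : ℕ) : Prop :=
  T.Connected ∧ (T.numVertices : ℤ) - T.numEdges + T.numFaces = 2 - 2 * g

/-! ## Edged multicurves -/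

/-- The dart `x` lies on an edge that the edge list `c` runs through. -/
def OnCurve (T : Tri D) (c : List D) (x : D) : Prop := x ∈ c ∨ T.twin x ∈ c

/-- `l` is the edge list of a simple closed curve in the 1-skeleton, in the order (and with the
direction) in which the curve runs through the edges: the end of every dart is the origin of the
cyclically following one, and no vertex and no edge is visited twice. -/
def IsEdgeCycle (T : Tri D) (l : List D) : Prop :=
  l ≠ [] ∧
  (∀ (i j : ℕ) (hi : i < l.length) (hj : j < l.length), j = (i + 1) % l.length →
    T.SameVertex (T.next l[i]) l[j]) ∧
  l.Pairwise (fun x y => ¬ T.SameVertex x y) ∧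
  ∀ x ∈ l, T.twin x ∉ l

/-- The corners of `x` and `y` lie at the same vertex, and on the same side of the curve `c` there:
one can turn around the vertex from one to the other without crossing an edge of `c`. -/
def SameSide (T : Tri D) (c : List D) : D → D → Prop :=
  Relation.EqvGen (fun a b => b = T.rot a ∧ ¬ T.OnCurve c b)

/-- `α` is an edged multicurve with `g` components.  Different components share no edge.  They may
share vertices, but do not cross there, so that they become disjoint after an arbitrarily small
isotopy. -/
structure IsEdgedMulticurve (T : Tri D) {g : ℕ} (α : Fin g → List D) : Prop where
  cycle : ∀ i, T.IsEdgeCycle (α i)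
  edge_disjoint : ∀ i j, i ≠ j → ∀ x, T.OnCurve (α i) x → ¬ T.OnCurve (α j) x
  not_crossing : ∀ i j, i ≠ j → ∀ x y, T.OnCurve (α j) x → T.OnCurve (α j) y →
    T.SameVertex x y → T.SameSide (α i) x y

/-- The complement of the edged multicurve `α` (made disjoint by a small isotopy) is connected.
The corners of one triangle lie in one component of the complement, and two corners at a vertex can
be joined near this vertex if and only if they are on the same side of every component of `α`. -/
def EdgedComplementConnected (T : Tri D) {g : ℕ} (α : Fin g → List D) : Prop :=
  ∀ x y, Relation.EqvGen
    (fun a b => b = T.next a ∨ (T.SameVertex a b ∧ ∀ i, T.SameSide (α i) a b)) x y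

/-! ## Normal multicurves -/

/-- The vector `N` (the number of intersections with every edge) consists of the normal coordinates
of some disjoint union of normal curves. -/
structure IsNormal (T : Tri D) (N : D → ℕ) : Prop where
  twin : ∀ x, N (T.twin x) = N x
  triangle : ∀ x, N x ≤ N (T.next x) + N (T.prev x)
  even : ∀ x, Even (N x + N (T.next x) + N (T.prev x))

/-- Corner coordinate: the number of elementary arcs that cut off the corner of `x`, that is, that
join the sides `x` and `prev x` of the triangle. -/
def corner (T : Tri D) (N : D → ℕ) (x : D) : ℕ := (N x + N (T.prev x) - N (T.next x)) / 2

/-- The pair `(x, i)` with `i < N x` is the `i`-th intersection point of the normal multicurve with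
the side `x`, counted from the origin of `x`.  Two such points are `Linked` if one gets from one to
the other by following elementary arcs inside the triangles, and by passing from a triangle to the
adjacent one only through the sides in `I`.  For `I = Set.univ` this says that the points lie on
the same component of the multicurve. -/
def Linked (T : Tri D) (N : D → ℕ) (I : Set D) : D × ℕ → D × ℕ → Prop :=
  Relation.EqvGen (fun p q =>
    (p.2 < T.corner N p.1 ∧ q = (T.prev p.1, N (T.prev p.1) - 1 - p.2)) ∨
    (p.1 ∈ I ∧ p.2 < N p.1 ∧ q = (T.twin p.1, N p.1 - 1 - p.2)))

/-- The normal coordinates of the union of the components. -/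
def total {g : ℕ} (β : Fin g → D → ℕ) (x : D) : ℕ := ∑ k, β k x

/-- The function `lab` tells for each intersection point of the union on which component it lies,
and `β k` is the vector of the normal coordinates of the `k`-th component. -/
structure IsLabelling (T : Tri D) {g : ℕ} (β : Fin g → D → ℕ) (lab : D → ℕ → Fin g) : Prop where
  iff_linked : ∀ x y i j, i < total β x → j < total β y →
    (lab x i = lab y j ↔ T.Linked (total β) Set.univ (x, i) (y, j))
  count : ∀ k x, β k x = ((Finset.range (total β x)).filter (fun i => lab x i = k)).card
  nonempty : ∀ k, ∃ x, 0 < β k x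

/-- The vectors `β 0, …, β (g - 1)` are the normal coordinates of the `g` components of a normal
multicurve. -/
def IsNormalMulticurve (T : Tri D) {g : ℕ} (β : Fin g → D → ℕ) : Prop :=
  T.IsNormal (total β) ∧ ∃ lab, T.IsLabelling β lab

/-- The complement of the normal multicurve with coordinates `N` is connected.  The `N x`
intersection points cut the side `x` into the segments `(x, 0), …, (x, N x)`, counted from the
origin of `x`; every region into which the multicurve cuts a triangle has such a segment in its
boundary, and two segments of different sides border the same region of the triangle if and only if
they have the same number, at most the corner coordinate, as seen from the corner between them. -/
def NormalComplementConnected (T : Tri D) (N : D → ℕ) : Prop :=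
  ∀ p q : D × ℕ, p.2 ≤ N p.1 → q.2 ≤ N q.1 → Relation.EqvGen (fun a b =>
    (a.2 ≤ T.corner N a.1 ∧ b = (T.prev a.1, N (T.prev a.1) - a.2)) ∨
    (a.2 ≤ N a.1 ∧ b = (T.twin a.1, N a.1 - a.2))) p q

/-! ## Heegaard diagrams -/

/-- `(T, α, β)` is a Heegaard diagram of genus `g`: `T` triangulates the closed surface of genus
`g`, `α` is an edged and `β` a normal multicurve in it, and both are systems.  (A multicurve with
`g` components on the surface of genus `g` has a complement homeomorphic to the sphere with `2 g`
punctures if and only if this complement is connected.) -/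
structure IsHeegaardDiagram (T : Tri D) (g : ℕ) (α : Fin g → List D) (β : Fin g → D → ℕ) :
    Prop where
  genus : T.HasGenus g
  edged : T.IsEdgedMulticurve α
  edged_system : T.EdgedComplementConnected α
  normal : T.IsNormalMulticurve β
  normal_system : T.NormalComplementConnected (total β)

end Tri

/-! ## Pachner moves -/

/-- `T'` arises from `T` by the flip (move (2,2)) of the edge of the dart `d`: the two triangles at
this edge are distinct, and in the quadrilateral that they form the diagonal is replaced by the
other one.  The two darts of the new diagonal are again called `d` and `twin d`. -/
structure IsFlip {D : Type} (T T' : Tri D) (d : D) : Prop where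
  ne_next : T.twin d ≠ T.next d
  ne_prev : T.twin d ≠ T.prev d
  twin : T'.twin = T.twin
  next_d : T'.next d = T.prev d
  next_prev : T'.next (T.prev d) = T.next (T.twin d)
  next_next_twin : T'.next (T.next (T.twin d)) = d
  next_twin : T'.next (T.twin d) = T.prev (T.twin d)
  next_prev_twin : T'.next (T.prev (T.twin d)) = T.next d
  next_next : T'.next (T.next d) = T.twin d
  next_other : ∀ x, x ≠ d → x ≠ T.next d → x ≠ T.prev d → x ≠ T.twin d →
    x ≠ T.next (T.twin d) → x ≠ T.prev (T.twin d) → T'.next x = T.next x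

/-- `T'` arises from `T` by the subdivision (move (1,3)) of the triangle of the dart `x` with a new
vertex in its interior.  `ι` maps the darts of `T` to the same darts in `T'`, and `s k` is the new
dart from the new vertex to the origin of `x`, `next x`, `prev x` for `k = 0, 1, 2`. -/
structure IsSubdivision {D D' : Type} (T : Tri D) (T' : Tri D') (x : D) (ι : D → D')
    (s : Fin 3 → D') : Prop where
  bijective : Function.Bijective
    (Sum.elim ι (Sum.elim s (fun k => T'.twin (s k))) : D ⊕ (Fin 3 ⊕ Fin 3) → D')
  twin : ∀ y, T'.twin (ι y) = ι (T.twin y)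
  next_spoke : ∀ k : Fin 3, T'.next (s k) = ι (T.next^[k] x)
  next_side : ∀ k : Fin 3, T'.next (ι (T.next^[k] x)) = T'.twin (s (k + 1))
  next_twin_spoke : ∀ k : Fin 3, T'.next (T'.twin (s (k + 1))) = s k
  next_other : ∀ y, y ≠ x → y ≠ T.next x → y ≠ T.prev x → T'.next (ι y) = ι (T.next y)

/-- The three kinds of Pachner moves of surfaces: (2,2), (1,3) and (3,1). -/
inductive Move where
  | flip
  | split
  | join

/-- The number by which the kind of the move is given to a program. -/
def Move.code : Move → ℕ
  | .flip => 0
  | .split => 1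
  | .join => 2

/-- `PachnerMove T T' mv x R`: the triangulation `T'` is the result of the Pachner move `mv` on `T`
at the dart `x`, which is a side of the edge to be flipped for `flip`, a side of the triangle to be
subdivided for `split`, and starts at the vertex to be removed for `join`, the inverse of `split`.
`R a b` says that the dart `a` of `T` and the dart `b` of `T'` are the same dart, so that the darts
without a partner are those of the edges that the move deletes or creates. -/
inductive PachnerMove {D D' : Type} (T : Tri D) : Tri D' → Move → D → (D → D' → Prop) → Prop
  | flip (T' : Tri D) (d : D) (h : IsFlip T T' d) (e : D ≃ D') (T'' : Tri D')
      (hn : ∀ y, T''.next (e y) = e (T'.next y)) (ht : ∀ y, T''.twin (e y) = e (T'.twin y)) :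
      PachnerMove T T'' .flip d (fun a b => b = e a ∧ a ≠ d ∧ a ≠ T.twin d)
  | split (T' : Tri D') (x : D) (ι : D → D') (s : Fin 3 → D') (h : IsSubdivision T T' x ι s) :
      PachnerMove T T' .split x (fun a b => b = ι a)
  | join (T' : Tri D') (x : D') (ι : D' → D) (s : Fin 3 → D) (h : IsSubdivision T' T x ι s) :
      PachnerMove T T' .join (s 0) (fun a b => a = ι b)

namespace Tri

variable {D D' : Type}

/-- Every strand of `β` in the polygon that is formed by the triangles on which the move acts joins
two distinct sides of this polygon.  For a move (3,1) the polygon is a triangle of the result, and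
this says that `β` is normal with respect to the result. -/
def StrandsJoinDistinctSides (T : Tri D) {g : ℕ} (β : Fin g → D → ℕ) (R : D → D' → Prop) : Prop :=
  ∀ a b, R a b → ∀ i j, i < total β a → j < total β a →
    T.Linked (total β) {z | ¬ ∃ z', R z z'} (a, i) (a, j) → i = j

/-- The multicurve with normal coordinates `β'` in `T'` is the image of the multicurve with normal
coordinates `β` in `T` (component by component) under an isotopy that is supported in the interior
of the polygon retriangulated by the move.  That is: they have the same intersection points, on the
same components, with all edges that are kept by the move; and inside the polygon (and inside every
other triangle) their strands join the same pairs of boundary points.  Recall that a system of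
disjoint arcs in a disk is determined by the pairs of its end points up to isotopy that fixes the
boundary. -/
def IsotopicInPolygon (T : Tri D) (T' : Tri D') {g : ℕ} (β : Fin g → D → ℕ) (β' : Fin g → D' → ℕ)
    (R : D → D' → Prop) : Prop :=
  (∃ lab lab', T.IsLabelling β lab ∧ T'.IsLabelling β' lab' ∧
    ∀ a b, R a b → total β a = total β' b ∧ ∀ i, i < total β a → lab a i = lab' b i) ∧
  ∀ a b c d, R a b → R c d → ∀ i j, i < total β a → j < total β c →
    (T.Linked (total β) {z | ¬ ∃ z', R z z'} (a, i) (c, j) ↔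
      T'.Linked (total β') {z' | ¬ ∃ z, R z z'} (b, i) (d, j))

end Tri

/-! ## A unit-cost random access machine -/

/-- The names of the arrays in the memory of the machine. -/
inductive Arr where
  | next | twin | vert | edge | face
  | vertDart | edgeDart | faceDart
  | coord
  | curveStart | curveLength | curveEdge
  | size
  deriving DecidableEq

/-- The machine has registers and the arrays above, all unbounded. -/
structure State where
  reg : ℕ → ℕ
  mem : Arr → ℕ → ℕ

/-- The four operations on natural numbers. -/
inductive Op where
  | add | sub | mul | div

def Op.eval : Op → ℕ → ℕ → ℕ
  | .add, a, b => a + b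
  | .sub, a, b => a - b
  | .mul, a, b => a * b
  | .div, a, b => a / b

/-- Programs: `const r n` puts the constant `n` into register `r`; `op o r a b` puts the result of
`o` on the registers `a` and `b` into `r`; `load r A a` and `store A a b` read and write the cell of
the array `A` whose index is in register `a`; `ifLt a b` and `whileLt a b` test whether register `a`
is smaller than register `b`. -/
inductive Prog where
  | skip
  | const (r n : ℕ)
  | op (o : Op) (r a b : ℕ)
  | load (r : ℕ) (A : Arr) (a : ℕ)
  | store (A : Arr) (a b : ℕ)
  | seq (p q : Prog)
  | ifLt (a b : ℕ) (p q : Prog)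
  | whileLt (a b : ℕ) (p : Prog)

def State.setReg (s : State) (r v : ℕ) : State :=
  { s with reg := Function.update s.reg r v }

def State.setMem (s : State) (A : Arr) (i v : ℕ) : State :=
  { s with mem := Function.update s.mem A (Function.update (s.mem A) i v) }

/-- `Exec W p s s' t`: on the unit-cost machine of bit-size `W`, the program `p` started in the
state `s` halts in the state `s'` after `t` steps.  Each instruction and each test is one step.
Every number that is put into a register has to fit into a word of `W` bits; otherwise there is no
execution. -/
inductive Exec (W : ℕ) : Prog → State → State → ℕ → Prop
  | skip (s : State) : Exec W .skip s s 1
  | const (s : State) (r n : ℕ) (h : n < 2 ^ W) : Exec W (.const r n) s (s.setReg r n) 1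
  | op (s : State) (o : Op) (r a b : ℕ) (h : o.eval (s.reg a) (s.reg b) < 2 ^ W) :
      Exec W (.op o r a b) s (s.setReg r (o.eval (s.reg a) (s.reg b))) 1
  | load (s : State) (r : ℕ) (A : Arr) (a : ℕ) (h : s.mem A (s.reg a) < 2 ^ W) :
      Exec W (.load r A a) s (s.setReg r (s.mem A (s.reg a))) 1
  | store (s : State) (A : Arr) (a b : ℕ) :
      Exec W (.store A a b) s (s.setMem A (s.reg a) (s.reg b)) 1
  | seq (p q : Prog) (s s₁ s₂ : State) (t₁ t₂ : ℕ) (h₁ : Exec W p s s₁ t₁)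
      (h₂ : Exec W q s₁ s₂ t₂) : Exec W (.seq p q) s s₂ (t₁ + t₂)
  | ifTrue (a b : ℕ) (p q : Prog) (s s₁ : State) (t : ℕ) (h : s.reg a < s.reg b)
      (h₁ : Exec W p s s₁ t) : Exec W (.ifLt a b p q) s s₁ (t + 1)
  | ifFalse (a b : ℕ) (p q : Prog) (s s₁ : State) (t : ℕ) (h : ¬ s.reg a < s.reg b)
      (h₁ : Exec W q s s₁ t) : Exec W (.ifLt a b p q) s s₁ (t + 1)
  | whileTrue (a b : ℕ) (p : Prog) (s s₁ s₂ : State) (t₁ t₂ : ℕ) (h : s.reg a < s.reg b)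
      (h₁ : Exec W p s s₁ t₁) (h₂ : Exec W (.whileLt a b p) s₁ s₂ t₂) :
      Exec W (.whileLt a b p) s s₂ (t₁ + t₂ + 1)
  | whileFalse (a b : ℕ) (p : Prog) (s : State) (h : ¬ s.reg a < s.reg b) :
      Exec W (.whileLt a b p) s s 1

/-! ## The data structure -/

/-- The numbers (pointers) by which the darts, and the vertex at the origin, the edge and the
triangle of a dart are named in memory. -/
structure Layout (D : Type) where
  dart : D → ℕ
  vert : D → ℕ
  edge : D → ℕ
  face : D → ℕ

/-- Two ways to store a normal multicurve: one vector for every component, or only the sum of these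
vectors. -/
inductive Storage where
  | byComponent
  | aggregate

/-- The list of the vectors that are stored. -/
def Storage.vectors {D : Type} {g : ℕ} : Storage → (Fin g → D → ℕ) → List (D → ℕ)
  | .byComponent, β => List.ofFn β
  | .aggregate, β => [Tri.total β]

/-- The memory `m` holds the triangulation `T`, the edge lists `α`, and the list `vs` of vectors of
normal coordinates, under the names `L`.  Every dart has pointers to its successor, its twin, its
origin, its edge and its triangle, and every vertex, edge and triangle has a pointer to one of its
darts.  The coordinates of an edge form a block of consecutive cells.  The cells `0, 1, 2, 3` of
`Arr.size` are strict upper bounds for the names in use for darts, vertices, edges and triangles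
(larger names are free), cell `4` is the number of stored vectors, cell `5` the genus. -/
structure Encodes {D : Type} (T : Tri D) {g : ℕ} (α : Fin g → List D) (vs : List (D → ℕ))
    (m : Arr → ℕ → ℕ) (L : Layout D) : Prop where
  dart_injective : Function.Injective L.dart
  vert_iff : ∀ x y, L.vert x = L.vert y ↔ T.SameVertex x y
  edge_iff : ∀ x y, L.edge x = L.edge y ↔ y = x ∨ y = T.twin x
  face_iff : ∀ x y, L.face x = L.face y ↔ y = x ∨ y = T.next x ∨ y = T.prev x
  next : ∀ x, m .next (L.dart x) = L.dart (T.next x)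
  twin : ∀ x, m .twin (L.dart x) = L.dart (T.twin x)
  vert : ∀ x, m .vert (L.dart x) = L.vert x
  edge : ∀ x, m .edge (L.dart x) = L.edge x
  face : ∀ x, m .face (L.dart x) = L.face x
  vertDart : ∀ x, ∃ y, L.vert y = L.vert x ∧ m .vertDart (L.vert x) = L.dart y
  edgeDart : ∀ x, ∃ y, L.edge y = L.edge x ∧ m .edgeDart (L.edge x) = L.dart y
  faceDart : ∀ x, ∃ y, L.face y = L.face x ∧ m .faceDart (L.face x) = L.dart y
  coord : ∀ x (j : ℕ) (h : j < vs.length), m .coord (L.edge x * vs.length + j) = vs[j] x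
  curveLength : ∀ i : Fin g, m .curveLength i = (α i).length
  curveEdge : ∀ (i : Fin g) (j : ℕ) (h : j < (α i).length),
    m .curveEdge (m .curveStart i + j) = L.edge (α i)[j]
  dart_lt : ∀ x, L.dart x < m .size 0
  vert_lt : ∀ x, L.vert x < m .size 1
  edge_lt : ∀ x, L.edge x < m .size 2
  face_lt : ∀ x, L.face x < m .size 3
  numVectors : m .size 4 = vs.length
  genus : m .size 5 = g

/-- The size of the part of the memory that is in use for the triangulation and the coordinates, up
to a constant factor. -/
def memoryInUse (m : Arr → ℕ → ℕ) : ℕ :=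
  m .size 0 + m .size 1 + m .size 2 * (m .size 4 + 1) + m .size 3

/-!
A Pachner move identifies the darts of `T` with the darts of `T'`, apart from those of the edges
that it deletes or creates. This identification is a relation `R`, and everything of which a
Heegaard diagram consists can be expressed by what `R` preserves; so the three moves are treated
alike once a few local facts about the retriangulated polygon are known, and a move (3,1) is a move
(1,3) read backwards.

*The curves `α`.* No edge of `α` is deleted, so that `α'` is the list of the images of the darts of
`α`. A *corner map* (`Tri.IsCornerMap`) sends the corners of `T` to corners of `T'`, compatibly with
`R`, such that corners that can be reached from each other around a vertex, or through the
complement of `α`, have images with the same property. With corner maps in both directions, "same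
vertex", "same side of a curve" and the connectedness of the complement of `α` carry over, and so do
the axioms of an edged multicurve. The Euler characteristic is the same, since a flip changes none
of the three numbers, and a subdivision adds one vertex, three edges and two triangles.

*The curves `β`.* Intersection points with edges, and segments between them, are both pairs of a
dart `x` and a number `i`, with `i < N x` for points and `i ≤ N x` for segments, and both are
connected by the same kind of steps through triangles and edges. The relation `Tri.Joined` contains
a parameter `δ ∈ {0, 1}` that covers both. For the new coordinates (`Tri.IsFlipAlong.Coord`,
`IsSubdivision.Coord`), each step in one of the triangulations is followed by a path in the other
one that stays in the polygon (`Tri.Follows`). Hence the strands in the polygon join the same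
points, the components are the same, and the complement stays connected. In a flip the two diagonals
add up to the larger of the two sums of opposite sides of the quadrilateral. In a subdivision the
new vertex is put into the region between the three families of corner arcs, so that the new edges
cross exactly the arcs around their corners. When a vertex is removed, the connectedness of the
complement excludes a circle around the vertex, and the assumption that the strands join distinct
sides excludes strands that turn around it through two of the three triangles; hence arcs around the
vertex occur in at most one of them (`IsSubdivision.exists_forall_corner_eq_zero`), and the strands
are those of a normal multicurve in the large triangle. Since every strand meets a dart that is
kept, the labels of the points carry over. The rule for the flip also holds for every single
component, although it is not linear: the new corner coordinates are minima of two old ones that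
count nested arcs from the same corner, and the number of those among the first `m` arcs that belong
to one component is a monotone function of `m`, which commutes with the minimum
(`Tri.IsFlipAlong.coord_component`).

*The program.* Each move is a straight-line program that changes a bounded number of pointers, and
then runs through a bounded number of loops over the stored vectors, one for each block of new
coordinates (`run_flip`, `run_split`, `IsSubdivision.run_join`). The names of the old cells are
kept, and the names of the new ones are taken from the unused ones, so that the memory again encodes
the new diagram (`Tri.IsFlipAlong.encodes`, `IsSubdivision.encodes`, `IsSubdivision.encodes_symm`).
-/

/-! ### Equivalence closures and orbits -/

section EqvGen

variable {A B : Type*} {r : A → A → Prop} {r' : B → B → Prop}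

theorem Relation.EqvGen.map_of_step {f : A → B}
    (h : ∀ a b, r a b → Relation.EqvGen r' (f a) (f b)) {a b : A} (hab : Relation.EqvGen r a b) :
    Relation.EqvGen r' (f a) (f b) := by
  induction hab with
  | rel a b hab => exact h a b hab
  | refl a => exact .refl _
  | symm a b _ ih => exact .symm _ _ ih
  | trans a b c _ _ ih₁ ih₂ => exact .trans _ _ _ ih₁ ih₂

/-- The class of `a` is determined by a function that is constant along `r`. -/
theorem Relation.EqvGen.eq_of_step {f : A → B} (h : ∀ a b, r a b → f a = f b) {a b : A}
    (hab : Relation.EqvGen r a b) : f a = f b := by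
  induction hab with
  | rel a b hab => exact h a b hab
  | refl a => rfl
  | symm a b _ ih => exact ih.symm
  | trans a b c _ _ ih₁ ih₂ => exact ih₁.trans ih₂

theorem Relation.EqvGen.mono' {r₁ r₂ : A → A → Prop} (h : ∀ a b, r₁ a b → r₂ a b) {a b : A}
    (hab : Relation.EqvGen r₁ a b) : Relation.EqvGen r₂ a b :=
  Relation.EqvGen.map_of_step (f := id) (fun a b hr => .rel a b (h a b hr)) hab

theorem Relation.EqvGen.trans' {a b c : A} (h : Relation.EqvGen r a b)
    (h' : Relation.EqvGen r b c) : Relation.EqvGen r a c := .trans _ _ _ h h'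

theorem Relation.EqvGen.symm' {a b : A} (h : Relation.EqvGen r a b) :
    Relation.EqvGen r b a := .symm _ _ h

end EqvGen

namespace Tri

variable {D D' : Type}

theorem next_next_eq_prev (T : Tri D) (x : D) : T.next (T.next x) = T.prev x := rfl

@[simp] theorem next_prev (T : Tri D) (x : D) : T.next (T.prev x) = x := T.next_next_next x

@[simp] theorem prev_next (T : Tri D) (x : D) : T.prev (T.next x) = x := T.next_next_next x

@[simp] theorem prev_prev (T : Tri D) (x : D) : T.prev (T.prev x) = T.next x := by
  rw [← next_next_eq_prev T (T.prev x), next_prev]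

@[simp] theorem twin_twin' (T : Tri D) (x : D) : T.twin (T.twin x) = x := T.twin_twin x

theorem next_injective (T : Tri D) : Function.Injective T.next := fun x y h => by
  rw [← T.prev_next x, h, T.prev_next]

theorem twin_injective (T : Tri D) : Function.Injective T.twin := fun x y h => by
  rw [← T.twin_twin x, h, T.twin_twin]

theorem prev_ne (T : Tri D) (x : D) : T.prev x ≠ x := fun h => by
  have := congrArg T.next h
  rw [next_prev] at this
  exact T.next_ne x this.symm

theorem prev_ne_next (T : Tri D) (x : D) : T.prev x ≠ T.next x := fun h =>
  T.next_ne (T.next x) h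

theorem prev_eq_of_next_eq (T : Tri D) {x y : D} (h : T.next x = y) : T.prev y = x := by
  rw [← h, prev_next]

theorem SameVertex.twin_next (T : Tri D) (x : D) : T.SameVertex (T.next x) (T.twin x) :=
  .rel _ _ (by rw [rot, prev_next])

theorem sameSide_nil (T : Tri D) (x y : D) : T.SameSide [] x y ↔ T.SameVertex x y := by
  constructor <;> intro h
  · exact Relation.EqvGen.mono' (fun a b hab => hab.1) h
  · exact Relation.EqvGen.mono' (fun a b hab => ⟨hab, by simp [OnCurve]⟩) h

/-! ### Counting edges and triangles -/

theorem card_quot_mul {D : Type} [Fintype D] (r : D → D → Prop) (n : ℕ)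
    (h : ∀ x, Nat.card {y // Relation.EqvGen r x y} = n) :
    Nat.card (Quot r) * n = Fintype.card D := by
  classical
  have e : (Σ q : Quot r, {y : D // Quot.mk r y = q}) ≃ D := Equiv.sigmaFiberEquiv (Quot.mk r)
  have : Finite (Quot r) := Quot.finite _
  have := Fintype.ofFinite (Quot r)
  have key : ∀ q : Quot r, Nat.card {y : D // Quot.mk r y = q} = n := by
    intro q
    induction q using Quot.ind with
    | mk x =>
      rw [← h x]
      refine Nat.card_congr (Equiv.subtypeEquivRight fun y => ?_)
      rw [Quot.eq]
      exact ⟨fun h => h.symm', fun h => h.symm'⟩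
  rw [← Nat.card_eq_fintype_card (α := D), ← Nat.card_congr e, Nat.card_sigma]
  simp only [key, Finset.sum_const, Finset.card_univ, Nat.card_eq_fintype_card, smul_eq_mul]

theorem numEdges_mul_two [Fintype D] (T : Tri D) : T.numEdges * 2 = Fintype.card D := by
  classical
  refine card_quot_mul _ 2 fun x => ?_
  have : ∀ y, Relation.EqvGen (fun a b => b = T.twin a) x y ↔ y ∈ ({x, T.twin x} : Finset D) := by
    intro y
    constructor
    · intro h
      have : ({x, T.twin x} : Finset D) = {y, T.twin y} :=
        Relation.EqvGen.eq_of_step (f := fun z => ({z, T.twin z} : Finset D))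
          (by rintro a b rfl; simp [Finset.pair_comm]) h
      rw [this]; simp
    · intro h
      simp only [Finset.mem_insert, Finset.mem_singleton] at h
      rcases h with rfl | rfl
      · exact .refl _
      · exact .rel _ _ rfl
  rw [Nat.card_congr (Equiv.subtypeEquivRight this), Nat.card_eq_fintype_card, Fintype.card_coe,
    Finset.card_pair (T.twin_ne x).symm]

theorem numFaces_mul_three [Fintype D] (T : Tri D) : T.numFaces * 3 = Fintype.card D := by
  classical
  refine card_quot_mul _ 3 fun x => ?_
  have : ∀ y, Relation.EqvGen (fun a b => b = T.next a) x y ↔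
      y ∈ ({x, T.next x, T.prev x} : Finset D) := by
    intro y
    constructor
    · intro h
      have : ({x, T.next x, T.prev x} : Finset D) = {y, T.next y, T.prev y} :=
        Relation.EqvGen.eq_of_step (f := fun z => ({z, T.next z, T.prev z} : Finset D))
          (by rintro a b rfl; ext z; simp; tauto) h
      rw [this]; simp
    · intro h
      simp only [Finset.mem_insert, Finset.mem_singleton] at h
      rcases h with rfl | rfl | rfl
      · exact .refl _
      · exact .rel _ _ rfl
      · exact .symm _ _ (.rel _ _ (by simp))
  rw [Nat.card_congr (Equiv.subtypeEquivRight this), Nat.card_eq_fintype_card, Fintype.card_coe,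
    Finset.card_eq_three.2 ⟨x, T.next x, T.prev x, (T.next_ne x).symm, (T.prev_ne x).symm,
      (T.prev_ne_next x).symm, rfl⟩]

/-! ### Transfer of edged multicurves -/

/-- Two darts lie in the same component of the complement of the edged multicurve `α`. -/
def EdgedLinked (T : Tri D) {g : ℕ} (α : Fin g → List D) : D → D → Prop :=
  Relation.EqvGen (fun a b => b = T.next a ∨ (T.SameVertex a b ∧ ∀ i, T.SameSide (α i) a b))

/-- The darts related by `R` are identified; the relation is a partial bijection that respects
`twin`. -/
structure IsMatching (T : Tri D) (T' : Tri D') (R : D → D' → Prop) : Prop where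
  right_unique : ∀ {a b b'}, R a b → R a b' → b = b'
  left_unique : ∀ {a a' b}, R a b → R a' b → a = a'
  twin : ∀ {a b}, R a b → R (T.twin a) (T'.twin b)

theorem IsMatching.symm {T : Tri D} {T' : Tri D'} {R : D → D' → Prop} (h : IsMatching T T' R) :
    IsMatching T' T (fun b a => R a b) :=
  ⟨fun h₁ h₂ => h.left_unique h₁ h₂, fun h₁ h₂ => h.right_unique h₁ h₂, fun h₁ => h.twin h₁⟩

/-- A map `f` of the darts (regarded as corners) of `T` to those of `T'`, which extends the partial
bijection `R` and respects the ways to go from corner to corner: around a vertex without crossing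
a curve that consists of darts in the domain of `R`, and inside a triangle. -/
structure IsCornerMap (T : Tri D) (T' : Tri D') (R : D → D' → Prop) (f : D → D') : Prop where
  agree : ∀ {a b}, R a b → f a = b
  rot : ∀ {c c'}, List.Forall₂ R c c' → ∀ a, ¬ T.OnCurve c (T.rot a) →
    T'.SameSide c' (f a) (f (T.rot a))
  next : ∀ {g : ℕ} {α : Fin g → List D} {α' : Fin g → List D'},
    (∀ i, List.Forall₂ R (α i) (α' i)) → ∀ a, T'.EdgedLinked α' (f a) (f (T.next a))
  surj : ∀ {g : ℕ} (α' : Fin g → List D') (b : D'), ∃ a, T'.EdgedLinked α' b (f a)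

section transfer

variable {T : Tri D} {T' : Tri D'} {R : D → D' → Prop} {f : D → D'} {f' : D' → D}

theorem forall₂_flip {c : List D} {c' : List D'} (h : List.Forall₂ R c c') :
    List.Forall₂ (fun b a => R a b) c' c := by
  induction h with
  | nil => exact .nil
  | cons h _ ih => exact .cons h ih

theorem exists_of_mem_forall₂ {c : List D} {c' : List D'} (h : List.Forall₂ R c c') {b : D'}
    (hb : b ∈ c') : ∃ a ∈ c, R a b := by
  induction h with
  | nil => simp at hb
  | cons h _ ih =>
    rcases List.mem_cons.1 hb with rfl | hb
    · exact ⟨_, by simp, h⟩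
    · obtain ⟨a, ha, hab⟩ := ih hb
      exact ⟨a, by simp [ha], hab⟩

theorem IsMatching.mem_iff (hR : IsMatching T T' R) {c : List D} {c' : List D'}
    (h : List.Forall₂ R c c') {a : D} {b : D'} (hab : R a b) : a ∈ c ↔ b ∈ c' := by
  constructor
  · intro ha
    obtain ⟨b', hb', h'⟩ := exists_of_mem_forall₂ (forall₂_flip h) ha
    rwa [hR.right_unique hab h']
  · intro hb
    obtain ⟨a', ha', h'⟩ := exists_of_mem_forall₂ h hb
    rwa [hR.left_unique hab h']

theorem IsMatching.onCurve_iff (hR : IsMatching T T' R) {c : List D} {c' : List D'}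
    (h : List.Forall₂ R c c') {a : D} {b : D'} (hab : R a b) : T.OnCurve c a ↔ T'.OnCurve c' b := by
  rw [OnCurve, OnCurve, hR.mem_iff h hab, hR.mem_iff h (hR.twin hab)]

theorem IsMatching.exists_of_onCurve (hR : IsMatching T T' R) {c : List D} {c' : List D'}
    (h : List.Forall₂ R c c') {b : D'} (hb : T'.OnCurve c' b) : ∃ a, R a b := by
  rcases hb with hb | hb
  · obtain ⟨a, -, hab⟩ := exists_of_mem_forall₂ h hb
    exact ⟨a, hab⟩
  · obtain ⟨a, -, hab⟩ := exists_of_mem_forall₂ h hb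
    exact ⟨T.twin a, by simpa using hR.twin hab⟩

theorem IsCornerMap.sameSide (hf : IsCornerMap T T' R f) {c : List D} {c' : List D'}
    (h : List.Forall₂ R c c') {a b : D} (hab : T.SameSide c a b) :
    T'.SameSide c' (f a) (f b) := by
  refine Relation.EqvGen.map_of_step (f := f) ?_ hab
  rintro a b ⟨rfl, hb⟩
  exact hf.rot h a hb

theorem IsCornerMap.sameVertex (hf : IsCornerMap T T' R f) {a b : D} (hab : T.SameVertex a b) :
    T'.SameVertex (f a) (f b) := by
  rw [← sameSide_nil] at hab ⊢
  exact hf.sameSide .nil hab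

theorem sameSide_iff (hf : IsCornerMap T T' R f)
    (hf' : IsCornerMap T' T (fun b a => R a b) f') {c : List D} {c' : List D'}
    (h : List.Forall₂ R c c') {a₁ a₂ : D} {b₁ b₂ : D'} (h₁ : R a₁ b₁) (h₂ : R a₂ b₂) :
    T.SameSide c a₁ a₂ ↔ T'.SameSide c' b₁ b₂ := by
  constructor
  · intro h'
    simpa [hf.agree h₁, hf.agree h₂] using hf.sameSide h h'
  · intro h'
    have := hf'.sameSide (forall₂_flip h) h'
    rwa [hf'.agree h₁, hf'.agree h₂] at this

theorem sameVertex_iff (hf : IsCornerMap T T' R f)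
    (hf' : IsCornerMap T' T (fun b a => R a b) f') {a₁ a₂ : D} {b₁ b₂ : D'}
    (h₁ : R a₁ b₁) (h₂ : R a₂ b₂) : T.SameVertex a₁ a₂ ↔ T'.SameVertex b₁ b₂ := by
  rw [← sameSide_nil, ← sameSide_nil]
  exact sameSide_iff hf hf' .nil h₁ h₂

theorem IsEdgeCycle.transfer (hR : IsMatching T T' R) (hf : IsCornerMap T T' R f)
    (hf' : IsCornerMap T' T (fun b a => R a b) f') {l : List D} {l' : List D'}
    (h : List.Forall₂ R l l') (hc : T.IsEdgeCycle l) : T'.IsEdgeCycle l' := by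
  obtain ⟨h₁, h₂, h₃, h₄⟩ := hc
  have hlen := h.length_eq
  have hget : ∀ i (hi : i < l.length) (hi' : i < l'.length), R l[i] l'[i] := fun i hi hi' =>
    (List.forall₂_iff_get.1 h).2 i hi hi'
  refine ⟨?_, ?_, ?_, ?_⟩
  · rintro rfl
    exact h₁ (List.length_eq_zero_iff.1 (by simpa using hlen))
  · intro i j hi hj hij
    have := h₂ i j (hlen ▸ hi) (hlen ▸ hj) (hlen ▸ hij)
    have h' : T.SameVertex (T.twin l[i]) l[j] := (SameVertex.twin_next T _).symm'.trans' this
    rw [sameVertex_iff hf hf' (hR.twin (hget i (hlen ▸ hi) hi)) (hget j (hlen ▸ hj) hj)] at h'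
    exact (SameVertex.twin_next T' _).trans' h'
  · rw [List.pairwise_iff_getElem] at h₃ ⊢
    intro i j hi hj hij
    rw [← sameVertex_iff hf hf' (hget i (hlen ▸ hi) hi) (hget j (hlen ▸ hj) hj)]
    exact h₃ i j _ _ hij
  · intro b hb hb'
    obtain ⟨a, ha, hab⟩ := exists_of_mem_forall₂ h hb
    exact h₄ a ha ((hR.mem_iff h (hR.twin hab)).2 hb')

theorem IsEdgedMulticurve.transfer (hR : IsMatching T T' R) (hf : IsCornerMap T T' R f)
    (hf' : IsCornerMap T' T (fun b a => R a b) f') {g : ℕ} {α : Fin g → List D}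
    {α' : Fin g → List D'} (h : ∀ i, List.Forall₂ R (α i) (α' i)) (hα : T.IsEdgedMulticurve α) :
    T'.IsEdgedMulticurve α' where
  cycle i := (hα.cycle i).transfer hR hf hf' (h i)
  edge_disjoint i j hij b hb hb' := by
    obtain ⟨a, hab⟩ := hR.exists_of_onCurve (h i) hb
    exact hα.edge_disjoint i j hij a ((hR.onCurve_iff (h i) hab).2 hb)
      ((hR.onCurve_iff (h j) hab).2 hb')
  not_crossing i j hij b₁ b₂ h₁ h₂ hv := by
    obtain ⟨a₁, hab₁⟩ := hR.exists_of_onCurve (h j) h₁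
    obtain ⟨a₂, hab₂⟩ := hR.exists_of_onCurve (h j) h₂
    rw [← sameSide_iff hf hf' (h i) hab₁ hab₂]
    exact hα.not_crossing i j hij a₁ a₂ ((hR.onCurve_iff (h j) hab₁).2 h₁)
      ((hR.onCurve_iff (h j) hab₂).2 h₂) ((sameVertex_iff hf hf' hab₁ hab₂).2 hv)

theorem EdgedComplementConnected.transfer (hf : IsCornerMap T T' R f) {g : ℕ}
    {α : Fin g → List D} {α' : Fin g → List D'} (h : ∀ i, List.Forall₂ R (α i) (α' i))
    (hα : T.EdgedComplementConnected α) : T'.EdgedComplementConnected α' := by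
  intro b₁ b₂
  obtain ⟨a₁, h₁⟩ := hf.surj α' b₁
  obtain ⟨a₂, h₂⟩ := hf.surj α' b₂
  refine h₁.trans' (Relation.EqvGen.trans' ?_ h₂.symm')
  refine Relation.EqvGen.map_of_step (f := f) ?_ (hα a₁ a₂)
  rintro a b (rfl | ⟨hv, hs⟩)
  · exact hf.next h a
  · exact .rel _ _ (.inr ⟨hf.sameVertex hv, fun i => hf.sameSide (h i) (hs i)⟩)

end transfer

end Tri

namespace Tri

variable {D D' : Type}

/-! ### Flips -/

/-- `T'` arises from `T` by the flip of the edge of `d`, and the bijection `e` identifies the darts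
of `T` with those of `T'`. -/
structure IsFlipAlong (T : Tri D) (T' : Tri D') (e : D ≃ D') (d : D) : Prop where
  ne_next : T.twin d ≠ T.next d
  ne_prev : T.twin d ≠ T.prev d
  twin : ∀ y, T'.twin (e y) = e (T.twin y)
  next_d : T'.next (e d) = e (T.prev d)
  next_prev : T'.next (e (T.prev d)) = e (T.next (T.twin d))
  next_next_twin : T'.next (e (T.next (T.twin d))) = e d
  next_twin : T'.next (e (T.twin d)) = e (T.prev (T.twin d))
  next_prev_twin : T'.next (e (T.prev (T.twin d))) = e (T.next d)
  next_next : T'.next (e (T.next d)) = e (T.twin d)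
  next_other : ∀ x, x ≠ d → x ≠ T.next d → x ≠ T.prev d → x ≠ T.twin d →
    x ≠ T.next (T.twin d) → x ≠ T.prev (T.twin d) → T'.next (e x) = e (T.next x)

theorem _root_.IsFlip.isFlipAlong {T T' : Tri D} {d : D} (h : IsFlip T T' d) {T'' : Tri D'}
    {e : D ≃ D'} (hn : ∀ y, T''.next (e y) = e (T'.next y))
    (ht : ∀ y, T''.twin (e y) = e (T'.twin y)) : IsFlipAlong T T'' e d where
  ne_next := h.ne_next
  ne_prev := h.ne_prev
  twin y := by rw [ht, h.twin]
  next_d := by rw [hn, h.next_d]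
  next_prev := by rw [hn, h.next_prev]
  next_next_twin := by rw [hn, h.next_next_twin]
  next_twin := by rw [hn, h.next_twin]
  next_prev_twin := by rw [hn, h.next_prev_twin]
  next_next := by rw [hn, h.next_next]
  next_other x h₁ h₂ h₃ h₄ h₅ h₆ := by rw [hn, h.next_other x h₁ h₂ h₃ h₄ h₅ h₆]

namespace IsFlipAlong

variable {T : Tri D} {T' : Tri D'} {e : D ≃ D'} {d : D}

theorem next_twin_ne (h : IsFlipAlong T T' e d) : T.next (T.twin d) ≠ d := fun h' =>
  h.ne_prev (by rw [← T.prev_next (T.twin d), h'])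

theorem next_twin_ne_next (_h : IsFlipAlong T T' e d) : T.next (T.twin d) ≠ T.next d := fun h' =>
  T.twin_ne d (T.next_injective h')

theorem next_twin_ne_prev (h : IsFlipAlong T T' e d) : T.next (T.twin d) ≠ T.prev d := fun h' =>
  h.ne_next (T.next_injective h')

theorem prev_twin_ne (h : IsFlipAlong T T' e d) : T.prev (T.twin d) ≠ d := fun h' =>
  h.ne_next (by rw [← T.next_prev (T.twin d), h'])

theorem prev_twin_ne_next (h : IsFlipAlong T T' e d) : T.prev (T.twin d) ≠ T.next d := fun h' =>
  h.ne_prev (by rw [← T.next_prev (T.twin d), h', next_next_eq_prev])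

theorem prev_twin_ne_prev (_h : IsFlipAlong T T' e d) : T.prev (T.twin d) ≠ T.prev d := fun h' =>
  T.twin_ne d (by rw [← T.next_prev (T.twin d), h', T.next_prev])

theorem prev_d (h : IsFlipAlong T T' e d) : T'.prev (e d) = e (T.next (T.twin d)) :=
  T'.prev_eq_of_next_eq h.next_next_twin

theorem prev_prev' (h : IsFlipAlong T T' e d) : T'.prev (e (T.prev d)) = e d :=
  T'.prev_eq_of_next_eq h.next_d

theorem prev_next_twin' (h : IsFlipAlong T T' e d) :
    T'.prev (e (T.next (T.twin d))) = e (T.prev d) :=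
  T'.prev_eq_of_next_eq h.next_prev

theorem prev_twin' (h : IsFlipAlong T T' e d) : T'.prev (e (T.twin d)) = e (T.next d) :=
  T'.prev_eq_of_next_eq h.next_next

theorem prev_prev_twin' (h : IsFlipAlong T T' e d) :
    T'.prev (e (T.prev (T.twin d))) = e (T.twin d) :=
  T'.prev_eq_of_next_eq h.next_twin

theorem prev_next' (h : IsFlipAlong T T' e d) : T'.prev (e (T.next d)) = e (T.prev (T.twin d)) :=
  T'.prev_eq_of_next_eq h.next_prev_twin

theorem prev_other (h : IsFlipAlong T T' e d) {x : D} (h₁ : x ≠ d) (h₂ : x ≠ T.next d)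
    (h₃ : x ≠ T.prev d) (h₄ : x ≠ T.twin d) (h₅ : x ≠ T.next (T.twin d))
    (h₆ : x ≠ T.prev (T.twin d)) : T'.prev (e x) = e (T.prev x) := by
  apply T'.prev_eq_of_next_eq
  rw [h.next_other, T.next_prev] <;> intro h'
  · exact h₂ (by rw [← h', T.next_prev])
  · exact h₃ (by rw [← T.next_prev x, h', next_next_eq_prev])
  · exact h₁ (by rw [← T.next_prev x, h', T.next_prev])
  · exact h₅ (by rw [← h', T.next_prev])
  · exact h₆ (by rw [← T.next_prev x, h', next_next_eq_prev])
  · exact h₄ (by rw [← T.next_prev x, h', T.next_prev])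

open Classical in
/-- Flipping back turns the diagonal by half a turn, so that it interchanges its two darts. -/
theorem symm (h : IsFlipAlong T T' e d) :
    IsFlipAlong T' T (e.symm.trans (Equiv.swap d (T.twin d))) (e d) := by
  have s₁ : ∀ x, x ≠ d → x ≠ T.twin d → Equiv.swap d (T.twin d) x = x := fun x =>
    Equiv.swap_apply_of_ne_of_ne
  have hn := s₁ _ (T.next_ne d) h.ne_next.symm
  have hp := s₁ _ (T.prev_ne d) h.ne_prev.symm
  have htn := s₁ _ h.next_twin_ne (T.next_ne _)
  have htp := s₁ _ h.prev_twin_ne (T.prev_ne _)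
  constructor
  · rw [h.twin, h.next_d]; exact fun h' => h.ne_prev (e.injective h')
  · rw [h.twin, h.prev_d]; exact fun h' => T.next_ne _ (e.injective h').symm
  · intro y
    obtain ⟨z, rfl⟩ := e.surjective y
    rw [h.twin]
    simp only [Equiv.trans_apply, Equiv.symm_apply_apply]
    by_cases h₁ : z = d
    · subst h₁; simp
    by_cases h₂ : z = T.twin d
    · subst h₂; simp
    rw [s₁ z h₁ h₂, s₁ _ (fun h' => h₂ (by rw [← h', T.twin_twin]))
      (fun h' => h₁ (T.twin_injective h'))]
  · simp [h.prev_d, htn]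
  · simp [h.prev_d, h.twin, h.next_twin, htn, htp, next_next_eq_prev]
  · simp [h.twin, h.next_twin, htp]
  · simp [h.twin, h.prev_twin', hn]
  · simp [h.twin, h.prev_twin', h.next_d, hn, hp, next_next_eq_prev]
  · simp [h.twin, h.next_d, hp]
  · intro y h₁ h₂ h₃ h₄ h₅ h₆
    obtain ⟨z, rfl⟩ := e.surjective y
    rw [h.next_d] at h₂
    rw [h.prev_d] at h₃
    rw [h.twin] at h₄ h₅ h₆
    rw [h.next_twin] at h₅
    rw [h.prev_twin'] at h₆
    have h₁ := fun h' => h₁ (congrArg e h')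
    have h₂ := fun h' => h₂ (congrArg e h')
    have h₃ := fun h' => h₃ (congrArg e h')
    have h₄ := fun h' => h₄ (congrArg e h')
    have h₅ := fun h' => h₅ (congrArg e h')
    have h₆ := fun h' => h₆ (congrArg e h')
    rw [h.next_other z h₁ h₆ h₂ h₄ h₃ h₅]
    simp only [Equiv.trans_apply, Equiv.symm_apply_apply]
    rw [s₁ z h₁ h₄, s₁]
    · exact fun h' => h₂ (by rw [← h', prev_next])
    · exact fun h' => h₅ (by rw [← h', prev_next])

theorem isMatching (h : IsFlipAlong T T' e d) :
    IsMatching T T' (fun a b => b = e a ∧ a ≠ d ∧ a ≠ T.twin d) where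
  right_unique h₁ h₂ := h₁.1.trans h₂.1.symm
  left_unique h₁ h₂ := e.injective (h₁.1.symm.trans h₂.1)
  twin := by
    rintro a b ⟨rfl, h₁, h₂⟩
    exact ⟨h.twin a, fun h' => h₂ (by rw [← h', T.twin_twin]), fun h' => h₁ (T.twin_injective h')⟩

open Classical in
/-- The two darts of the diagonal are sent to sides of the quadrilateral with the same corner. -/
noncomputable def cornerMap (T : Tri D) (e : D ≃ D') (d : D) (a : D) : D' :=
  if a = d then e (T.next (T.twin d)) else if a = T.twin d then e (T.next d) else e a

theorem cornerMap_d (T : Tri D) (e : D ≃ D') (d : D) :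
    cornerMap T e d d = e (T.next (T.twin d)) := if_pos rfl

theorem cornerMap_twin (T : Tri D) (e : D ≃ D') (d : D) :
    cornerMap T e d (T.twin d) = e (T.next d) := by
  rw [cornerMap, if_neg (T.twin_ne d), if_pos rfl]

theorem cornerMap_of_ne (T : Tri D) (e : D ≃ D') {a d : D} (h₁ : a ≠ d) (h₂ : a ≠ T.twin d) :
    cornerMap T e d a = e a := by
  rw [cornerMap, if_neg h₁, if_neg h₂]

/-- Every dart is a side of the quadrilateral, of the diagonal, or of another triangle. -/
theorem cases (T : Tri D) (d : D) (P : D → Prop) (h₁ : P d) (h₂ : P (T.next d)) (h₃ : P (T.prev d))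
    (h₄ : P (T.twin d)) (h₅ : P (T.next (T.twin d))) (h₆ : P (T.prev (T.twin d)))
    (h : ∀ x, x ≠ d → x ≠ T.next d → x ≠ T.prev d → x ≠ T.twin d →
      x ≠ T.next (T.twin d) → x ≠ T.prev (T.twin d) → P x) (a : D) : P a := by
  by_cases e₁ : a = d
  · rwa [e₁]
  by_cases e₂ : a = T.next d
  · rwa [e₂]
  by_cases e₃ : a = T.prev d
  · rwa [e₃]
  by_cases e₄ : a = T.twin d
  · rwa [e₄]
  by_cases e₅ : a = T.next (T.twin d)
  · rwa [e₅]
  by_cases e₆ : a = T.prev (T.twin d)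
  · rwa [e₆]
  exact h a e₁ e₂ e₃ e₄ e₅ e₆

theorem isCornerMap (h : IsFlipAlong T T' e d) :
    IsCornerMap T T' (fun a b => b = e a ∧ a ≠ d ∧ a ≠ T.twin d) (cornerMap T e d) := by
  have fn := cornerMap_of_ne T e (T.next_ne d) h.ne_next.symm
  have fp := cornerMap_of_ne T e (T.prev_ne d) h.ne_prev.symm
  have ftn := cornerMap_of_ne T e h.next_twin_ne (T.next_ne _)
  have ftp := cornerMap_of_ne T e h.prev_twin_ne (T.prev_ne _)
  have off : ∀ {c c'}, List.Forall₂ (fun a b => b = e a ∧ a ≠ d ∧ a ≠ T.twin d) c c' →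
      ¬ T'.OnCurve c' (e d) ∧ ¬ T'.OnCurve c' (e (T.twin d)) := fun hc => by
    constructor <;> intro h' <;> obtain ⟨a, ha, h₁, h₂⟩ := h.isMatching.exists_of_onCurve hc h'
    · exact h₁ (e.injective ha).symm
    · exact h₂ (e.injective ha).symm
  -- one step around a vertex of `T'`, across a dart that is kept
  have one : ∀ {c c'}, List.Forall₂ (fun a b => b = e a ∧ a ≠ d ∧ a ≠ T.twin d) c c' →
      ∀ {a : D} {b : D'}, a ≠ d → a ≠ T.twin d → ¬ T.OnCurve c a →
      T'.rot b = e a → T'.SameSide c' b (e a) := by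
    intro c c' hc a b h₁ h₂ ha hb
    refine .rel _ _ ⟨hb.symm, fun h' => ha ?_⟩
    exact (h.isMatching.onCurve_iff hc ⟨rfl, h₁, h₂⟩).2 h'
  have twin_ne₁ : ∀ {a}, a ≠ T.twin d → T.twin a ≠ d := fun h' h'' =>
    h' (by rw [← h'', T.twin_twin])
  have twin_ne₂ : ∀ {a}, a ≠ d → T.twin a ≠ T.twin d := fun h' h'' => h' (T.twin_injective h'')
  refine ⟨?_, ?_, ?_, ?_⟩
  · rintro a b ⟨rfl, h₁, h₂⟩
    exact cornerMap_of_ne T e h₁ h₂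
  · intro c c' hc a
    have off' := off hc
    have one' := @one c c' hc
    refine cases T d (fun a => ¬ T.OnCurve c (T.rot a) →
      T'.SameSide c' (cornerMap T e d a) (cornerMap T e d (T.rot a))) ?_ ?_ ?_ ?_ ?_ ?_ ?_ a
    · intro ha
      rw [rot] at ha ⊢
      rw [cornerMap_of_ne T e (twin_ne₁ h.ne_prev.symm) (twin_ne₂ (T.prev_ne d)), cornerMap_d]
      refine one' (twin_ne₁ h.ne_prev.symm) (twin_ne₂ (T.prev_ne d)) ha ?_
      rw [rot, h.prev_next_twin', h.twin]
    · intro _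
      rw [rot, prev_next, cornerMap_twin, fn]
      exact .refl _
    · intro ha
      rw [rot, prev_prev] at ha ⊢
      rw [fp, cornerMap_of_ne T e (twin_ne₁ h.ne_next.symm) (twin_ne₂ (T.next_ne d))]
      refine Relation.EqvGen.trans' (b := e (T.twin d)) (.rel _ _ ⟨?_, off'.2⟩)
        (one' (twin_ne₁ h.ne_next.symm) (twin_ne₂ (T.next_ne d)) ha ?_)
      · rw [rot, h.prev_prev', h.twin]
      · rw [rot, h.prev_twin', h.twin]
    · intro ha
      rw [rot] at ha ⊢
      rw [cornerMap_of_ne T e (twin_ne₁ (T.prev_ne _)) (twin_ne₂ h.prev_twin_ne), cornerMap_twin]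
      refine one' (twin_ne₁ (T.prev_ne _)) (twin_ne₂ h.prev_twin_ne) ha ?_
      rw [rot, h.prev_next', h.twin]
    · intro _
      rw [rot, prev_next, T.twin_twin, cornerMap_d, ftn]
      exact .refl _
    · intro ha
      rw [rot, prev_prev] at ha ⊢
      rw [ftp, cornerMap_of_ne T e (twin_ne₁ (T.next_ne _)) (twin_ne₂ h.next_twin_ne)]
      refine Relation.EqvGen.trans' (b := e d) (.rel _ _ ⟨?_, off'.1⟩)
        (one' (twin_ne₁ (T.next_ne _)) (twin_ne₂ h.next_twin_ne) ha ?_)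
      · rw [rot, h.prev_prev_twin', h.twin, T.twin_twin]
      · rw [rot, h.prev_d, h.twin]
    · intro x h₁ h₂ h₃ h₄ h₅ h₆ ha
      rw [rot] at ha ⊢
      have h₇ : T.prev x ≠ T.twin d := fun h' => h₅ (by rw [← h', T.next_prev])
      have h₈ : T.prev x ≠ d := fun h' => h₂ (by rw [← h', T.next_prev])
      rw [cornerMap_of_ne T e h₁ h₄, cornerMap_of_ne T e (twin_ne₁ h₇) (twin_ne₂ h₈)]
      refine one' (twin_ne₁ h₇) (twin_ne₂ h₈) ha ?_
      rw [rot, h.prev_other h₁ h₂ h₃ h₄ h₅ h₆, h.twin]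
  · intro g α α' hα
    have l₁ : T'.EdgedLinked α' (e d) (e (T.prev d)) := .rel _ _ (.inl h.next_d.symm)
    have l₂ : T'.EdgedLinked α' (e (T.prev d)) (e (T.next (T.twin d))) :=
      .rel _ _ (.inl h.next_prev.symm)
    have l₃ : T'.EdgedLinked α' (e (T.twin d)) (e (T.prev (T.twin d))) :=
      .rel _ _ (.inl h.next_twin.symm)
    have l₄ : T'.EdgedLinked α' (e (T.prev (T.twin d))) (e (T.next d)) :=
      .rel _ _ (.inl h.next_prev_twin.symm)
    -- the two triangles meet along the new diagonal, which lies on no component of the multicurve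
    have l₅ : T'.EdgedLinked α' (e (T.prev d)) (e (T.twin d)) := by
      have : e (T.twin d) = T'.rot (e (T.prev d)) := by rw [rot, h.prev_prev', h.twin]
      exact .rel _ _ (.inr ⟨.rel _ _ this, fun i => .rel _ _ ⟨this, (off (hα i)).2⟩⟩)
    refine cases T d (fun a => T'.EdgedLinked α' (cornerMap T e d a)
      (cornerMap T e d (T.next a))) ?_ ?_ ?_ ?_ ?_ ?_ ?_
    · rw [cornerMap_d, fn]
      exact l₂.symm'.trans' (l₅.trans' (l₃.trans' l₄))
    · rw [next_next_eq_prev, fn, fp]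
      exact (l₅.trans' (l₃.trans' l₄)).symm'
    · rw [T.next_prev, fp, cornerMap_d]
      exact l₂
    · rw [cornerMap_twin, ftn]
      exact (l₂.symm'.trans' (l₅.trans' (l₃.trans' l₄))).symm'
    · rw [next_next_eq_prev, ftn, ftp]
      exact l₂.symm'.trans' (l₅.trans' l₃)
    · rw [T.next_prev, ftp, cornerMap_twin]
      exact l₄
    · intro x h₁ h₂ h₃ h₄ h₅ h₆
      rw [cornerMap_of_ne T e h₁ h₄, cornerMap_of_ne T e (fun h' => h₃ (by rw [← h', prev_next]))
        (fun h' => h₆ (by rw [← h', prev_next]))]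
      exact .rel _ _ (.inl (h.next_other x h₁ h₂ h₃ h₄ h₅ h₆).symm)
  · intro g α' b
    obtain ⟨a, rfl⟩ := e.surjective b
    by_cases h₁ : a = d
    · exact ⟨T.prev d, by rw [fp, h₁]; exact .rel _ _ (.inl h.next_d.symm)⟩
    by_cases h₂ : a = T.twin d
    · exact ⟨T.prev (T.twin d), by rw [ftp, h₂]; exact .rel _ _ (.inl h.next_twin.symm)⟩
    exact ⟨a, by rw [cornerMap_of_ne T e h₁ h₂]; exact .refl _⟩

/-- The partial bijection of the reverse flip is the reverse one. -/
theorem matching_symm (h : IsFlipAlong T T' e d) :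
    ∃ e' : D' ≃ D, IsFlipAlong T' T e' (e d) ∧
      (fun (b : D') (a : D) => a = e' b ∧ b ≠ e d ∧ b ≠ T'.twin (e d)) =
        (fun b a => b = e a ∧ a ≠ d ∧ a ≠ T.twin d) := by
  classical
  refine ⟨_, h.symm, ?_⟩
  funext b a
  obtain ⟨z, rfl⟩ := e.surjective b
  simp only [Equiv.trans_apply, Equiv.symm_apply_apply, h.twin, ne_eq, e.injective.eq_iff, eq_iff_iff]
  constructor
  · rintro ⟨rfl, h₁, h₂⟩
    rw [Equiv.swap_apply_of_ne_of_ne h₁ h₂]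
    exact ⟨rfl, h₁, h₂⟩
  · rintro ⟨rfl, h₁, h₂⟩
    rw [Equiv.swap_apply_of_ne_of_ne h₁ h₂]
    exact ⟨rfl, h₁, h₂⟩

theorem exists_isCornerMap_symm (h : IsFlipAlong T T' e d) :
    ∃ f, IsCornerMap T' T (fun b a => b = e a ∧ a ≠ d ∧ a ≠ T.twin d) f := by
  obtain ⟨e', h', hR⟩ := h.matching_symm
  exact ⟨_, hR ▸ h'.isCornerMap⟩

theorem sameVertex_cornerMap (h : IsFlipAlong T T' e d) (a : D) :
    ∃ a', a' ≠ d ∧ a' ≠ T.twin d ∧ cornerMap T e d a = e a' ∧ T.SameVertex a' a := by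
  by_cases h₁ : a = d
  · refine ⟨_, h.next_twin_ne, T.next_ne _, by rw [h₁, cornerMap_d], ?_⟩
    exact .rel _ _ (by rw [rot, prev_next, T.twin_twin, h₁])
  by_cases h₂ : a = T.twin d
  · refine ⟨_, T.next_ne _, h.ne_next.symm, by rw [h₂, cornerMap_twin], ?_⟩
    exact .rel _ _ (by rw [rot, prev_next, h₂])
  exact ⟨a, h₁, h₂, cornerMap_of_ne T e h₁ h₂, .refl _⟩

theorem numVertices_eq (h : IsFlipAlong T T' e d) [Finite D] : T'.numVertices = T.numVertices := by
  have : Finite D' := Finite.of_equiv D e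
  have key : ∀ {E E' : Type} [Finite E] [Finite E'] {S : Tri E} {S' : Tri E'} {i : E ≃ E'} {x : E},
      IsFlipAlong S S' i x → S.numVertices ≤ S'.numVertices := by
    intro E E' _ _ S S' i x hS
    obtain ⟨f, hf⟩ := hS.exists_isCornerMap_symm
    have hf' := hS.isCornerMap
    have : Finite (Quot fun a b => b = S'.rot a) := Quot.finite _
    refine Nat.card_le_card_of_injective
      (Quot.lift (fun a => Quot.mk (fun a b => b = S'.rot a) (cornerMap S i x a)) ?_) ?_
    · rintro a b hb
      exact Quot.eq.2 (hf'.sameVertex (.rel _ _ hb))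
    · rintro ⟨a⟩ ⟨b⟩ hab
      obtain ⟨a', h₁, h₂, h₃, h₄⟩ := hS.sameVertex_cornerMap a
      obtain ⟨b', h₁', h₂', h₃', h₄'⟩ := hS.sameVertex_cornerMap b
      have hab' : S'.SameVertex (i a') (i b') := by rw [← h₃, ← h₃']; exact Quot.eq.1 hab
      exact Quot.eq.2 (h₄.symm'.trans' (Relation.EqvGen.trans'
        ((sameVertex_iff hf' hf ⟨rfl, h₁, h₂⟩ ⟨rfl, h₁', h₂'⟩).2 hab') h₄'))
  exact le_antisymm (key h.symm) (key h)

theorem connected (h : IsFlipAlong T T' e d) (hT : T.Connected) : T'.Connected := by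
  refine ⟨hT.1.map e, fun b₁ b₂ => ?_⟩
  obtain ⟨a₁, rfl⟩ := e.surjective b₁
  obtain ⟨a₂, rfl⟩ := e.surjective b₂
  refine Relation.EqvGen.map_of_step (f := e) ?_ (hT.2 a₁ a₂)
  have t : ∀ a, Relation.EqvGen (fun a b => b = T'.next a ∨ b = T'.twin a) (e a) (e (T.twin a)) :=
    fun a => .rel _ _ (.inr (h.twin a).symm)
  have n : ∀ {a b : D}, T'.next (e a) = e b →
    Relation.EqvGen (fun a b => b = T'.next a ∨ b = T'.twin a) (e a) (e b) :=
    fun h => .rel _ _ (.inl h.symm)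
  have l₁ := n h.next_d
  have l₂ := n h.next_prev
  have l₃ := n h.next_twin
  have l₄ := n h.next_prev_twin
  have l₅ := t d
  rintro a b (rfl | rfl)
  · refine cases T d (fun a => Relation.EqvGen (fun a b => b = T'.next a ∨ b = T'.twin a) (e a)
      (e (T.next a))) ?_ ?_ ?_ ?_ ?_ ?_ ?_ a
    · exact l₅.trans' (l₃.trans' l₄)
    · exact (l₅.trans' (l₃.trans' l₄)).symm'.trans' l₁
    · rw [T.next_prev]
      exact l₂.trans' (n h.next_next_twin)
    · exact l₅.symm'.trans' (l₁.trans' l₂)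
    · exact (l₁.trans' l₂).symm'.trans' (l₅.trans' l₃)
    · rw [T.next_prev]
      exact l₄.trans' (n h.next_next)
    · intro x h₁ h₂ h₃ h₄ h₅ h₆
      exact n (h.next_other x h₁ h₂ h₃ h₄ h₅ h₆)
  · exact t a

theorem hasGenus [Fintype D] [Fintype D'] (h : IsFlipAlong T T' e d) {g : ℕ} (hT : T.HasGenus g) :
    T'.HasGenus g := by
  refine ⟨h.connected hT.1, ?_⟩
  have := hT.2
  have h₁ := T.numEdges_mul_two
  have h₂ := T'.numEdges_mul_two
  have h₃ := T.numFaces_mul_three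
  have h₄ := T'.numFaces_mul_three
  have h₅ := h.numVertices_eq
  have h₆ := Fintype.card_congr e
  omega

end IsFlipAlong

end Tri

/-! ### Subdivisions -/

namespace IsSubdivision

variable {D D' : Type} {T : Tri D} {T' : Tri D'} {x : D} {ι : D → D'} {s : Fin 3 → D'}

theorem injective (h : IsSubdivision T T' x ι s) : Function.Injective ι := fun a b hab => by
  simpa using h.bijective.1 (a₁ := .inl a) (a₂ := .inl b) hab

theorem spoke_injective (h : IsSubdivision T T' x ι s) : Function.Injective s := fun a b hab => by
  simpa using h.bijective.1 (a₁ := .inr (.inl a)) (a₂ := .inr (.inl b)) hab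

theorem ne_spoke (h : IsSubdivision T T' x ι s) (y : D) (k : Fin 3) : ι y ≠ s k := fun hab => by
  simpa using h.bijective.1 (a₁ := .inl y) (a₂ := .inr (.inl k)) hab

theorem ne_twin_spoke (h : IsSubdivision T T' x ι s) (y : D) (k : Fin 3) : ι y ≠ T'.twin (s k) :=
  fun hab => by simpa using h.bijective.1 (a₁ := .inl y) (a₂ := .inr (.inr k)) hab

theorem spoke_ne_twin (h : IsSubdivision T T' x ι s) (j k : Fin 3) : s j ≠ T'.twin (s k) :=
  fun hab => by simpa using h.bijective.1 (a₁ := .inr (.inl j)) (a₂ := .inr (.inr k)) hab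

theorem cases (h : IsSubdivision T T' x ι s) {P : D' → Prop} (h₁ : ∀ y, P (ι y))
    (h₂ : ∀ k, P (s k)) (h₃ : ∀ k, P (T'.twin (s k))) (b : D') : P b := by
  obtain ⟨y | k | k, rfl⟩ := h.bijective.2 b
  · exact h₁ y
  · exact h₂ k
  · exact h₃ k

theorem iterate_succ (_h : IsSubdivision T T' x ι s) (k : Fin 3) :
    T.next^[(k + 1 : Fin 3)] x = T.next (T.next^[k] x) := by
  fin_cases k
  · rfl
  · rfl
  · exact (T.next_next_next x).symm

theorem eq_iterate_or (_h : IsSubdivision T T' x ι s) (y : D) :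
    (∃ k : Fin 3, y = T.next^[k] x) ∨ (y ≠ x ∧ y ≠ T.next x ∧ y ≠ T.prev x) := by
  by_cases h₀ : y = x
  · exact .inl ⟨0, h₀⟩
  by_cases h₁ : y = T.next x
  · exact .inl ⟨1, h₁⟩
  by_cases h₂ : y = T.prev x
  · exact .inl ⟨2, h₂⟩
  exact .inr ⟨h₀, h₁, h₂⟩

theorem prev_side (h : IsSubdivision T T' x ι s) (k : Fin 3) :
    T'.prev (ι (T.next^[k] x)) = s k :=
  T'.prev_eq_of_next_eq (h.next_spoke k)

theorem prev_twin_spoke_succ (h : IsSubdivision T T' x ι s) (k : Fin 3) :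
    T'.prev (T'.twin (s (k + 1))) = ι (T.next^[k] x) :=
  T'.prev_eq_of_next_eq (h.next_side k)

theorem prev_twin_spoke (h : IsSubdivision T T' x ι s) (k : Fin 3) :
    T'.prev (T'.twin (s k)) = ι (T.prev (T.next^[k] x)) := by
  have := h.prev_twin_spoke_succ (k + 2)
  have e := h.iterate_succ (k + 2)
  rw [show k + 2 + 1 = k by omega] at this e
  rw [this, e, T.prev_next]

theorem prev_spoke (h : IsSubdivision T T' x ι s) (k : Fin 3) :
    T'.prev (s k) = T'.twin (s (k + 1)) :=
  T'.prev_eq_of_next_eq (h.next_twin_spoke k)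

theorem prev_other (h : IsSubdivision T T' x ι s) {y : D} (h₀ : y ≠ x) (h₁ : y ≠ T.next x)
    (h₂ : y ≠ T.prev x) : T'.prev (ι y) = ι (T.prev y) := by
  apply T'.prev_eq_of_next_eq
  rw [h.next_other, T.next_prev] <;> intro h'
  · exact h₁ (by rw [← h', T.next_prev])
  · exact h₂ (by rw [← T.next_prev y, h', T.next_next_eq_prev])
  · exact h₀ (by rw [← T.next_prev y, h', T.next_prev])

theorem rotate (h : IsSubdivision T T' x ι s) :
    IsSubdivision T T' (T.next x) ι (fun k => s (k + 1)) where
  bijective := by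
    have : (Sum.elim ι (Sum.elim (fun k => s (k + 1)) (fun k => T'.twin (s (k + 1))))) =
        Sum.elim ι (Sum.elim s (fun k => T'.twin (s k))) ∘
          (Equiv.sumCongr (Equiv.refl D) (Equiv.sumCongr (Equiv.addRight 1) (Equiv.addRight 1))) := by
      funext y
      rcases y with y | k | k <;> rfl
    rw [this]
    exact h.bijective.comp (Equiv.bijective _)
  twin := h.twin
  next_spoke k := by
    rw [h.next_spoke, h.iterate_succ, ← Function.iterate_succ_apply' T.next,
      Function.iterate_succ_apply]
  next_side k := by
    rw [← Function.iterate_succ_apply, Function.iterate_succ_apply', ← h.iterate_succ, h.next_side]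
  next_twin_spoke k := h.next_twin_spoke (k + 1)
  next_other y h₀ h₁ h₂ := h.next_other y (by rwa [T.prev_next] at h₂) h₀ h₁

theorem isMatching (h : IsSubdivision T T' x ι s) : T.IsMatching T' (fun a b => b = ι a) where
  right_unique h₁ h₂ := h₁.trans h₂.symm
  left_unique h₁ h₂ := h.injective (h₁.symm.trans h₂)
  twin := by rintro a _ rfl; exact h.twin a

/-- The spokes do not belong to the domain of the matching. -/
theorem not_onCurve (h : IsSubdivision T T' x ι s) {c : List D} {c' : List D'}
    (hc : List.Forall₂ (fun a b => b = ι a) c c') (k : Fin 3) :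
    ¬ T'.OnCurve c' (T'.twin (s k)) := fun h' => by
  obtain ⟨a, ha⟩ := h.isMatching.exists_of_onCurve hc h'
  exact h.ne_twin_spoke a k ha.symm

theorem isCornerMap (h : IsSubdivision T T' x ι s) :
    T.IsCornerMap T' (fun a b => b = ι a) ι := by
  refine ⟨fun h => h.symm, ?_, ?_, ?_⟩
  · intro c c' hc y hy
    have hy' : ¬ T'.OnCurve c' (ι (T.rot y)) := fun h' => hy ((h.isMatching.onCurve_iff hc rfl).2 h')
    rcases h.eq_iterate_or y with ⟨k, rfl⟩ | ⟨h₀, h₁, h₂⟩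
    · refine Relation.EqvGen.trans' (b := T'.twin (s k)) (.rel _ _ ⟨?_, h.not_onCurve hc k⟩)
        (.rel _ _ ⟨?_, hy'⟩)
      · rw [Tri.rot, h.prev_side]
      · rw [Tri.rot, Tri.rot, h.prev_twin_spoke, h.twin]
    · exact .rel _ _ ⟨by rw [Tri.rot, Tri.rot, h.prev_other h₀ h₁ h₂, h.twin], hy'⟩
  · intro g α α' hα y
    rcases h.eq_iterate_or y with ⟨k, rfl⟩ | ⟨h₀, h₁, h₂⟩
    · refine Relation.EqvGen.trans' (b := T'.twin (s (k + 1))) (.rel _ _ (.inl (h.next_side k).symm)) ?_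
      rw [← h.iterate_succ]
      have : T'.twin (s (k + 1)) = T'.rot (ι (T.next^[(k + 1 : Fin 3)] x)) := by
        rw [Tri.rot, h.prev_side]
      exact .symm _ _ (.rel _ _ (.inr
        ⟨.rel _ _ this, fun i => .rel _ _ ⟨this, h.not_onCurve (hα i) (k + 1)⟩⟩))
    · exact .rel _ _ (.inl (h.next_other y h₀ h₁ h₂).symm)
  · intro g α' b
    refine h.cases (P := fun b => ∃ a, T'.EdgedLinked α' b (ι a)) ?_ ?_ ?_ b
    · exact fun y => ⟨y, .refl _⟩
    · exact fun k => ⟨_, .rel _ _ (.inl (h.next_spoke k).symm)⟩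
    · refine fun k => ⟨T.next^[(k + 2 : Fin 3)] x, .symm _ _ (.rel _ _ (.inl ?_))⟩
      rw [h.next_side, show k + 2 + 1 = k by omega]

/-- Functions on the darts of the subdivision, by cases: `f` on the old darts, `u` on the spokes and
`w` on their twins. -/
noncomputable def elim {X : Type*} (h : IsSubdivision T T' x ι s) (f : D → X) (u w : Fin 3 → X)
    (b : D') : X :=
  Sum.elim f (Sum.elim u w) ((Equiv.ofBijective _ h.bijective).symm b)

section elim

variable {X : Type*} (h : IsSubdivision T T' x ι s) (f : D → X) (u w : Fin 3 → X)

@[simp] theorem elim_side (y : D) : h.elim f u w (ι y) = f y := by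
  have : (Equiv.ofBijective _ h.bijective).symm (ι y) = .inl y :=
    (Equiv.symm_apply_eq _).2 rfl
  rw [elim, this]
  rfl

@[simp] theorem elim_spoke (k : Fin 3) : h.elim f u w (s k) = u k := by
  have : (Equiv.ofBijective _ h.bijective).symm (s k) = .inr (.inl k) :=
    (Equiv.symm_apply_eq _).2 rfl
  rw [elim, this]
  rfl

@[simp] theorem elim_twin (k : Fin 3) : h.elim f u w (T'.twin (s k)) = w k := by
  have : (Equiv.ofBijective _ h.bijective).symm (T'.twin (s k)) = .inr (.inr k) :=
    (Equiv.symm_apply_eq _).2 rfl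
  rw [elim, this]
  rfl

end elim

/-- The map that removes the new vertex: the corners at this vertex and at the new edges are sent
to corners of the subdivided triangle. -/
noncomputable def cornerMap (h : IsSubdivision T T' x ι s) : D' → D :=
  h.elim id (fun _ => x) (fun k => T.next^[k] x)

theorem cornerMap_side (h : IsSubdivision T T' x ι s) (y : D) : h.cornerMap (ι y) = y :=
  h.elim_side _ _ _ y

theorem cornerMap_spoke (h : IsSubdivision T T' x ι s) (k : Fin 3) : h.cornerMap (s k) = x :=
  h.elim_spoke _ _ _ k

theorem cornerMap_twin (h : IsSubdivision T T' x ι s) (k : Fin 3) :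
    h.cornerMap (T'.twin (s k)) = T.next^[k] x :=
  h.elim_twin _ _ _ k

theorem isCornerMap_symm (h : IsSubdivision T T' x ι s) :
    T'.IsCornerMap T (fun b a => b = ι a) h.cornerMap := by
  refine ⟨?_, ?_, ?_, ?_⟩
  · rintro _ a rfl
    exact h.cornerMap_side a
  · intro c' c hc b
    have one : ∀ y : D, ¬ T'.OnCurve c' (ι y) → ¬ T.OnCurve c y := fun y hy h' =>
      hy ((h.isMatching.symm.onCurve_iff hc rfl).2 h')
    refine h.cases (P := fun b => ¬ T'.OnCurve c' (T'.rot b) →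
      T.SameSide c (h.cornerMap b) (h.cornerMap (T'.rot b))) ?_ ?_ ?_ b
    · intro y
      rcases h.eq_iterate_or y with ⟨k, rfl⟩ | ⟨h₀, h₁, h₂⟩
      · intro _
        rw [Tri.rot, h.prev_side, cornerMap_twin, cornerMap_side]
        exact .refl _
      · rw [Tri.rot, h.prev_other h₀ h₁ h₂, h.twin, cornerMap_side, cornerMap_side]
        exact fun hy => .rel _ _ ⟨rfl, one _ hy⟩
    · intro k _
      rw [Tri.rot, h.prev_spoke, T'.twin_twin, cornerMap_spoke, cornerMap_spoke]
      exact .refl _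
    · intro k
      rw [Tri.rot, h.prev_twin_spoke, h.twin, cornerMap_twin, cornerMap_side]
      exact fun hy => .rel _ _ ⟨rfl, one _ hy⟩
  · intro g α' α _ b
    have l : ∀ k : Fin 3, T.EdgedLinked α x (T.next^[k] x) := by
      have l₁ : T.EdgedLinked α x (T.next x) := .rel _ _ (.inl rfl)
      intro k
      fin_cases k
      · exact .refl _
      · exact l₁
      · exact l₁.trans' (.rel _ _ (.inl rfl))
    refine h.cases (P := fun b => T.EdgedLinked α (h.cornerMap b) (h.cornerMap (T'.next b)))
      ?_ ?_ ?_ b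
    · intro y
      rcases h.eq_iterate_or y with ⟨k, rfl⟩ | ⟨h₀, h₁, h₂⟩
      · rw [h.next_side, cornerMap_twin, cornerMap_side]
        exact (l _).symm'.trans' (l _)
      · rw [h.next_other y h₀ h₁ h₂, cornerMap_side, cornerMap_side]
        exact .rel _ _ (.inl rfl)
    · intro k
      rw [h.next_spoke, cornerMap_spoke, cornerMap_side]
      exact l k
    · intro k
      have := h.next_twin_spoke (k + 2)
      rw [show k + 2 + 1 = k by omega] at this
      rw [this, cornerMap_spoke, cornerMap_twin]
      exact (l k).symm'
  · exact fun α' y => ⟨ι y, by rw [h.cornerMap_side]; exact .refl _⟩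

/-- The darts that start at the new vertex are the spokes. -/
theorem sameVertex_spoke (h : IsSubdivision T T' x ι s) {b : D'} {k : Fin 3} :
    T'.SameVertex (s k) b ↔ ∃ j, b = s j := by
  constructor
  · intro h'
    have : (∃ j, s k = s j) = ∃ j, b = s j := by
      refine Relation.EqvGen.eq_of_step (f := fun b => ∃ j, b = s j) ?_ h'
      rintro b _ rfl
      simp only [eq_iff_iff]
      constructor
      · rintro ⟨j, rfl⟩
        exact ⟨j + 1, by rw [Tri.rot, h.prev_spoke, T'.twin_twin]⟩
      · rintro ⟨j, hj⟩
        refine ⟨j + 2, ?_⟩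
        have e : T'.prev (s (j + 2)) = T'.twin (s j) := by
          rw [h.prev_spoke, show j + 2 + 1 = j by omega]
        have hj' : T'.prev b = T'.twin (s j) := by rw [← hj, Tri.rot, T'.twin_twin]
        rw [← T'.next_prev b, hj', ← e, T'.next_prev]
    exact this.mp ⟨k, rfl⟩
  · rintro ⟨j, rfl⟩
    have l : ∀ j : Fin 3, T'.SameVertex (s j) (s (j + 1)) := fun j =>
      .rel _ _ (by rw [Tri.rot, h.prev_spoke, T'.twin_twin])
    have l' : ∀ j : Fin 3, T'.SameVertex (s 0) (s j) := by
      intro j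
      fin_cases j
      · exact .refl _
      · exact l 0
      · exact (l 0).trans' (l 1)
    exact (l' k).symm'.trans' (l' j)

theorem sameVertex_twin_spoke (h : IsSubdivision T T' x ι s) (k : Fin 3) :
    T'.SameVertex (T'.twin (s k)) (ι (T.next^[k] x)) :=
  .symm _ _ (.rel _ _ (by rw [Tri.rot, h.prev_side]))

theorem numVertices_eq (h : IsSubdivision T T' x ι s) [Finite D] [Finite D'] :
    T'.numVertices = T.numVertices + 1 := by
  have : Finite (Quot fun a b => b = T'.rot a) := Quot.finite _
  have : Finite (Quot fun a b => b = T.rot a) := Quot.finite _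
  let F : Option (Quot fun a b => b = T.rot a) → Quot fun a b => b = T'.rot a := fun o =>
    o.elim (Quot.mk _ (s 0)) (Quot.lift (fun a => Quot.mk _ (ι a))
      (fun a b hab => Quot.eq.2 (h.isCornerMap.sameVertex (.rel _ _ hab))))
  have hF : Function.Bijective F := by
    constructor
    · rintro (_ | ⟨⟨a⟩⟩) (_ | ⟨⟨b⟩⟩) hab
      · rfl
      · obtain ⟨j, hj⟩ := h.sameVertex_spoke.1 (Quot.eq.1 hab)
        exact (h.ne_spoke _ _ hj).elim
      · obtain ⟨j, hj⟩ := h.sameVertex_spoke.1 (Quot.eq.1 hab).symm'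
        exact (h.ne_spoke _ _ hj).elim
      · exact congrArg some (Quot.eq.2
          ((Tri.sameVertex_iff h.isCornerMap h.isCornerMap_symm rfl rfl).2 (Quot.eq.1 hab)))
    · rintro ⟨b⟩
      refine h.cases (P := fun b => ∃ o, F o = Quot.mk _ b) ?_ ?_ ?_ b
      · exact fun y => ⟨some (Quot.mk _ y), rfl⟩
      · exact fun k => ⟨none, Quot.eq.2 (h.sameVertex_spoke.2 ⟨k, rfl⟩)⟩
      · exact fun k => ⟨some (Quot.mk _ (T.next^[k] x)), Quot.eq.2 (h.sameVertex_twin_spoke k).symm'⟩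
  rw [Tri.numVertices, ← Nat.card_congr (Equiv.ofBijective F hF), Finite.card_option,
    Tri.numVertices]

theorem connected_iff (h : IsSubdivision T T' x ι s) : T.Connected ↔ T'.Connected := by
  have t : ∀ (S : Tri D) (a : D), Relation.EqvGen (fun a b => b = S.next a ∨ b = S.twin a) a
    (S.twin a) := fun S a => .rel _ _ (.inr rfl)
  have n : ∀ {a b : D'}, T'.next a = b →
    Relation.EqvGen (fun a b => b = T'.next a ∨ b = T'.twin a) a b := fun h => .rel _ _ (.inl h.symm)
  have ts : ∀ k, Relation.EqvGen (fun a b => b = T'.next a ∨ b = T'.twin a)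
    (T'.twin (s k)) (s k) := fun k => .symm _ _ (.rel _ _ (.inr rfl))
  constructor
  · rintro ⟨⟨y⟩, hT⟩
    refine ⟨⟨ι y⟩, ?_⟩
    have key : ∀ a b, Relation.EqvGen (fun a b => b = T'.next a ∨ b = T'.twin a) (ι a) (ι b) := by
      intro a b
      refine Relation.EqvGen.map_of_step (f := ι) ?_ (hT a b)
      rintro a b (rfl | rfl)
      · rcases h.eq_iterate_or a with ⟨k, rfl⟩ | ⟨h₀, h₁, h₂⟩
        · rw [← h.iterate_succ]
          exact (n (h.next_side k)).trans' ((ts _).trans' (n (h.next_spoke _)))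
        · exact n (h.next_other a h₀ h₁ h₂)
      · rw [← h.twin]
        exact .rel _ _ (.inr rfl)
    have out : ∀ b, ∃ a, Relation.EqvGen (fun a b => b = T'.next a ∨ b = T'.twin a) b (ι a) :=
      h.cases (fun y => ⟨y, .refl _⟩) (fun k => ⟨_, n (h.next_spoke k)⟩)
        (fun k => ⟨_, (ts k).trans' (n (h.next_spoke k))⟩)
    intro b₁ b₂
    obtain ⟨a₁, h₁⟩ := out b₁
    obtain ⟨a₂, h₂⟩ := out b₂
    exact h₁.trans' ((key a₁ a₂).trans' h₂.symm')
  · rintro ⟨-, hT⟩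
    refine ⟨⟨x⟩, fun a b => ?_⟩
    have l : ∀ k : Fin 3, Relation.EqvGen (fun a b => b = T.next a ∨ b = T.twin a) x
        (T.next^[k] x) := by
      have l₁ : Relation.EqvGen (fun a b => b = T.next a ∨ b = T.twin a) x (T.next x) :=
        .rel _ _ (.inl rfl)
      intro k
      fin_cases k
      · exact .refl _
      · exact l₁
      · exact l₁.trans' (.rel _ _ (.inl rfl))
    have := Relation.EqvGen.map_of_step (f := h.cornerMap)
      (r' := fun a b => b = T.next a ∨ b = T.twin a) ?_ (hT (ι a) (ι b))
    · rwa [h.cornerMap_side, h.cornerMap_side] at this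
    rintro b _ (rfl | rfl)
    · refine h.cases (P := fun b => Relation.EqvGen (fun a b => b = T.next a ∨ b = T.twin a)
        (h.cornerMap b) (h.cornerMap (T'.next b))) ?_ ?_ ?_ b
      · intro y
        rcases h.eq_iterate_or y with ⟨k, rfl⟩ | ⟨h₀, h₁, h₂⟩
        · rw [h.next_side, cornerMap_twin, cornerMap_side]
          exact (l _).symm'.trans' (l _)
        · rw [h.next_other y h₀ h₁ h₂, cornerMap_side, cornerMap_side]
          exact .rel _ _ (.inl rfl)
      · intro k
        rw [h.next_spoke, cornerMap_spoke, cornerMap_side]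
        exact l k
      · intro k
        have := h.next_twin_spoke (k + 2)
        rw [show k + 2 + 1 = k by omega] at this
        rw [this, cornerMap_spoke, cornerMap_twin]
        exact (l k).symm'
    · refine h.cases (P := fun b => Relation.EqvGen (fun a b => b = T.next a ∨ b = T.twin a)
        (h.cornerMap b) (h.cornerMap (T'.twin b))) ?_ ?_ ?_ b
      · intro y
        rw [h.twin, cornerMap_side, cornerMap_side]
        exact t T y
      · intro k
        rw [cornerMap_spoke, cornerMap_twin]
        exact l k
      · intro k
        rw [T'.twin_twin, cornerMap_spoke, cornerMap_twin]
        exact (l k).symm'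

theorem hasGenus_iff [Fintype D] [Fintype D'] (h : IsSubdivision T T' x ι s) {g : ℕ} :
    T.HasGenus g ↔ T'.HasGenus g := by
  refine and_congr h.connected_iff ?_
  have h₁ := T.numEdges_mul_two
  have h₂ := T'.numEdges_mul_two
  have h₃ := T.numFaces_mul_three
  have h₄ := T'.numFaces_mul_three
  have h₅ := h.numVertices_eq
  have h₆ := Fintype.card_congr (Equiv.ofBijective _ h.bijective)
  simp only [Fintype.card_sum, Fintype.card_fin] at h₆
  omega

end IsSubdivision

namespace Tri

variable {D D' : Type}

/-! ### Strands and regions of normal multicurves -/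

/-- One step from point to point (`δ = 1`) or from segment to segment (`δ = 0`) of the sides of the
triangles, along an elementary arc (or through a region of a triangle next to such an arc), or to
the adjacent triangle through a side in `I`. -/
def PointStep (T : Tri D) (N : D → ℕ) (I : Set D) (δ : ℕ) : D × ℕ → D × ℕ → Prop := fun p q =>
  (p.2 + δ ≤ T.corner N p.1 ∧ q = (T.prev p.1, N (T.prev p.1) - δ - p.2)) ∨
  (p.1 ∈ I ∧ p.2 + δ ≤ N p.1 ∧ q = (T.twin p.1, N p.1 - δ - p.2))

/-- The common generalization of `Linked` (`δ = 1`) and of the relation in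
`NormalComplementConnected` (`δ = 0`). -/
def Joined (T : Tri D) (N : D → ℕ) (I : Set D) (δ : ℕ) : D × ℕ → D × ℕ → Prop :=
  Relation.EqvGen (T.PointStep N I δ)

theorem linked_iff_joined (T : Tri D) (N : D → ℕ) (I : Set D) (p q : D × ℕ) :
    T.Linked N I p q ↔ T.Joined N I 1 p q := Iff.rfl

theorem normalComplementConnected_iff (T : Tri D) (N : D → ℕ) :
    T.NormalComplementConnected N ↔
      ∀ p q : D × ℕ, p.2 ≤ N p.1 → q.2 ≤ N q.1 → T.Joined N Set.univ 0 p q := by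
  have : (fun a b : D × ℕ =>
      (a.2 ≤ T.corner N a.1 ∧ b = (T.prev a.1, N (T.prev a.1) - a.2)) ∨
      (a.2 ≤ N a.1 ∧ b = (T.twin a.1, N a.1 - a.2))) = T.PointStep N Set.univ 0 := by
    funext a b
    simp [PointStep]
  rw [NormalComplementConnected, this]
  rfl

theorem Joined.arc {T : Tri D} {N : D → ℕ} {I : Set D} {δ : ℕ} {x y : D} {i j : ℕ}
    (hy : T.prev x = y) (hi : i + δ ≤ T.corner N x) (hj : i + j + δ = N y) :
    T.Joined N I δ (x, i) (y, j) := by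
  refine .rel _ _ (.inl ⟨hi, ?_⟩)
  rw [hy, Prod.mk.injEq]
  exact ⟨rfl, by dsimp only; omega⟩

theorem Joined.cross {T : Tri D} {N : D → ℕ} {I : Set D} {δ : ℕ} {x y : D} {i j : ℕ}
    (hy : T.twin x = y) (hx : x ∈ I) (hj : i + j + δ = N x) :
    T.Joined N I δ (x, i) (y, j) := by
  refine .rel _ _ (.inr ⟨hx, by dsimp only; omega, ?_⟩)
  rw [hy, Prod.mk.injEq]
  exact ⟨rfl, by dsimp only; omega⟩

/-- Each side of a triangle carries the ends of the arcs around its two corners. -/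
theorem IsNormal.eq_corner_add {T : Tri D} {N : D → ℕ} (hN : T.IsNormal N) (x : D) :
    N x = T.corner N x + T.corner N (T.next x) := by
  have h₁ := hN.triangle x
  have h₂ := hN.triangle (T.next x)
  have h₃ := hN.triangle (T.prev x)
  have h₄ := hN.even x
  simp only [next_next_eq_prev, prev_next, next_prev, prev_prev] at h₁ h₂ h₃ h₄
  simp only [corner, next_next_eq_prev, prev_next]
  obtain ⟨r, hr⟩ := h₄
  omega

theorem IsNormal.eq_corner_add₃ {T : Tri D} {N : D → ℕ} (hN : T.IsNormal N) {x y z : D}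
    (hy : T.next x = y) (hz : T.next y = z) :
    N x = T.corner N x + T.corner N y ∧ N y = T.corner N y + T.corner N z ∧
      N z = T.corner N z + T.corner N x := by
  have h₁ := hN.eq_corner_add x
  have h₂ := hN.eq_corner_add y
  have h₃ := hN.eq_corner_add z
  have : T.next z = x := by rw [← hz, ← hy, T.next_next_next]
  rw [hy] at h₁
  rw [hz] at h₂
  rw [this] at h₃
  exact ⟨h₁, h₂, h₃⟩

/-- The sets `I` and `I'` of the sides that may be crossed contain the darts that are not matched,
and the same matched darts. -/
structure Compatible (R : D → D' → Prop) (I : Set D) (I' : Set D') : Prop where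
  left : ∀ a, (¬ ∃ b, R a b) → a ∈ I
  right : ∀ b, (¬ ∃ a, R a b) → b ∈ I'
  iff : ∀ {a b}, R a b → (a ∈ I ↔ b ∈ I')

theorem Compatible.symm {R : D → D' → Prop} {I : Set D} {I' : Set D'} (h : Compatible R I I') :
    Compatible (fun b a => R a b) I' I :=
  ⟨h.right, h.left, fun hab => (h.iff hab).symm⟩

theorem compatible_univ (R : D → D' → Prop) : Compatible R Set.univ Set.univ :=
  ⟨fun _ _ => trivial, fun _ _ => trivial, fun _ => Iff.rfl⟩

theorem compatible_unmatched (R : D → D' → Prop) :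
    Compatible R {a | ¬ ∃ b, R a b} {b | ¬ ∃ a, R a b} :=
  ⟨fun _ h => h, fun _ h => h, fun {a b} hab =>
    ⟨fun h => (h ⟨b, hab⟩).elim, fun h => (h ⟨a, hab⟩).elim⟩⟩

/-- The strands and regions of the multicurve with coordinates `N` in `T` can be followed in `T'`,
where it has the coordinates `N'`: a map extends the identification of the points on the darts that
are matched by `R`, and respects joining; moreover every strand and region in `T` meets a matched
dart. -/
structure Follows (T : Tri D) (T' : Tri D') (R : D → D' → Prop) (N : D → ℕ) (N' : D' → ℕ) :
    Prop where
  coord : ∀ {a b}, R a b → N a = N' b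
  map : ∀ δ ≤ 1, ∀ I I', Compatible R I I' → ∃ f : D × ℕ → D' × ℕ,
    (∀ a b i, R a b → f (a, i) = (b, i)) ∧
    ∀ p q, T.PointStep N I δ p q → T'.Joined N' I' δ (f p) (f q)
  outer : ∀ δ ≤ 1, ∀ I : Set D, (∀ a, (¬ ∃ b, R a b) → a ∈ I) → ∀ a i, i + δ ≤ N a →
    ∃ c d j, R c d ∧ j + δ ≤ N c ∧ T.Joined N I δ (a, i) (c, j)

section follows

variable {T : Tri D} {T' : Tri D'} {R : D → D' → Prop} {N : D → ℕ} {N' : D' → ℕ}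

theorem Follows.joined (h : Follows T T' R N N') {δ : ℕ} (hδ : δ ≤ 1) {I : Set D} {I' : Set D'}
    (hI : Compatible R I I') {a c : D} {b d : D'} (hab : R a b) (hcd : R c d) {i j : ℕ}
    (hj : T.Joined N I δ (a, i) (c, j)) : T'.Joined N' I' δ (b, i) (d, j) := by
  obtain ⟨f, hf, hs⟩ := h.map δ hδ I I' hI
  rw [← hf a b i hab, ← hf c d j hcd]
  exact Relation.EqvGen.map_of_step hs hj

theorem Follows.joined_iff (h : Follows T T' R N N') (h' : Follows T' T (fun b a => R a b) N' N)
    {δ : ℕ} (hδ : δ ≤ 1) {I : Set D} {I' : Set D'}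
    (hI : Compatible R I I') {a c : D} {b d : D'} (hab : R a b) (hcd : R c d) {i j : ℕ} :
    T.Joined N I δ (a, i) (c, j) ↔ T'.Joined N' I' δ (b, i) (d, j) :=
  ⟨h.joined hδ hI hab hcd, h'.joined hδ hI.symm hab hcd⟩

theorem NormalComplementConnected.transfer (h : Follows T T' R N N')
    (h' : Follows T' T (fun b a => R a b) N' N) (hT : T.NormalComplementConnected N) :
    T'.NormalComplementConnected N' := by
  rw [normalComplementConnected_iff] at hT ⊢
  rintro ⟨b₁, i₁⟩ ⟨b₂, i₂⟩ hb₁ hb₂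
  obtain ⟨c₁, a₁, j₁, hR₁, hj₁, hJ₁⟩ := h'.outer 0 (by omega) Set.univ (fun _ _ => trivial) b₁ i₁ hb₁
  obtain ⟨c₂, a₂, j₂, hR₂, hj₂, hJ₂⟩ := h'.outer 0 (by omega) Set.univ (fun _ _ => trivial) b₂ i₂ hb₂
  refine hJ₁.trans' (Relation.EqvGen.trans' ?_ hJ₂.symm')
  refine h.joined (by omega) (compatible_univ R) hR₁ hR₂ (hT _ _ ?_ ?_)
  · rw [h.coord hR₁]; exact hj₁
  · rw [h.coord hR₂]; exact hj₂

end follows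

/-! ### Strands under a flip -/

namespace IsFlipAlong

variable {T : Tri D} {T' : Tri D'} {e : D ≃ D'} {d : D} {N : D → ℕ} {N' : D' → ℕ}

/-- The coordinates after a flip: those of the diagonals have as sum the larger of the two sums of
opposite sides of the quadrilateral. -/
structure Coord (T : Tri D) (e : D ≃ D') (d : D) (N : D → ℕ) (N' : D' → ℕ) : Prop where
  other : ∀ a, a ≠ d → a ≠ T.twin d → N' (e a) = N a
  diag : N' (e d) + N d =
    max (N (T.next d) + N (T.next (T.twin d))) (N (T.prev d) + N (T.prev (T.twin d)))
  diag_twin : N' (e (T.twin d)) = N' (e d)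

theorem Coord.isNormal (h : IsFlipAlong T T' e d) (hc : Coord T e d N N') (hN : T.IsNormal N) :
    T'.IsNormal N' := by
  have hn := hc.other _ (T.next_ne d) h.ne_next.symm
  have hp := hc.other _ (T.prev_ne d) h.ne_prev.symm
  have htn := hc.other _ h.next_twin_ne (T.next_ne _)
  have htp := hc.other _ h.prev_twin_ne (T.prev_ne _)
  have hd := hc.diag
  have ht := hc.diag_twin
  obtain ⟨k₁, k₂, k₃⟩ := hN.eq_corner_add₃ (x := d) rfl rfl
  obtain ⟨k₄, k₅, k₆⟩ := hN.eq_corner_add₃ (x := T.twin d) rfl rfl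
  rw [next_next_eq_prev] at k₂ k₃ k₅ k₆
  rw [hN.twin] at k₄
  constructor
  · intro b
    obtain ⟨z, rfl⟩ := e.surjective b
    rw [h.twin]
    by_cases h₁ : z = d
    · rw [h₁, ht]
    by_cases h₂ : z = T.twin d
    · rw [h₂, T.twin_twin, ht]
    rw [hc.other z h₁ h₂, hc.other, hN.twin]
    · exact fun h' => h₂ (by rw [← h', T.twin_twin])
    · exact fun h' => h₁ (T.twin_injective h')
  · intro b
    obtain ⟨z, rfl⟩ := e.surjective b
    refine cases T d (fun z => N' (e z) ≤ N' (T'.next (e z)) + N' (T'.prev (e z)))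
      ?_ ?_ ?_ ?_ ?_ ?_ ?_ z
    · rw [h.next_d, h.prev_d]; omega
    · rw [h.next_next, h.prev_next']; omega
    · rw [h.next_prev, h.prev_prev']; omega
    · rw [h.next_twin, h.prev_twin']; omega
    · rw [h.next_next_twin, h.prev_next_twin']; omega
    · rw [h.next_prev_twin, h.prev_prev_twin']; omega
    · intro x h₁ h₂ h₃ h₄ h₅ h₆
      rw [h.next_other x h₁ h₂ h₃ h₄ h₅ h₆, h.prev_other h₁ h₂ h₃ h₄ h₅ h₆, hc.other x h₁ h₄,
        hc.other, hc.other]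
      · exact hN.triangle x
      · exact fun h' => h₂ (by rw [← h', T.next_prev])
      · exact fun h' => h₅ (by rw [← h', T.next_prev])
      · exact fun h' => h₃ (by rw [← h', T.prev_next])
      · exact fun h' => h₆ (by rw [← h', T.prev_next])
  · intro b
    obtain ⟨z, rfl⟩ := e.surjective b
    have e₁ : (N' (e d) + N (T.prev d) + N (T.next (T.twin d))) % 2 = 0 := by omega
    have e₂ : (N' (e d) + N (T.prev (T.twin d)) + N (T.next d)) % 2 = 0 := by omega
    clear k₁ k₂ k₃ k₄ k₅ k₆ hd
    refine cases T d (fun z => Even (N' (e z) + N' (T'.next (e z)) + N' (T'.prev (e z))))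
      ?_ ?_ ?_ ?_ ?_ ?_ ?_ z
    · rw [h.next_d, h.prev_d, Nat.even_iff]; omega
    · rw [h.next_next, h.prev_next', Nat.even_iff]; omega
    · rw [h.next_prev, h.prev_prev', Nat.even_iff]; omega
    · rw [h.next_twin, h.prev_twin', Nat.even_iff]; omega
    · rw [h.next_next_twin, h.prev_next_twin', Nat.even_iff]; omega
    · rw [h.next_prev_twin, h.prev_prev_twin', Nat.even_iff]; omega
    · intro x h₁ h₂ h₃ h₄ h₅ h₆
      rw [h.next_other x h₁ h₂ h₃ h₄ h₅ h₆, h.prev_other h₁ h₂ h₃ h₄ h₅ h₆, hc.other x h₁ h₄,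
        hc.other, hc.other]
      · exact hN.even x
      · exact fun h' => h₂ (by rw [← h', T.next_prev])
      · exact fun h' => h₅ (by rw [← h', T.next_prev])
      · exact fun h' => h₃ (by rw [← h', T.prev_next])
      · exact fun h' => h₆ (by rw [← h', T.prev_next])

/-- The points on the old diagonal are moved along their strands to a side of the quadrilateral. -/
theorem follows (h : IsFlipAlong T T' e d) (hc : Coord T e d N N') (hN : T.IsNormal N) :
    Follows T T' (fun a b => b = e a ∧ a ≠ d ∧ a ≠ T.twin d) N N' := by
  classical
  have hN' := hc.isNormal h hN
  have hn := hc.other _ (T.next_ne d) h.ne_next.symm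
  have hp := hc.other _ (T.prev_ne d) h.ne_prev.symm
  have htn := hc.other _ h.next_twin_ne (T.next_ne _)
  have htp := hc.other _ h.prev_twin_ne (T.prev_ne _)
  have hd := hc.diag
  have ht := hc.diag_twin
  obtain ⟨k₁, k₂, k₃⟩ := hN.eq_corner_add₃ (x := d) rfl rfl
  obtain ⟨k₄, k₅, k₆⟩ := hN.eq_corner_add₃ (x := T.twin d) rfl rfl
  rw [next_next_eq_prev] at k₂ k₃ k₅ k₆
  have hNt := hN.twin d
  obtain ⟨l₁, l₂, l₃⟩ := hN'.eq_corner_add₃ h.next_d h.next_prev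
  obtain ⟨l₄, l₅, l₆⟩ := hN'.eq_corner_add₃ h.next_twin h.next_prev_twin
  refine ⟨?_, ?_, ?_⟩
  · rintro a b ⟨rfl, h₁, h₂⟩
    exact (hc.other a h₁ h₂).symm
  · intro δ hδ I I' hI
    have hdI : e d ∈ I' := hI.right _ (by
      rintro ⟨a, h₁, h₂, -⟩
      exact h₂ (e.injective h₁).symm)
    -- the strands of the two triangles in `T'`, and their combinations across the diagonal
    have A₁ : ∀ i j, i + δ ≤ T'.corner N' (e (T.next (T.twin d))) → i + j + δ = N (T.prev d) →
        T'.Joined N' I' δ (e (T.next (T.twin d)), i) (e (T.prev d), j) :=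
      fun i j hi hj => .arc h.prev_next_twin' hi (by omega)
    have A₂ : ∀ i j, i + δ ≤ T'.corner N' (e (T.prev d)) → i + j + δ = N' (e d) →
        T'.Joined N' I' δ (e (T.prev d), i) (e d, j) :=
      fun i j hi hj => .arc h.prev_prev' hi (by omega)
    have A₃ : ∀ i j, i + δ ≤ T'.corner N' (e d) → i + j + δ = N (T.next (T.twin d)) →
        T'.Joined N' I' δ (e d, i) (e (T.next (T.twin d)), j) :=
      fun i j hi hj => .arc h.prev_d hi (by omega)
    have A₄ : ∀ i j, i + δ ≤ T'.corner N' (e (T.twin d)) → i + j + δ = N (T.next d) →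
        T'.Joined N' I' δ (e (T.twin d), i) (e (T.next d), j) :=
      fun i j hi hj => .arc h.prev_twin' hi (by omega)
    have A₅ : ∀ i j, i + δ ≤ T'.corner N' (e (T.next d)) → i + j + δ = N (T.prev (T.twin d)) →
        T'.Joined N' I' δ (e (T.next d), i) (e (T.prev (T.twin d)), j) :=
      fun i j hi hj => .arc h.prev_next' hi (by omega)
    have A₆ : ∀ i j, i + δ ≤ T'.corner N' (e (T.prev (T.twin d))) → i + j + δ = N' (e d) →
        T'.Joined N' I' δ (e (T.prev (T.twin d)), i) (e (T.twin d), j) :=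
      fun i j hi hj => .arc h.prev_prev_twin' hi (by omega)
    have X : ∀ i j, i + j + δ = N' (e d) →
        T'.Joined N' I' δ (e d, i) (e (T.twin d), j) :=
      fun i j hj => .cross (h.twin d) hdI hj
    have B₁ : ∀ i j, i + δ ≤ T.corner N (T.prev d) → i + j + δ = N (T.next d) →
        T'.Joined N' I' δ (e (T.prev d), i) (e (T.next d), j) := fun i j hi hj =>
      (A₂ i (N' (e d) - δ - i) (by omega) (by omega)).trans'
        ((X _ i (by omega)).trans' (A₄ i j (by omega) hj))
    have B₂ : ∀ i j, i + δ ≤ T.corner N (T.prev (T.twin d)) → i + j + δ = N (T.next (T.twin d)) →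
        T'.Joined N' I' δ (e (T.prev (T.twin d)), i) (e (T.next (T.twin d)), j) := fun i j hi hj =>
      (A₆ i (N' (e d) - δ - i) (by omega) (by omega)).trans'
        ((X i _ (by omega)).symm'.trans' (A₃ i j (by omega) hj))
    -- the points on arcs around the origin of `d` are moved to `prev d`, the other ones to `next d`
    let F : ℕ → D' × ℕ := fun i => if i + δ ≤ T.corner N d then (e (T.prev d), N (T.prev d) - δ - i)
      else (e (T.next d), N d - δ - i)
    let f : D × ℕ → D' × ℕ := fun p => if p.1 = d then F p.2 else
      if p.1 = T.twin d then F (N d - δ - p.2) else (e p.1, p.2)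
    have fd : ∀ i, f (d, i) = F i := fun i => if_pos rfl
    have ft : ∀ i, f (T.twin d, i) = F (N d - δ - i) := fun i => by
      simp only [f, T.twin_ne, if_true, if_false]
    have fo : ∀ {a : D} (i : ℕ), a ≠ d → a ≠ T.twin d → f (a, i) = (e a, i) := fun i h₁ h₂ => by
      simp only [f, h₁, h₂, if_false]
    have fn := fun i => fo i (T.next_ne d) h.ne_next.symm
    have fp := fun i => fo i (T.prev_ne d) h.ne_prev.symm
    have ftn := fun i => fo i h.next_twin_ne (T.next_ne _)
    have ftp := fun i => fo i h.prev_twin_ne (T.prev_ne _)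
    refine ⟨f, ?_, ?_⟩
    · rintro a b i ⟨rfl, h₁, h₂⟩
      exact fo i h₁ h₂
    · rintro ⟨a, i⟩ q (⟨hi, rfl⟩ | ⟨ha, hi, rfl⟩)
      · dsimp only at hi ⊢
        refine cases T d (fun a => i + δ ≤ T.corner N a → T'.Joined N' I' δ (f (a, i))
          (f (T.prev a, N (T.prev a) - δ - i))) ?_ ?_ ?_ ?_ ?_ ?_ ?_ a hi
        · intro hi
          rw [fd, fp]
          simp only [F, hi, if_true]
          exact .refl _
        · intro hi
          rw [T.prev_next, fn, fd]
          simp only [F]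
          split_ifs with h'
          · exact (B₁ _ _ (by omega) (by omega)).symm'
          · rw [show N d - δ - (N d - δ - i) = i by omega]
            exact .refl _
        · intro hi
          rw [T.prev_prev, fn, fp]
          exact B₁ _ _ hi (by omega)
        · intro hi
          rw [ftp, ft]
          simp only [F]
          split_ifs with h'
          · obtain ⟨k, hk⟩ : ∃ k, k = N (T.prev d) - δ - (N d - δ - i) := ⟨_, rfl⟩
            rw [← hk]
            exact (A₂ k (N' (e d) - δ - k) (by omega) (by omega)).trans'
              ((X _ k (by omega)).trans' (A₆ _ _ (by omega) (by omega)).symm')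
          · rw [show N d - δ - (N d - δ - i) = i by omega]
            exact A₅ _ _ (by omega) (by omega)
        · intro hi
          rw [T.prev_next, ftn, ft, hNt, show N d - δ - (N d - δ - i) = i by omega]
          simp only [F]
          split_ifs with h'
          · exact A₁ _ _ (by omega) (by omega)
          · obtain ⟨k, hk⟩ : ∃ k, k = N (T.next (T.twin d)) - δ - i := ⟨_, rfl⟩
            exact (A₃ k i (by omega) (by omega)).symm'.trans'
              ((X k (N' (e d) - δ - k) (by omega)).trans' (A₄ _ _ (by omega) (by omega)))
        · intro hi
          rw [T.prev_prev, ftn, ftp]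
          exact B₂ _ _ hi (by omega)
        · intro a h₁ h₂ h₃ h₄ h₅ h₆ hi
          have hprev₁ : T.prev a ≠ d := fun h' => h₂ (by rw [← h', T.next_prev])
          have hprev₂ : T.prev a ≠ T.twin d := fun h' => h₅ (by rw [← h', T.next_prev])
          have hnext₁ : T.next a ≠ d := fun h' => h₃ (by rw [← h', T.prev_next])
          have hnext₂ : T.next a ≠ T.twin d := fun h' => h₆ (by rw [← h', T.prev_next])
          rw [fo i h₁ h₄, fo _ hprev₁ hprev₂]
          refine .rel _ _ (.inl ⟨?_, ?_⟩)
          · rw [corner] at hi ⊢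
            rw [h.prev_other h₁ h₂ h₃ h₄ h₅ h₆, h.next_other a h₁ h₂ h₃ h₄ h₅ h₆,
              hc.other a h₁ h₄, hc.other _ hprev₁ hprev₂, hc.other _ hnext₁ hnext₂]
            exact hi
          · rw [h.prev_other h₁ h₂ h₃ h₄ h₅ h₆, hc.other _ hprev₁ hprev₂]
      · dsimp only at hi ⊢
        by_cases h₁ : a = d
        · subst h₁
          rw [fd, ft, show N a - δ - (N a - δ - i) = i by omega]
          exact .refl _
        by_cases h₂ : a = T.twin d
        · subst h₂
          rw [T.twin_twin, fd, ft, hNt]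
          exact .refl _
        have h₃ : T.twin a ≠ d := fun h' => h₂ (by rw [← h', T.twin_twin])
        have h₄ : T.twin a ≠ T.twin d := fun h' => h₁ (T.twin_injective h')
        rw [fo _ h₁ h₂, fo _ h₃ h₄]
        exact .cross (h.twin a) ((hI.iff ⟨rfl, h₁, h₂⟩).1 ha)
          (by rw [hc.other a h₁ h₂]; omega)
  · intro δ hδ I hI
    have hnot : ∀ {a}, a = d ∨ a = T.twin d → a ∈ I := fun ha => hI _ (by
      rintro ⟨b, -, h₁, h₂⟩
      exact ha.elim h₁ h₂)
    have key : ∀ i, i + δ ≤ N d → ∃ c d' j, (d' = e c ∧ c ≠ d ∧ c ≠ T.twin d) ∧ j + δ ≤ N c ∧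
        T.Joined N I δ (d, i) (c, j) := by
      intro i hi
      by_cases h' : i + δ ≤ T.corner N d
      · exact ⟨T.prev d, _, N (T.prev d) - δ - i, ⟨rfl, T.prev_ne d, h.ne_prev.symm⟩, by omega,
          .arc rfl h' (by omega)⟩
      · exact ⟨T.next d, _, N d - δ - i, ⟨rfl, T.next_ne d, h.ne_next.symm⟩, by omega,
          .symm _ _ (Joined.arc (T.prev_next d) (by omega) (by omega))⟩
    intro a i hi
    by_cases h₁ : a = d
    · subst h₁
      exact key i hi
    by_cases h₂ : a = T.twin d
    · subst h₂
      obtain ⟨c, d', j, hc', hj, hJ⟩ := key (N d - δ - i) (by omega)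
      exact ⟨c, d', j, hc', hj, Relation.EqvGen.trans'
        (Joined.cross (T.twin_twin d) (hnot (.inr rfl)) (by omega)) hJ⟩
    exact ⟨a, _, i, ⟨rfl, h₁, h₂⟩, hi, .refl _⟩

/-- The rule for the coordinates is symmetric, so that the strands can also be followed back. -/
theorem follows_symm (h : IsFlipAlong T T' e d) (hc : Coord T e d N N') (hN : T.IsNormal N) :
    Follows T' T (fun b a => b = e a ∧ a ≠ d ∧ a ≠ T.twin d) N' N := by
  classical
  have hN' := hc.isNormal h hN
  obtain ⟨e', h', hR⟩ := h.matching_symm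
  have hR' : ∀ b a, (a = e' b ∧ b ≠ e d ∧ b ≠ T'.twin (e d)) ↔ (b = e a ∧ a ≠ d ∧ a ≠ T.twin d) :=
    fun b a => by rw [← show _ = _ from congrFun (congrFun hR b) a]
  have hother : ∀ b, b ≠ e d → b ≠ T'.twin (e d) → N (e' b) = N' b := by
    intro b h₁ h₂
    obtain ⟨h₃, h₄, h₅⟩ := (hR' b (e' b)).1 ⟨rfl, h₁, h₂⟩
    rw [← hc.other _ h₄ h₅, ← h₃]
  have hd : N (e' (e d)) = N d ∧ N (e' (T'.twin (e d))) = N d := by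
    have h₁ : ∀ b, b = e d ∨ b = T'.twin (e d) → e' b = d ∨ e' b = T.twin d := by
      intro b hb
      by_contra hcon
      push Not at hcon
      obtain ⟨h₃, h₄, h₅⟩ := (hR' (e (e' b)) (e' b)).2 ⟨rfl, hcon⟩
      rw [← e'.injective h₃] at h₄ h₅
      exact hb.elim h₄ h₅
    constructor
    · rcases h₁ _ (.inl rfl) with h | h <;> rw [h]
      exact hN.twin d
    · rcases h₁ _ (.inr rfl) with h | h <;> rw [h]
      exact hN.twin d
  have hc' : Coord T' e' (e d) N' N := by
    refine ⟨hother, ?_, by rw [hd.1, hd.2]⟩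
    have hn := hc.other _ (T.next_ne d) h.ne_next.symm
    have hp := hc.other _ (T.prev_ne d) h.ne_prev.symm
    have htn := hc.other _ h.next_twin_ne (T.next_ne _)
    have htp := hc.other _ h.prev_twin_ne (T.prev_ne _)
    have := hc.diag
    rw [hd.1, h.next_d, h.twin, h.next_twin, h.prev_d, h.prev_twin', hn, hp, htn, htp]
    omega
  exact hR ▸ h'.follows hc' hN'

end IsFlipAlong

end Tri

/-! ### Strands under a subdivision -/

namespace IsSubdivision

open Tri

variable {D D' : Type} {T : Tri D} {T' : Tri D'} {x : D} {ι : D → D'} {s : Fin 3 → D'}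
  {N : D → ℕ} {N' : D' → ℕ}

theorem corner_other (h : IsSubdivision T T' x ι s) (hco : ∀ y, N' (ι y) = N y) {y : D}
    (h₀ : y ≠ x) (h₁ : y ≠ T.next x) (h₂ : y ≠ T.prev x) :
    T'.corner N' (ι y) = T.corner N y := by
  rw [corner, corner, h.prev_other h₀ h₁ h₂, h.next_other y h₀ h₁ h₂, hco, hco, hco]

/-- The three triangles at the new vertex, with the numbers of their corner arcs. -/
theorem eq_corner_add (h : IsSubdivision T T' x ι s) (hco : ∀ y, N' (ι y) = N y)
    (hN' : T'.IsNormal N') (k : Fin 3) :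
    N' (s k) = T'.corner N' (s k) + T'.corner N' (ι (T.next^[k] x)) ∧
    N (T.next^[k] x) = T'.corner N' (ι (T.next^[k] x)) + T'.corner N' (T'.twin (s (k + 1))) ∧
    N' (s (k + 1)) = T'.corner N' (T'.twin (s (k + 1))) + T'.corner N' (s k) := by
  have := hN'.eq_corner_add₃ (h.next_spoke k) (h.next_side k)
  rwa [hco, hN'.twin] at this

/-- The equations of `eq_corner_add` and those of the subdivided triangle, if at most the first of
the three triangles contains arcs around the new vertex. -/
theorem corner_eqs (h : IsSubdivision T T' x ι s) (hco : ∀ y, N' (ι y) = N y)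
    (hN : T.IsNormal N) (hN' : T'.IsNormal N') (h₁ : T'.corner N' (s 1) = 0)
    (h₂ : T'.corner N' (s 2) = 0) :
    (N x = T.corner N x + T.corner N (T.next x) ∧
      N (T.next x) = T.corner N (T.next x) + T.corner N (T.prev x) ∧
      N (T.prev x) = T.corner N (T.prev x) + T.corner N x) ∧
    (N' (s 0) = T'.corner N' (s 0) + T.corner N x ∧
      N' (s 1) = T'.corner N' (s 0) + T.corner N (T.next x) ∧
      N' (s 2) + T'.corner N' (s 0) = T.corner N (T.prev x)) ∧
    (T'.corner N' (ι x) = T.corner N x ∧ T'.corner N' (ι (T.next x)) = N' (s 1) ∧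
      T'.corner N' (ι (T.prev x)) = N' (s 2)) ∧
    (T'.corner N' (T'.twin (s 0)) = N' (s 0) ∧
      T'.corner N' (T'.twin (s 1)) = T.corner N (T.next x) ∧
      T'.corner N' (T'.twin (s 2)) = N' (s 2)) := by
  have k := hN.eq_corner_add₃ (x := x) rfl rfl
  rw [next_next_eq_prev] at k
  have l₀ := h.eq_corner_add hco hN' 0
  have l₁ := h.eq_corner_add hco hN' 1
  have l₂ := h.eq_corner_add hco hN' 2
  change _ ∧ N x = T'.corner N' (ι x) + T'.corner N' (T'.twin (s 1)) ∧ N' (s 1) = _ at l₀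
  change N' (s 1) = T'.corner N' (s 1) + T'.corner N' (ι (T.next x)) ∧
    N (T.next x) = T'.corner N' (ι (T.next x)) + T'.corner N' (T'.twin (s 2)) ∧ N' (s 2) = _ at l₁
  change N' (s 2) = T'.corner N' (s 2) + T'.corner N' (ι (T.prev x)) ∧
    N (T.prev x) = T'.corner N' (ι (T.prev x)) + T'.corner N' (T'.twin (s 0)) ∧ N' (s 0) = _ at l₂
  change N' (s 0) = _ + T'.corner N' (ι x) ∧ _ at l₀
  change _ ∧ _ ∧ N' (s 1) = T'.corner N' (T'.twin (s 1)) + _ at l₀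
  change _ ∧ _ ∧ N' (s 2) = T'.corner N' (T'.twin (s 2)) + _ at l₁
  change _ ∧ _ ∧ N' (s 0) = T'.corner N' (T'.twin (s 0)) + _ at l₂
  omega

/-- Arcs in the large triangle are followed through the small ones: directly across a spoke, or, for
the outer arcs at the corner of `prev x`, around the new vertex through the first triangle. -/
theorem follows_aux (h : IsSubdivision T T' x ι s) (hco : ∀ y, N' (ι y) = N y)
    (hN : T.IsNormal N) (hN' : T'.IsNormal N') (h₁ : T'.corner N' (s 1) = 0)
    (h₂ : T'.corner N' (s 2) = 0) : Follows T T' (fun a b => b = ι a) N N' := by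
  obtain ⟨⟨a₀, a₁, a₂⟩, ⟨n₀, n₁, n₂⟩, ⟨u₀, u₁, u₂⟩, w₀, w₁, w₂⟩ := h.corner_eqs hco hN hN' h₁ h₂
  refine ⟨?_, ?_, ?_⟩
  · rintro a _ rfl
    exact (hco a).symm
  · intro δ hδ I I' hI
    have hs : ∀ k, s k ∈ I' := fun k => hI.right _ (by rintro ⟨a, ha⟩; exact h.ne_spoke a k ha.symm)
    have side : ∀ (k : Fin 3) (i j : ℕ), i + δ ≤ T'.corner N' (ι (T.next^[k] x)) →
        i + j + δ = N' (s k) → T'.Joined N' I' δ (ι (T.next^[k] x), i) (s k, j) := fun k i j hi hj =>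
      .arc (h.prev_side k) hi hj
    have spoke : ∀ (k : Fin 3) (i j : ℕ), i + δ ≤ T'.corner N' (T'.twin (s k)) →
        i + j + δ = N (T.prev (T.next^[k] x)) →
        T'.Joined N' I' δ (T'.twin (s k), i) (ι (T.prev (T.next^[k] x)), j) := fun k i j hi hj =>
      .arc (h.prev_twin_spoke k) hi (by rw [hco]; exact hj)
    have cross : ∀ (k : Fin 3) (i j : ℕ), i + j + δ = N' (s k) →
        T'.Joined N' I' δ (s k, i) (T'.twin (s k), j) := fun k i j hj => .cross rfl (hs k) hj
    refine ⟨fun p => (ι p.1, p.2), by rintro a _ i rfl; rfl, ?_⟩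
    rintro ⟨y, i⟩ q (⟨hi, rfl⟩ | ⟨hy, hi, rfl⟩)
    · dsimp only at hi ⊢
      by_cases e₀ : y = x
      · subst e₀
        exact (side 0 i (N' (s 0) - δ - i) (u₀.symm ▸ hi) (by omega)).trans'
          ((cross 0 _ i (by omega)).trans' (spoke 0 i _ (by omega)
            (show _ = N (T.prev y) by omega)))
      by_cases e₁ : y = T.next x
      · subst e₁
        rw [T.prev_next]
        refine (side 1 i (N' (s 1) - δ - i) (show _ ≤ T'.corner N' (ι (T.next x)) by omega)
          (by omega)).trans' ((cross 1 _ i (by omega)).trans' ?_)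
        have := spoke 1 i (N x - δ - i) (by omega) (show _ = N (T.prev (T.next x)) by
          rw [T.prev_next]; omega)
        rwa [show T.next^[(1 : Fin 3)] x = T.next x from rfl, T.prev_next] at this
      by_cases e₂ : y = T.prev x
      · subst e₂
        rw [T.prev_prev]
        by_cases hle : i + δ ≤ N' (s 2)
        · refine (side 2 i (N' (s 2) - δ - i) (show _ ≤ T'.corner N' (ι (T.prev x)) by omega)
            (by omega)).trans' ((cross 2 _ i (by omega)).trans' ?_)
          have := spoke 2 i (N (T.next x) - δ - i) (by omega) (show _ = N (T.prev (T.prev x)) by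
            rw [T.prev_prev]; omega)
          rwa [show T.next^[(2 : Fin 3)] x = T.prev x from rfl, T.prev_prev] at this
        · -- the strand turns around the new vertex inside the first triangle
          obtain ⟨l, hl⟩ : ∃ l, i = N' (s 2) + l := ⟨i - N' (s 2), by omega⟩
          have c₁ : T'.Joined N' I' δ (T'.twin (s 0), N' (s 0) - δ - l) (ι (T.prev x), i) :=
            spoke 0 _ _ (by omega) (show _ = N (T.prev x) by omega)
          have c₂ := cross 0 l (N' (s 0) - δ - l) (by omega)
          have c₃ : T'.Joined N' I' δ (s 0, l) (T'.twin (s 1), N' (s 1) - δ - l) :=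
            .arc (h.prev_spoke 0) (by omega) (by rw [hN'.twin]; omega)
          have c₄ := cross 1 l (N' (s 1) - δ - l) (by omega)
          have c₅ : T'.Joined N' I' δ (ι (T.next x), N (T.next x) - δ - i) (s 1, l) :=
            side 1 _ _ (show _ ≤ T'.corner N' (ι (T.next x)) by omega) (by omega)
          exact c₁.symm'.trans' (c₂.symm'.trans' (c₃.trans' (c₄.symm'.trans' c₅.symm')))
      · have := hN.eq_corner_add (T.prev y)
        rw [T.next_prev] at this
        exact .arc (h.prev_other e₀ e₁ e₂) (by rwa [h.corner_other hco e₀ e₁ e₂])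
          (by rw [hco]; omega)
    · dsimp only at hi ⊢
      exact .cross (h.twin y) ((hI.iff rfl).1 hy) (by rw [hco]; omega)
  · intro δ _ I _ a i hi
    exact ⟨a, _, i, rfl, hi, .refl _⟩

/-- The images of the points on the spokes in the triangle without the new vertex, if at most the
first of the three triangles contains arcs around the new vertex. -/
def spokePoint (T : Tri D) (x : D) (s : Fin 3 → D') (N' : D' → ℕ) (δ : ℕ) (k : Fin 3) (i : ℕ) :
    D × ℕ :=
  ![(T.prev x, N' (s 2) + i), (T.next x, N' (s 1) - δ - i), (T.prev x, N' (s 2) - δ - i)] k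

/-- The map of points that removes the new vertex. -/
noncomputable def pointMap (h : IsSubdivision T T' x ι s) (N' : D' → ℕ) (δ : ℕ) (p : D' × ℕ) :
    D × ℕ :=
  h.elim (fun y => (y, p.2)) (fun k => spokePoint T x s N' δ k p.2)
    (fun k => spokePoint T x s N' δ k (N' (s k) - δ - p.2)) p.1

theorem pointMap_side (h : IsSubdivision T T' x ι s) (δ : ℕ) (y : D) (i : ℕ) :
    h.pointMap N' δ (ι y, i) = (y, i) :=
  h.elim_side _ _ _ y

theorem pointMap_spoke (h : IsSubdivision T T' x ι s) (δ : ℕ) (k : Fin 3) (i : ℕ) :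
    h.pointMap N' δ (s k, i) = spokePoint T x s N' δ k i :=
  h.elim_spoke _ _ _ k

theorem pointMap_twin (h : IsSubdivision T T' x ι s) (δ : ℕ) (k : Fin 3) (i : ℕ) :
    h.pointMap N' δ (T'.twin (s k), i) = spokePoint T x s N' δ k (N' (s k) - δ - i) :=
  h.elim_twin _ _ _ k

/-- Conversely, the arcs in the small triangles are followed in the large one along `pointMap`, which
moves the points on the spokes to sides of the large triangle. -/
theorem follows_symm_aux (h : IsSubdivision T T' x ι s) (hco : ∀ y, N' (ι y) = N y)
    (hN : T.IsNormal N) (hN' : T'.IsNormal N') (h₁ : T'.corner N' (s 1) = 0)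
    (h₂ : T'.corner N' (s 2) = 0) : Follows T' T (fun b a => b = ι a) N' N := by
  obtain ⟨⟨a₀, a₁, a₂⟩, ⟨n₀, n₁, n₂⟩, ⟨u₀, u₁, u₂⟩, w₀, w₁, w₂⟩ := h.corner_eqs hco hN hN' h₁ h₂
  refine ⟨?_, ?_, ?_⟩
  · rintro _ a rfl
    exact hco a
  · intro δ hδ I' I hI
    refine ⟨h.pointMap N' δ, by rintro _ a i rfl; exact h.pointMap_side δ a i, ?_⟩
    rintro ⟨b, i⟩ q (⟨hi, rfl⟩ | ⟨hb, hi, rfl⟩)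
    · dsimp only at hi ⊢
      revert hi
      refine h.cases (P := fun b => i + δ ≤ T'.corner N' b → T.Joined N I δ (h.pointMap N' δ (b, i))
        (h.pointMap N' δ (T'.prev b, N' (T'.prev b) - δ - i))) ?_ ?_ ?_ b
      · intro y hi
        rcases h.eq_iterate_or y with ⟨k, rfl⟩ | ⟨e₀, e₁, e₂⟩
        · rw [h.prev_side, pointMap_side, pointMap_spoke]
          fin_cases k
          · change i + δ ≤ T'.corner N' (ι x) at hi
            change T.Joined N I δ (x, i) (T.prev x, N' (s 2) + (N' (s 0) - δ - i))
            exact .arc rfl (by omega) (by omega)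
          · change i + δ ≤ T'.corner N' (ι (T.next x)) at hi
            change T.Joined N I δ (T.next x, i) (T.next x, N' (s 1) - δ - (N' (s 1) - δ - i))
            rw [show N' (s 1) - δ - (N' (s 1) - δ - i) = i by omega]
            exact .refl _
          · change i + δ ≤ T'.corner N' (ι (T.prev x)) at hi
            change T.Joined N I δ (T.prev x, i) (T.prev x, N' (s 2) - δ - (N' (s 2) - δ - i))
            rw [show N' (s 2) - δ - (N' (s 2) - δ - i) = i by omega]
            exact .refl _
        · rw [h.prev_other e₀ e₁ e₂, pointMap_side, pointMap_side, hco]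
          rw [h.corner_other hco e₀ e₁ e₂] at hi
          exact .rel _ _ (.inl ⟨hi, rfl⟩)
      · intro k hi
        rw [h.prev_spoke, pointMap_twin, pointMap_spoke, hN'.twin]
        fin_cases k
        · change i + δ ≤ T'.corner N' (s 0) at hi
          change T.Joined N I δ (T.prev x, N' (s 2) + i)
            (T.next x, N' (s 1) - δ - (N' (s 1) - δ - (N' (s 1) - δ - i)))
          exact .arc (T.prev_prev x) (by omega) (by omega)
        · change i + δ ≤ T'.corner N' (s 1) at hi
          change T.Joined N I δ (T.next x, N' (s 1) - δ - i)
            (T.prev x, N' (s 2) - δ - (N' (s 2) - δ - (N' (s 2) - δ - i)))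
          exact .symm _ _ (Joined.arc (T.prev_prev x) (by omega) (by omega))
        · change i + δ ≤ T'.corner N' (s 2) at hi
          change T.Joined N I δ (T.prev x, N' (s 2) - δ - i)
            (T.prev x, N' (s 2) + (N' (s 0) - δ - (N' (s 0) - δ - i)))
          rw [show N' (s 2) - δ - i = N' (s 2) + (N' (s 0) - δ - (N' (s 0) - δ - i)) by omega]
          exact .refl _
      · intro k hi
        rw [h.prev_twin_spoke, pointMap_twin, pointMap_side, hco]
        fin_cases k
        · change i + δ ≤ T'.corner N' (T'.twin (s 0)) at hi
          change T.Joined N I δ (T.prev x, N' (s 2) + (N' (s 0) - δ - i))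
            (T.prev x, N (T.prev x) - δ - i)
          rw [show N' (s 2) + (N' (s 0) - δ - i) = N (T.prev x) - δ - i by omega]
          exact .refl _
        · change i + δ ≤ T'.corner N' (T'.twin (s 1)) at hi
          change T.Joined N I δ (T.next x, N' (s 1) - δ - (N' (s 1) - δ - i))
            (T.prev (T.next x), N (T.prev (T.next x)) - δ - i)
          exact .arc rfl (by omega) (by rw [T.prev_next]; omega)
        · change i + δ ≤ T'.corner N' (T'.twin (s 2)) at hi
          change T.Joined N I δ (T.prev x, N' (s 2) - δ - (N' (s 2) - δ - i))
            (T.prev (T.prev x), N (T.prev (T.prev x)) - δ - i)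
          exact .arc rfl (by omega) (by rw [T.prev_prev]; omega)
    · dsimp only at hi ⊢
      revert hi hb
      refine h.cases (P := fun b => b ∈ I' → i + δ ≤ N' b →
        T.Joined N I δ (h.pointMap N' δ (b, i))
        (h.pointMap N' δ (T'.twin b, N' b - δ - i))) ?_ ?_ ?_ b
      · intro y hy hi
        rw [h.twin, pointMap_side, pointMap_side, hco]
        rw [hco] at hi
        exact .rel _ _ (.inr ⟨(hI.iff rfl).1 hy, hi, rfl⟩)
      · intro k _ hi
        rw [pointMap_twin, pointMap_spoke, show N' (s k) - δ - (N' (s k) - δ - i) = i by omega]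
        exact .refl _
      · intro k _ hi
        rw [T'.twin_twin, pointMap_twin, pointMap_spoke, hN'.twin]
        exact .refl _
  · intro δ hδ I' hI b i
    have hs : ∀ k, s k ∈ I' := fun k => hI _ (by rintro ⟨a, ha⟩; exact h.ne_spoke a k ha.symm)
    have hts : ∀ k, T'.twin (s k) ∈ I' := fun k => hI _ (by
      rintro ⟨a, ha⟩; exact h.ne_twin_spoke a k ha.symm)
    have key : ∀ k i, i + δ ≤ N' (s k) → ∃ c d j, c = ι d ∧ j + δ ≤ N' c ∧
        T'.Joined N' I' δ (s k, i) (c, j) := by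
      intro k i hi
      fin_cases k
      · change i + δ ≤ N' (s 0) at hi
        change ∃ c d j, c = ι d ∧ j + δ ≤ N' c ∧ T'.Joined N' I' δ (s 0, i) (c, j)
        refine ⟨_, T.prev x, N (T.prev x) - δ - (N' (s 0) - δ - i), rfl, by rw [hco]; omega, ?_⟩
        refine Relation.EqvGen.trans' (Joined.cross (j := N' (s 0) - δ - i) rfl (hs 0)
          (show _ = N' (s 0) by omega)) ?_
        exact Joined.arc (h.prev_twin_spoke 0) (by omega)
          (by rw [hco]; omega)
      · change i + δ ≤ N' (s 1) at hi
        exact ⟨_, T.next x, N' (s 1) - δ - i, rfl, by rw [hco]; omega,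
          .symm _ _ (Joined.arc (h.prev_side 1) (show _ ≤ T'.corner N' (ι (T.next x)) by omega)
            (show _ = N' (s 1) by omega))⟩
      · change i + δ ≤ N' (s 2) at hi
        exact ⟨_, T.prev x, N' (s 2) - δ - i, rfl, by rw [hco]; omega,
          .symm _ _ (Joined.arc (h.prev_side 2) (show _ ≤ T'.corner N' (ι (T.prev x)) by omega)
            (show _ = N' (s 2) by omega))⟩
    refine h.cases (P := fun b => i + δ ≤ N' b → ∃ c d j, c = ι d ∧ j + δ ≤ N' c ∧
        T'.Joined N' I' δ (b, i) (c, j)) ?_ (fun k => key k i) ?_ b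
    · exact fun y hi => ⟨_, y, i, rfl, hi, .refl _⟩
    · intro k hi
      rw [hN'.twin] at hi
      obtain ⟨c, d, j, hc, hj, hJ⟩ := key k (N' (s k) - δ - i) (by omega)
      exact ⟨c, d, j, hc, hj, Relation.EqvGen.trans' (Joined.cross (T'.twin_twin _) (hts k)
        (by rw [hN'.twin]; omega)) hJ⟩

/-- If arcs around the new vertex occur in at most one of the three triangles, then the strands are
those of the normal multicurve in the subdivided triangle. -/
theorem follows (h : IsSubdivision T T' x ι s) (hco : ∀ y, N' (ι y) = N y)
    (hN : T.IsNormal N) (hN' : T'.IsNormal N') (hm : ∃ k₀, ∀ k ≠ k₀, T'.corner N' (s k) = 0) :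
    Follows T T' (fun a b => b = ι a) N N' ∧ Follows T' T (fun b a => b = ι a) N' N := by
  obtain ⟨k₀, hm⟩ := hm
  fin_cases k₀
  · have h₁ := hm 1 (by decide)
    have h₂ := hm 2 (by decide)
    exact ⟨h.follows_aux hco hN hN' h₁ h₂, h.follows_symm_aux hco hN hN' h₁ h₂⟩
  · have h₁ := hm 2 (by decide)
    have h₂ := hm 0 (by decide)
    exact ⟨h.rotate.follows_aux hco hN hN' h₁ h₂, h.rotate.follows_symm_aux hco hN hN' h₁ h₂⟩
  · have h₁ := hm 0 (by decide)
    have h₂ := hm 1 (by decide)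
    exact ⟨h.rotate.rotate.follows_aux hco hN hN' h₁ h₂,
      h.rotate.rotate.follows_symm_aux hco hN hN' h₁ h₂⟩

theorem iterate_succ_succ (h : IsSubdivision T T' x ι s) (k : Fin 3) :
    T.prev (T.next^[k] x) = T.next^[(k + 2 : Fin 3)] x := by
  rw [show k + 2 = k + 1 + 1 by omega, h.iterate_succ, h.iterate_succ, next_next_eq_prev]

/-! ### Coordinates after a subdivision -/

/-- The coordinates after a subdivision: those of the spokes are the corner coordinates. -/
structure Coord (T : Tri D) (T' : Tri D') (x : D) (ι : D → D') (s : Fin 3 → D') (N : D → ℕ)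
    (N' : D' → ℕ) : Prop where
  side : ∀ y, N' (ι y) = N y
  spoke : ∀ k : Fin 3, N' (s k) = T.corner N (T.next^[k] x)
  twin_spoke : ∀ k : Fin 3, N' (T'.twin (s k)) = T.corner N (T.next^[k] x)

theorem exists_coord (h : IsSubdivision T T' x ι s) (N : D → ℕ) :
    ∃ N', Coord T T' x ι s N N' :=
  ⟨h.elim N (fun k => T.corner N (T.next^[k] x)) (fun k => T.corner N (T.next^[k] x)),
    h.elim_side _ _ _, h.elim_spoke _ _ _, h.elim_twin _ _ _⟩

theorem Coord.isNormal (h : IsSubdivision T T' x ι s) (hc : Coord T T' x ι s N N')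
    (hN : T.IsNormal N) : T'.IsNormal N' := by
  have key : ∀ k : Fin 3, N (T.next^[k] x) =
      T.corner N (T.next^[k] x) + T.corner N (T.next^[(k + 1 : Fin 3)] x) := fun k => by
    rw [h.iterate_succ]
    exact hN.eq_corner_add _
  have next_t : ∀ k : Fin 3, T'.next (T'.twin (s k)) = s (k + 2) := fun k => by
    rw [← h.next_twin_spoke (k + 2), show k + 2 + 1 = k by omega]
  have key' : ∀ k : Fin 3, N (T.prev (T.next^[k] x)) =
      T.corner N (T.next^[(k + 2 : Fin 3)] x) + T.corner N (T.next^[k] x) := fun k => by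
    have := key (k + 2)
    rw [show k + 2 + 1 = k by omega] at this
    rwa [h.iterate_succ_succ]
  constructor
  · refine h.cases (fun y => ?_) (fun k => ?_) (fun k => ?_)
    · rw [h.twin, hc.side, hc.side, hN.twin]
    · rw [hc.spoke, hc.twin_spoke]
    · rw [T'.twin_twin, hc.spoke, hc.twin_spoke]
  · refine h.cases (fun y => ?_) (fun k => ?_) (fun k => ?_)
    · rcases h.eq_iterate_or y with ⟨k, rfl⟩ | ⟨e₀, e₁, e₂⟩
      · rw [h.prev_side, h.next_side, hc.side, hc.spoke, hc.twin_spoke, key]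
        omega
      · rw [h.prev_other e₀ e₁ e₂, h.next_other y e₀ e₁ e₂, hc.side, hc.side, hc.side]
        exact hN.triangle y
    · rw [h.prev_spoke, h.next_spoke, hc.side, hc.spoke, hc.twin_spoke, key]
      omega
    · rw [h.prev_twin_spoke, next_t, hc.side, hc.spoke, hc.twin_spoke, key']
      omega
  · refine h.cases (fun y => ?_) (fun k => ?_) (fun k => ?_)
    · rcases h.eq_iterate_or y with ⟨k, rfl⟩ | ⟨e₀, e₁, e₂⟩
      · rw [h.prev_side, h.next_side, hc.side, hc.spoke, hc.twin_spoke, key, Nat.even_iff]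
        omega
      · rw [h.prev_other e₀ e₁ e₂, h.next_other y e₀ e₁ e₂, hc.side, hc.side, hc.side]
        exact hN.even y
    · rw [h.prev_spoke, h.next_spoke, hc.side, hc.spoke, hc.twin_spoke, key, Nat.even_iff]
      omega
    · rw [h.prev_twin_spoke, next_t, hc.side, hc.spoke, hc.twin_spoke, key', Nat.even_iff]
      omega

theorem Coord.corner_spoke (h : IsSubdivision T T' x ι s) (hc : Coord T T' x ι s N N')
    (hN : T.IsNormal N) (k : Fin 3) : T'.corner N' (s k) = 0 := by
  have := hN.eq_corner_add (T.next^[k] x)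
  rw [← h.iterate_succ] at this
  rw [corner, h.next_spoke, h.prev_spoke, hc.side, hc.spoke, hc.twin_spoke]
  omega

/-! ### Removing a vertex of degree three -/

/-- Since the complement is connected, no component encircles the vertex: the innermost one would
cut off the vertex. -/
theorem exists_corner_eq_zero (h : IsSubdivision T T' x ι s) (hN' : T'.IsNormal N')
    (hcon : T'.NormalComplementConnected N') : ∃ k, T'.corner N' (s k) = 0 := by
  by_contra hm
  push Not at hm
  have eqs := fun k => h.eq_corner_add (N := fun y => N' (ι y)) (fun _ => rfl) hN' k
  have next_t : ∀ k : Fin 3, T'.next (T'.twin (s k)) = s (k + 2) := fun k => by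
    rw [← h.next_twin_spoke (k + 2), show k + 2 + 1 = k by omega]
  have pos : ∀ k, T'.corner N' (T'.twin (s k)) < N' (s k) := fun k => by
    have := (eqs (k + 2)).2.2
    rw [show k + 2 + 1 = k by omega] at this
    have := hm (k + 2)
    omega
  rw [normalComplementConnected_iff] at hcon
  -- the segments of the spokes next to the vertex
  let S : D' × ℕ → Prop := fun p => ∃ k, p = (s k, 0) ∨ p = (T'.twin (s k), N' (s k))
  have hS : ∀ p q, T'.PointStep N' Set.univ 0 p q → S p = S q := by
    rintro ⟨b, i⟩ q (⟨hi, rfl⟩ | ⟨-, hi, rfl⟩)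
    · dsimp only at hi ⊢
      simp only [eq_iff_iff, S, Prod.mk.injEq]
      constructor
      · rintro ⟨k, ⟨rfl, rfl⟩ | ⟨rfl, rfl⟩⟩
        · exact ⟨k + 1, .inr ⟨h.prev_spoke k, by rw [h.prev_spoke, hN'.twin]; omega⟩⟩
        · have := pos k
          omega
      · rintro ⟨k, ⟨hb, hi'⟩ | ⟨hb, hi'⟩⟩
        · have hb' : b = ι (T.next^[k] x) := by rw [← T'.next_prev b, hb, h.next_spoke]
          rw [hb'] at hi
          rw [hb] at hi'
          have := (eqs k).1
          have := hm k
          omega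
        · have hb' : b = s (k + 2) := by rw [← T'.next_prev b, hb, next_t]
          refine ⟨k + 2, .inl ⟨hb', ?_⟩⟩
          rw [hb, hN'.twin] at hi'
          have := pos k
          omega
    · dsimp only at hi ⊢
      simp only [eq_iff_iff, S, Prod.mk.injEq]
      constructor
      · rintro ⟨k, ⟨rfl, rfl⟩ | ⟨rfl, rfl⟩⟩
        · exact ⟨k, .inr ⟨rfl, by omega⟩⟩
        · exact ⟨k, .inl ⟨T'.twin_twin _, by rw [hN'.twin]; omega⟩⟩
      · rintro ⟨k, ⟨hb, hi'⟩ | ⟨hb, hi'⟩⟩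
        · have hb' : b = T'.twin (s k) := by rw [← T'.twin_twin b, hb]
          refine ⟨k, .inr ⟨hb', ?_⟩⟩
          rw [hb', hN'.twin] at hi hi'
          omega
        · have hb' : b = s k := T'.twin_injective hb
          refine ⟨k, .inl ⟨hb', ?_⟩⟩
          rw [hb'] at hi hi'
          omega
  have h0 : S (s 0, N' (s 0)) := by
    rw [← Relation.EqvGen.eq_of_step hS (hcon (s 0, 0) (s 0, N' (s 0)) (Nat.zero_le _) le_rfl)]
    exact ⟨0, .inl rfl⟩
  have := pos 0
  obtain ⟨k, hk | hk⟩ := h0 <;> rw [Prod.mk.injEq] at hk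
  · omega
  · exact h.spoke_ne_twin _ _ hk.1

/-- If strands turned around the vertex in two of the three triangles, the innermost one would
leave the polygon through the side through which it came. -/
theorem corner_eq_zero_or (h : IsSubdivision T T' x ι s) (hN' : T'.IsNormal N')
    (hst : ∀ a i j, i < N' (ι a) → j < N' (ι a) →
      T'.Joined N' {z | ¬ ∃ z', z = ι z'} 1 (ι a, i) (ι a, j) → i = j)
    (k : Fin 3) (hk : T'.corner N' (s k) = 0) :
    T'.corner N' (s (k + 1)) = 0 ∨ T'.corner N' (s (k + 2)) = 0 := by
  by_contra hm
  push Not at hm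
  obtain ⟨h₁, h₂⟩ := hm
  have e₀ := h.eq_corner_add (N := fun y => N' (ι y)) (fun _ => rfl) hN' k
  have e₁ := h.eq_corner_add (N := fun y => N' (ι y)) (fun _ => rfl) hN' (k + 1)
  have e₂ := h.eq_corner_add (N := fun y => N' (ι y)) (fun _ => rfl) hN' (k + 2)
  have hs : ∀ k, s k ∈ {z | ¬ ∃ z', z = ι z'} := fun k => by
    rintro ⟨a, ha⟩; exact h.ne_spoke a k ha.symm
  rw [show k + 1 + 1 = k + 2 by omega] at e₁
  rw [show k + 2 + 1 = k by omega] at e₂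
  have around : ∀ j : Fin 3, T'.corner N' (s j) ≠ 0 →
      T'.Joined N' {z | ¬ ∃ z', z = ι z'} 1 (s j, 0) (s (j + 1), 0) := fun j hj => by
    have := (h.eq_corner_add (N := fun y => N' (ι y)) (fun _ => rfl) hN' j).2.2
    refine Relation.EqvGen.trans' (b := (T'.twin (s (j + 1)), N' (s (j + 1)) - 1))
      (Joined.arc (h.prev_spoke j) (by omega) (by rw [hN'.twin]; omega))
      (.symm _ _ (Joined.cross rfl (hs _) (by omega)))
  have c₁ := around (k + 1) h₁
  have c₂ := around (k + 2) h₂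
  rw [show k + 1 + 1 = k + 2 by omega] at c₁
  rw [show k + 2 + 1 = k by omega] at c₂
  have c₃ : T'.Joined N' {z | ¬ ∃ z', z = ι z'} 1 (ι (T.next^[k] x), N' (s k) - 1) (s k, 0) :=
    .arc (h.prev_side k) (by omega) (by omega)
  have c₄ : T'.Joined N' {z | ¬ ∃ z', z = ι z'} 1 (s (k + 1), 0)
      (T'.twin (s (k + 1)), N' (s (k + 1)) - 1) := .cross rfl (hs _) (by omega)
  have c₅ : T'.Joined N' {z | ¬ ∃ z', z = ι z'} 1 (T'.twin (s (k + 1)), N' (s (k + 1)) - 1)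
      (ι (T.next^[k] x), N' (s k)) := .arc (h.prev_twin_spoke_succ k) (by omega) (by omega)
  have := hst _ _ _ (by omega) (by omega)
    (c₃.trans' (c₂.symm'.trans' (c₁.symm'.trans' (c₄.trans' c₅))))
  omega

theorem exists_forall_corner_eq_zero (h : IsSubdivision T T' x ι s) (hN' : T'.IsNormal N')
    (hcon : T'.NormalComplementConnected N')
    (hst : ∀ a i j, i < N' (ι a) → j < N' (ι a) →
      T'.Joined N' {z | ¬ ∃ z', z = ι z'} 1 (ι a, i) (ι a, j) → i = j) :
    ∃ k₀, ∀ k ≠ k₀, T'.corner N' (s k) = 0 := by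
  obtain ⟨k, hk⟩ := h.exists_corner_eq_zero hN' hcon
  rcases h.corner_eq_zero_or hN' hst k hk with h' | h'
  · refine ⟨k + 2, fun j hj => ?_⟩
    rcases (by omega : j = k ∨ j = k + 1) with rfl | rfl <;> assumption
  · refine ⟨k + 1, fun j hj => ?_⟩
    rcases (by omega : j = k ∨ j = k + 2) with rfl | rfl <;> assumption

/-- The sides of the large triangle satisfy the triangle inequalities and the parity condition. -/
theorem isNormal_of_corner_eq_zero (h : IsSubdivision T T' x ι s) (hco : ∀ y, N' (ι y) = N y)
    (hN' : T'.IsNormal N') (hm : ∃ k₀, ∀ k ≠ k₀, T'.corner N' (s k) = 0) : T.IsNormal N := by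
  have key : ∀ k : Fin 3,
      N (T.next^[k] x) ≤ N (T.next (T.next^[k] x)) + N (T.prev (T.next^[k] x)) ∧
      (N (T.next^[k] x) + N (T.next (T.next^[k] x)) + N (T.prev (T.next^[k] x))) % 2 = 0 := by
    intro k
    rw [h.iterate_succ_succ, ← h.iterate_succ]
    have e₀ := h.eq_corner_add hco hN' k
    have e₁ := h.eq_corner_add hco hN' (k + 1)
    have e₂ := h.eq_corner_add hco hN' (k + 2)
    rw [show k + 1 + 1 = k + 2 by omega] at e₁
    rw [show k + 2 + 1 = k by omega] at e₂
    obtain ⟨k₀, hm⟩ := hm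
    have h₀ := hm k
    have h₁ := hm (k + 1)
    have h₂ := hm (k + 2)
    rcases (by omega : (k ≠ k₀ ∧ k + 1 ≠ k₀) ∨ (k ≠ k₀ ∧ k + 2 ≠ k₀) ∨ (k + 1 ≠ k₀ ∧ k + 2 ≠ k₀))
      with ⟨a, b⟩ | ⟨a, b⟩ | ⟨a, b⟩ <;> simp only [a, b, ne_eq, not_false_eq_true, forall_const]
        at h₀ h₁ h₂ <;> omega
  constructor
  · intro y
    rw [← hco, ← hco, ← h.twin, hN'.twin]
  · intro y
    rcases h.eq_iterate_or y with ⟨k, rfl⟩ | ⟨e₀, e₁, e₂⟩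
    · exact (key k).1
    · have := hN'.triangle (ι y)
      rwa [h.prev_other e₀ e₁ e₂, h.next_other y e₀ e₁ e₂, hco, hco, hco] at this
  · intro y
    rcases h.eq_iterate_or y with ⟨k, rfl⟩ | ⟨e₀, e₁, e₂⟩
    · exact Nat.even_iff.2 (key k).2
    · have := hN'.even (ι y)
      rwa [h.prev_other e₀ e₁ e₂, h.next_other y e₀ e₁ e₂, hco, hco, hco] at this

end IsSubdivision

namespace Tri

variable {D D' : Type}

/-! ### Components of normal multicurves -/

section labelling

variable {T : Tri D} {g : ℕ} {β : Fin g → D → ℕ} {lab : D → ℕ → Fin g}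

/-- The number of the arcs of the `k`-th component that cut off the corner of `x`. -/
def labelCorner (T : Tri D) (β : Fin g → D → ℕ) (lab : D → ℕ → Fin g) (k : Fin g) (x : D) : ℕ :=
  ((Finset.range (T.corner (total β) x)).filter (fun i => lab x i = k)).card

theorem IsLabelling.eq_of_joined (h : T.IsLabelling β lab) {x y : D} {i j : ℕ}
    (hi : i < total β x) (hj : j < total β y)
    (hJ : T.Joined (total β) Set.univ 1 (x, i) (y, j)) : lab x i = lab y j :=
  (h.iff_linked x y i j hi hj).2 hJ

/-- The arcs of a component around the two corners of a side have its points on this side as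
ends. -/
theorem IsLabelling.eq_labelCorner_add (hN : T.IsNormal (total β)) (h : T.IsLabelling β lab)
    (k : Fin g) (x : D) :
    β k x = T.labelCorner β lab k x + T.labelCorner β lab k (T.next x) := by
  have e := hN.eq_corner_add x
  have e' := hN.eq_corner_add (T.next x)
  rw [h.count, labelCorner, labelCorner, e, Finset.card_filter, Finset.card_filter,
    Finset.card_filter, Finset.sum_range_add]
  congr 1
  rw [← Finset.sum_range_reflect]
  refine Finset.sum_congr rfl fun j hj => ?_
  rw [Finset.mem_range] at hj
  have : lab x (T.corner (total β) x + (T.corner (total β) (T.next x) - 1 - j)) =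
      lab (T.next x) j :=
    h.eq_of_joined (by omega) (by omega)
      (.symm _ _ (Joined.arc (T.prev_next x) (by omega) (by omega)))
  rw [this]

/-- The corner coordinates of a component count its arcs. -/
theorem IsLabelling.corner_eq (hN : T.IsNormal (total β)) (h : T.IsLabelling β lab)
    (k : Fin g) (x : D) : T.corner (β k) x = T.labelCorner β lab k x := by
  have h₁ := h.eq_labelCorner_add hN k x
  have h₂ := h.eq_labelCorner_add hN k (T.next x)
  have h₃ := h.eq_labelCorner_add hN k (T.prev x)
  rw [T.next_prev] at h₃
  rw [T.next_next_eq_prev] at h₂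
  rw [corner]
  omega

theorem IsLabelling.twin (hN : T.IsNormal (total β)) (h : T.IsLabelling β lab)
    (k : Fin g) (x : D) : β k (T.twin x) = β k x := by
  rw [h.count, h.count, hN.twin, Finset.card_filter, Finset.card_filter,
    ← Finset.sum_range_reflect]
  refine Finset.sum_congr rfl fun j hj => ?_
  rw [Finset.mem_range] at hj
  rw [h.eq_of_joined (y := x) (j := j)]
  · rw [hN.twin]; omega
  · exact hj
  · exact .symm _ _ (Joined.cross rfl trivial (by omega))

theorem IsLabelling.le_total (β : Fin g → D → ℕ) (k : Fin g) (x : D) : β k x ≤ total β x :=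
  Finset.single_le_sum (f := fun k => β k x) (fun _ _ => Nat.zero_le _) (Finset.mem_univ k)

end labelling

section transfer

variable {T : Tri D} {T' : Tri D'} {R : D → D' → Prop} {g : ℕ} {β : Fin g → D → ℕ}
  {N' : D' → ℕ} {lab : D → ℕ → Fin g}

/-- The components in `T'` are obtained by following the strands to matched darts. -/
theorem IsLabelling.exists_transfer [Nonempty D] (H : Follows T T' R (total β) N')
    (H' : Follows T' T (fun b a => R a b) N' (total β)) (h : T.IsLabelling β lab) :
    ∃ (β' : Fin g → D' → ℕ) (lab' : D' → ℕ → Fin g), total β' = N' ∧ T'.IsLabelling β' lab' ∧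
      ∀ a b, R a b → ∀ i, i < total β a → lab a i = lab' b i := by
  have ex : ∀ b i, ∃ k : Fin g, i < N' b → ∀ c a j, R a c → j < N' c →
      T'.Joined N' Set.univ 1 (b, i) (c, j) → lab a j = k := by
    intro b i
    by_cases hi : i < N' b
    · obtain ⟨c, a, j, hR, hj, hJ⟩ := H'.outer 1 le_rfl Set.univ (fun _ _ => trivial) b i hi
      refine ⟨lab a j, fun _ c' a' j' hR' hj' hJ' => ?_⟩
      refine h.eq_of_joined (by rw [H.coord hR']; exact hj') (by rw [H.coord hR]; exact hj) ?_
      exact H'.joined le_rfl (compatible_univ _) hR' hR (hJ'.symm'.trans' hJ)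
    · exact ⟨lab (Classical.arbitrary D) 0, fun h => (hi h).elim⟩
  choose lab' hlab' using ex
  have hlab : ∀ a b, R a b → ∀ i, i < total β a → lab a i = lab' b i := fun a b hab i hi =>
    hlab' b i (by rw [← H.coord hab]; exact hi) b a i hab (by rw [← H.coord hab]; exact hi)
      (.refl _)
  have htot : total (fun k b => ((Finset.range (N' b)).filter (fun i => lab' b i = k)).card) =
      N' := by
    funext b
    rw [total, ← Finset.card_eq_sum_card_fiberwise (fun _ _ => Finset.mem_coe.2 (Finset.mem_univ _)),
      Finset.card_range]
  refine ⟨fun k b => ((Finset.range (N' b)).filter (fun i => lab' b i = k)).card, lab', htot,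
    ⟨?_, ?_, ?_⟩, hlab⟩
  · intro b₁ b₂ i₁ i₂ h₁ h₂
    rw [htot] at h₁ h₂ ⊢
    obtain ⟨c₁, a₁, j₁, hR₁, hj₁, hJ₁⟩ :=
      H'.outer 1 le_rfl Set.univ (fun _ _ => trivial) b₁ i₁ h₁
    obtain ⟨c₂, a₂, j₂, hR₂, hj₂, hJ₂⟩ :=
      H'.outer 1 le_rfl Set.univ (fun _ _ => trivial) b₂ i₂ h₂
    rw [← hlab' b₁ i₁ h₁ c₁ a₁ j₁ hR₁ hj₁ hJ₁, ← hlab' b₂ i₂ h₂ c₂ a₂ j₂ hR₂ hj₂ hJ₂,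
      h.iff_linked _ _ _ _ (by rw [H.coord hR₁]; exact hj₁) (by rw [H.coord hR₂]; exact hj₂),
      linked_iff_joined, linked_iff_joined, H.joined_iff H' le_rfl (compatible_univ _) hR₁ hR₂]
    exact ⟨fun hJ => hJ₁.trans' (hJ.trans' hJ₂.symm'), fun hJ => hJ₁.symm'.trans' (hJ.trans' hJ₂)⟩
  · intro k b
    rw [htot]
  · intro k
    obtain ⟨x, hx⟩ := h.nonempty k
    rw [h.count, Finset.card_pos] at hx
    obtain ⟨i, hi⟩ := hx
    rw [Finset.mem_filter, Finset.mem_range] at hi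
    obtain ⟨c, b, j, hR, hj, hJ⟩ := H.outer 1 le_rfl Set.univ (fun _ _ => trivial) x i hi.1
    refine ⟨b, Finset.card_pos.2 ⟨j, ?_⟩⟩
    rw [Finset.mem_filter, Finset.mem_range, ← hlab c b hR j hj, ← H.coord hR,
      ← h.eq_of_joined hi.1 hj hJ]
    exact ⟨hj, hi.2⟩

/-- The Heegaard diagram after a move, if the corners, strands and regions can be followed in both
directions. -/
theorem IsHeegaardDiagram.exists_transfer (hR : IsMatching T T' R) {f : D → D'} {f' : D' → D}
    (hf : IsCornerMap T T' R f) (hf' : IsCornerMap T' T (fun b a => R a b) f')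
    (H : Follows T T' R (total β) N') (H' : Follows T' T (fun b a => R a b) N' (total β))
    (hN' : T'.IsNormal N') (hg : T'.HasGenus g) {α : Fin g → List D} {α' : Fin g → List D'}
    (hα : ∀ i, List.Forall₂ R (α i) (α' i)) (h : T.IsHeegaardDiagram g α β) :
    ∃ β' : Fin g → D' → ℕ, total β' = N' ∧ T'.IsHeegaardDiagram g α' β' ∧
      T.IsotopicInPolygon T' β β' R := by
  obtain ⟨lab, hlab⟩ := h.normal.2
  have := h.genus.1.1
  obtain ⟨β', lab', htot, hlab', hagree⟩ := hlab.exists_transfer H H'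
  refine ⟨β', htot, ⟨hg, h.edged.transfer hR hf hf' hα, h.edged_system.transfer hf hα,
    ⟨htot ▸ hN', lab', hlab'⟩, htot ▸ h.normal_system.transfer H H'⟩,
    ⟨lab, lab', hlab, hlab', fun a b hab => ⟨?_, hagree a b hab⟩⟩, ?_⟩
  · rw [htot, H.coord hab]
  · intro a b c d hab hcd i j _ _
    rw [htot]
    exact H.joined_iff H' le_rfl (compatible_unmatched R) hab hcd

theorem IsotopicInPolygon.coord {β' : Fin g → D' → ℕ} (h : T.IsotopicInPolygon T' β β' R)
    (k : Fin g) {a : D} {b : D'} (hab : R a b) : β' k b = β k a := by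
  obtain ⟨⟨lab, lab', hlab, hlab', hagree⟩, -⟩ := h
  obtain ⟨h₁, h₂⟩ := hagree a b hab
  rw [hlab.count, hlab'.count, ← h₁]
  congr 1
  refine Finset.filter_congr fun i hi => ?_
  rw [h₂ i (Finset.mem_range.1 hi)]

end transfer

/-- After a flip, every component has the coordinates that the rule for the union gives. -/
theorem IsFlipAlong.coord_component {T : Tri D} {T' : Tri D'} {e : D ≃ D'} {d : D}
    (h : IsFlipAlong T T' e d) {g : ℕ} {β : Fin g → D → ℕ} {β' : Fin g → D' → ℕ}
    (hc : IsFlipAlong.Coord T e d (total β) (total β')) (hN : T.IsNormal (total β))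
    (hiso : T.IsotopicInPolygon T' β β' (fun a b => b = e a ∧ a ≠ d ∧ a ≠ T.twin d)) (k : Fin g) :
    IsFlipAlong.Coord T e d (β k) (β' k) := by
  have hN' := hc.isNormal h hN
  have hother : ∀ a, a ≠ d → a ≠ T.twin d → β' k (e a) = β k a := fun a h₁ h₂ =>
    hiso.coord k ⟨rfl, h₁, h₂⟩
  obtain ⟨⟨lab, lab', hlab, hlab', hagree⟩, -⟩ := hiso
  have htw : β' k (e (T.twin d)) = β' k (e d) := by rw [← h.twin, hlab'.twin hN']
  refine ⟨hother, ?_, htw⟩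
  have hn := hc.other _ (T.next_ne d) h.ne_next.symm
  have hp := hc.other _ (T.prev_ne d) h.ne_prev.symm
  have htn := hc.other _ h.next_twin_ne (T.next_ne _)
  have htp := hc.other _ h.prev_twin_ne (T.prev_ne _)
  have hd := hc.diag
  obtain ⟨k₁, k₂, k₃⟩ := hN.eq_corner_add₃ (x := d) rfl rfl
  obtain ⟨k₄, k₅, k₆⟩ := hN.eq_corner_add₃ (x := T.twin d) rfl rfl
  rw [next_next_eq_prev] at k₂ k₃ k₅ k₆
  have hNt := hN.twin d
  obtain ⟨l₁, l₂, l₃⟩ := hN'.eq_corner_add₃ h.next_d h.next_prev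
  have hmin : T'.corner (total β') (e (T.next (T.twin d))) =
      min (T.corner (total β) d) (T.corner (total β) (T.next (T.twin d))) := by omega
  -- the points on the diagonal that belong to the component, counted from the origin of `d`
  let F : ℕ → ℕ := fun m => ((Finset.range m).filter (fun i => lab d i = k)).card
  have F_mono : Monotone F := fun m n hmn =>
    Finset.card_le_card (Finset.filter_subset_filter _ (Finset.range_mono hmn))
  have hlabel : ∀ i, i < T.corner (total β) (T.next (T.twin d)) →
      lab (T.next (T.twin d)) i = lab d i := fun i hi =>
    hlab.eq_of_joined (by omega) (by omega)
      ((Joined.arc (j := total β d - 1 - i) (T.prev_next _) (by omega) (by omega)).trans'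
        (Joined.cross (T.twin_twin d) trivial (by omega)))
  have f₁ : T.labelCorner β lab k d = F (T.corner (total β) d) := rfl
  have f₂ : T.labelCorner β lab k (T.next (T.twin d)) =
      F (T.corner (total β) (T.next (T.twin d))) := by
    rw [labelCorner]
    congr 1
    exact Finset.filter_congr fun i hi => by rw [hlabel i (Finset.mem_range.1 hi)]
  have f₃ : T'.labelCorner β' lab' k (e (T.next (T.twin d))) =
      min (F (T.corner (total β) d)) (F (T.corner (total β) (T.next (T.twin d)))) := by
    rw [← F_mono.map_min, ← hmin, labelCorner]
    congr 1
    refine Finset.filter_congr fun i hi => ?_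
    rw [Finset.mem_range] at hi
    rw [← (hagree _ _ ⟨rfl, h.next_twin_ne, T.next_ne _⟩).2 i (by omega), hlabel i (by omega)]
  have b₁ := hlab.eq_labelCorner_add hN k d
  have b₂ := hlab.eq_labelCorner_add hN k (T.next d)
  have b₃ := hlab.eq_labelCorner_add hN k (T.prev d)
  have b₄ := hlab.eq_labelCorner_add hN k (T.twin d)
  have b₅ := hlab.eq_labelCorner_add hN k (T.next (T.twin d))
  have b₆ := hlab.eq_labelCorner_add hN k (T.prev (T.twin d))
  have b₇ := hlab.twin hN k d
  rw [next_next_eq_prev] at b₂ b₅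
  rw [T.next_prev] at b₃ b₆
  have b₁' := hlab'.eq_labelCorner_add hN' k (e d)
  have b₂' := hlab'.eq_labelCorner_add hN' k (e (T.prev d))
  have b₃' := hlab'.eq_labelCorner_add hN' k (e (T.next (T.twin d)))
  rw [h.next_d] at b₁'
  rw [h.next_prev, hother _ (T.prev_ne d) h.ne_prev.symm] at b₂'
  rw [h.next_next_twin, hother _ h.next_twin_ne (T.next_ne _)] at b₃'
  clear k₁ k₂ k₃ k₄ k₅ k₆ l₁ l₂ l₃ hd hn hp htn htp hNt hmin
  omega

/-- After a subdivision, the coordinates of every component on the spokes are its corner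
coordinates. -/
theorem _root_.IsSubdivision.coord_component {T : Tri D} {T' : Tri D'} {x : D} {ι : D → D'}
    {s : Fin 3 → D'} (h : IsSubdivision T T' x ι s) {g : ℕ} {β : Fin g → D → ℕ}
    {β' : Fin g → D' → ℕ} (hc : IsSubdivision.Coord T T' x ι s (total β) (total β'))
    (hN : T.IsNormal (total β))
    (hiso : T.IsotopicInPolygon T' β β' (fun a b => b = ι a)) (k : Fin g) :
    IsSubdivision.Coord T T' x ι s (β k) (β' k) := by
  have hN' := hc.isNormal h hN
  have hside : ∀ y, β' k (ι y) = β k y := fun y => hiso.coord k rfl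
  obtain ⟨⟨lab, lab', hlab, hlab', hagree⟩, -⟩ := hiso
  have hspoke : ∀ j : Fin 3, β' k (s j) = T.corner (β k) (T.next^[j] x) := by
    intro j
    have h₀ := hc.corner_spoke h hN j
    have h₁ := (h.eq_corner_add hc.side hN' j).1
    have hz : T'.labelCorner β' lab' k (s j) = 0 := by
      rw [labelCorner, h₀]
      rfl
    rw [hlab'.eq_labelCorner_add hN' k (s j), hz, h.next_spoke, hlab.corner_eq hN, zero_add,
      labelCorner, labelCorner]
    rw [h₀, zero_add, hc.spoke] at h₁
    rw [← h₁]
    congr 1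
    refine Finset.filter_congr fun i hi => ?_
    have := hN.eq_corner_add (T.next^[j] x)
    rw [Finset.mem_range] at hi
    rw [(hagree _ _ rfl).2 i (by omega)]
  exact ⟨hside, hspoke, fun j => by rw [hlab'.twin hN', hspoke]⟩

theorem exists_forall₂ {R : D → D' → Prop} {l : List D} (h : ∀ a ∈ l, ∃ b, R a b) :
    ∃ l', List.Forall₂ R l l' := by
  induction l with
  | nil => exact ⟨[], .nil⟩
  | cons a l ih =>
    obtain ⟨b, hb⟩ := h a (by simp)
    obtain ⟨l', hl'⟩ := ih fun a ha => h a (by simp [ha])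
    exact ⟨b :: l', .cons hb hl'⟩

theorem IsFlipAlong.exists_coord {T : Tri D} {T' : Tri D'} {e : D ≃ D'} {d : D}
    (_h : IsFlipAlong T T' e d) {N : D → ℕ} (hN : T.IsNormal N) :
    ∃ N', IsFlipAlong.Coord T e d N N' := by
  classical
  have h₁ := hN.eq_corner_add d
  have h₂ := hN.triangle d
  refine ⟨fun b => if e.symm b = d ∨ e.symm b = T.twin d then
    max (N (T.next d) + N (T.next (T.twin d))) (N (T.prev d) + N (T.prev (T.twin d))) - N d
    else N (e.symm b), ?_, ?_, ?_⟩
  · intro a h₁ h₂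
    simp [h₁, h₂]
  · have h₃ := hN.triangle (T.twin d)
    rw [hN.twin] at h₃
    simp only [Equiv.symm_apply_apply, true_or, if_true]
    omega
  · simp

/-- The Heegaard diagram after a flip. -/
theorem IsFlipAlong.exists_heegaard [Fintype D] [Fintype D'] {T : Tri D} {T' : Tri D'} {e : D ≃ D'}
    {d : D} (h : IsFlipAlong T T' e d) {g : ℕ} {α : Fin g → List D} {β : Fin g → D → ℕ}
    {α' : Fin g → List D'} (hT : T.IsHeegaardDiagram g α β)
    (hα : ∀ i, List.Forall₂ (fun a b => b = e a ∧ a ≠ d ∧ a ≠ T.twin d) (α i) (α' i)) :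
    ∃ β' : Fin g → D' → ℕ, T'.IsHeegaardDiagram g α' β' ∧
      T.IsotopicInPolygon T' β β' (fun a b => b = e a ∧ a ≠ d ∧ a ≠ T.twin d) ∧
      IsFlipAlong.Coord T e d (total β) (total β') ∧
      ∀ k, IsFlipAlong.Coord T e d (β k) (β' k) := by
  have hN := hT.normal.1
  obtain ⟨N', hc⟩ := h.exists_coord hN
  obtain ⟨f', hf'⟩ := h.exists_isCornerMap_symm
  obtain ⟨β', rfl, hT', hiso⟩ := hT.exists_transfer h.isMatching h.isCornerMap hf'
    (h.follows hc hN) (h.follows_symm hc hN) (hc.isNormal h hN) (h.hasGenus hT.genus) hα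
  exact ⟨β', hT', hiso, hc, h.coord_component hc hN hiso⟩

/-- The Heegaard diagram after a subdivision. -/
theorem _root_.IsSubdivision.exists_heegaard [Fintype D] [Fintype D'] {T : Tri D} {T' : Tri D'}
    {x : D} {ι : D → D'} {s : Fin 3 → D'} (h : IsSubdivision T T' x ι s) {g : ℕ}
    {α : Fin g → List D} {β : Fin g → D → ℕ} {α' : Fin g → List D'}
    (hT : T.IsHeegaardDiagram g α β)
    (hα : ∀ i, List.Forall₂ (fun a b => b = ι a) (α i) (α' i)) :
    ∃ β' : Fin g → D' → ℕ, T'.IsHeegaardDiagram g α' β' ∧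
      T.IsotopicInPolygon T' β β' (fun a b => b = ι a) ∧
      IsSubdivision.Coord T T' x ι s (total β) (total β') ∧
      ∀ k, IsSubdivision.Coord T T' x ι s (β k) (β' k) := by
  have hN := hT.normal.1
  obtain ⟨N', hc⟩ := h.exists_coord (total β)
  have hN' := hc.isNormal h hN
  obtain ⟨H, H'⟩ := h.follows hc.side hN hN' ⟨0, fun k _ => hc.corner_spoke h hN k⟩
  obtain ⟨β', rfl, hT', hiso⟩ := hT.exists_transfer h.isMatching h.isCornerMap h.isCornerMap_symm
    H H' hN' (h.hasGenus_iff.1 hT.genus) hα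
  exact ⟨β', hT', hiso, hc, h.coord_component hc hN hiso⟩

/-- The Heegaard diagram after the removal of a vertex of degree three. -/
theorem _root_.IsSubdivision.exists_heegaard_symm [Fintype D] [Fintype D'] {T : Tri D}
    {T' : Tri D'} {x : D} {ι : D → D'} {s : Fin 3 → D'} (h : IsSubdivision T T' x ι s) {g : ℕ}
    {α : Fin g → List D} {α' : Fin g → List D'} {β' : Fin g → D' → ℕ}
    (hT' : T'.IsHeegaardDiagram g α' β')
    (hst : T'.StrandsJoinDistinctSides β' (fun b a => b = ι a))
    (hα : ∀ i, List.Forall₂ (fun b a => b = ι a) (α' i) (α i)) :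
    ∃ β : Fin g → D → ℕ, T.IsHeegaardDiagram g α β ∧
      T'.IsotopicInPolygon T β' β (fun b a => b = ι a) ∧
      (∀ y, total β y = total β' (ι y)) ∧ ∀ k y, β k y = β' k (ι y) := by
  have hN' := hT'.normal.1
  have hm := h.exists_forall_corner_eq_zero hN' hT'.normal_system
    fun a i j hi hj hJ => hst (ι a) a rfl i j hi hj hJ
  have hN : T.IsNormal fun y => total β' (ι y) :=
    h.isNormal_of_corner_eq_zero (fun _ => rfl) hN' hm
  obtain ⟨H, H'⟩ := h.follows (N := fun y => total β' (ι y)) (fun _ => rfl) hN hN' hm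
  obtain ⟨β, htot, hT, hiso⟩ := hT'.exists_transfer h.isMatching.symm h.isCornerMap_symm
    h.isCornerMap H' H hN (h.hasGenus_iff.2 hT'.genus) hα
  exact ⟨β, hT, hiso, fun y => congrFun htot y, fun k y => hiso.coord k rfl⟩

end Tri

/-! ### Running programs -/

/-- The program `p` started in the state `s` halts after at most `c` steps in a state that
satisfies `Q`. -/
def Run (W : ℕ) (p : Prog) (s : State) (c : ℕ) (Q : State → Prop) : Prop :=
  ∃ s' t, Exec W p s s' t ∧ t ≤ c ∧ Q s'

namespace State

@[simp] theorem setReg_mem (s : State) (r v : ℕ) : (s.setReg r v).mem = s.mem := rfl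

@[simp] theorem setReg_reg (s : State) (r v q : ℕ) :
    (s.setReg r v).reg q = if q = r then v else s.reg q := by
  simp [setReg, Function.update_apply]

@[simp] theorem setMem_reg (s : State) (A : Arr) (i v : ℕ) : (s.setMem A i v).reg = s.reg := rfl

theorem setMem_mem (s : State) (A : Arr) (i v : ℕ) (B : Arr) :
    (s.setMem A i v).mem B = if B = A then Function.update (s.mem A) i v else s.mem B := by
  simp [setMem, Function.update_apply]

end State

namespace Prog

/-- A list of programs, run one after the other. -/
def block : List Prog → Prog
  | [] => .skip
  | p :: l => .seq p (block l)

end Prog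

namespace Run

variable {W : ℕ} {s : State} {c c' : ℕ} {Q Q' : State → Prop} {p q : Prog} {l : List Prog}

theorem mono (h : Run W p s c Q) (hc : c ≤ c') (hQ : ∀ s', Q s' → Q' s') : Run W p s c' Q' := by
  obtain ⟨s', t, h₁, h₂, h₃⟩ := h
  exact ⟨s', t, h₁, h₂.trans hc, hQ s' h₃⟩

theorem seq (h : Run W p s c fun s' => Run W q s' c' Q) : Run W (.seq p q) s (c + c') Q := by
  obtain ⟨s₁, t₁, h₁, ht₁, s₂, t₂, h₂, ht₂, hQ⟩ := h
  exact ⟨s₂, t₁ + t₂, .seq _ _ _ _ _ _ _ h₁ h₂, by omega, hQ⟩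

theorem nil (h : Q s) : Run W (Prog.block []) s 1 Q := ⟨s, 1, .skip s, le_rfl, h⟩

theorem const {r n : ℕ} (hn : n < 2 ^ W) (h : Run W (Prog.block l) (s.setReg r n) c Q) :
    Run W (Prog.block (.const r n :: l)) s (c + 1) Q :=
  (seq (c := 1) ⟨_, 1, .const s r n hn, le_rfl, h⟩).mono (by omega) fun _ h => h

theorem op {o : Op} {r a b v : ℕ} (hv : o.eval (s.reg a) (s.reg b) = v) (hlt : v < 2 ^ W)
    (h : Run W (Prog.block l) (s.setReg r v) c Q) :
    Run W (Prog.block (.op o r a b :: l)) s (c + 1) Q := by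
  subst hv
  exact (seq (c := 1) ⟨_, 1, .op s o r a b hlt, le_rfl, h⟩).mono (by omega) fun _ h => h

theorem load {r a v : ℕ} {A : Arr} (hv : s.mem A (s.reg a) = v) (hlt : v < 2 ^ W)
    (h : Run W (Prog.block l) (s.setReg r v) c Q) :
    Run W (Prog.block (.load r A a :: l)) s (c + 1) Q := by
  subst hv
  exact (seq (c := 1) ⟨_, 1, .load s r A a hlt, le_rfl, h⟩).mono (by omega) fun _ h => h

theorem store {a b : ℕ} {A : Arr}
    (h : Run W (Prog.block l) (s.setMem A (s.reg a) (s.reg b)) c Q) :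
    Run W (Prog.block (.store A a b :: l)) s (c + 1) Q :=
  (seq (c := 1) ⟨_, 1, .store s A a b, le_rfl, h⟩).mono (by omega) fun _ h => h

theorem ifTrue {a b : ℕ} (hab : s.reg a < s.reg b) (h : Run W p s c Q) :
    Run W (.ifLt a b p q) s (c + 1) Q := by
  obtain ⟨s', t, h₁, h₂, h₃⟩ := h
  exact ⟨s', t + 1, .ifTrue _ _ _ _ _ _ _ hab h₁, by omega, h₃⟩

theorem ifFalse {a b : ℕ} (hab : ¬ s.reg a < s.reg b) (h : Run W q s c Q) :
    Run W (.ifLt a b p q) s (c + 1) Q := by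
  obtain ⟨s', t, h₁, h₂, h₃⟩ := h
  exact ⟨s', t + 1, .ifFalse _ _ _ _ _ _ _ hab h₁, by omega, h₃⟩

/-- A `while` loop that runs from `j` to `K`, with an invariant that depends on `j`. -/
theorem while_of_invariant {a b K : ℕ} (I : ℕ → State → Prop)
    (hI : ∀ j s, I j s → s.reg a = j ∧ s.reg b = K)
    (hbody : ∀ j s, j < K → I j s → Run W p s c (I (j + 1))) :
    ∀ n j s, j + n = K → I j s → Run W (.whileLt a b p) s (n * (c + 1) + 1) (I K) := by
  intro n
  induction n with
  | zero =>
    intro j s hj h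
    obtain ⟨ha, hb⟩ := hI j s h
    exact ⟨s, 1, .whileFalse _ _ _ _ (by omega), by omega, by rwa [← hj]⟩
  | succ n ih =>
    intro j s hj h
    obtain ⟨ha, hb⟩ := hI j s h
    obtain ⟨s₁, t₁, h₁, ht₁, hs₁⟩ := hbody j s (by omega) h
    obtain ⟨s₂, t₂, h₂, ht₂, hs₂⟩ := ih (j + 1) s₁ (by omega) hs₁
    refine ⟨s₂, t₁ + t₂ + 1, .whileTrue _ _ _ _ _ _ _ _ (by omega) h₁ h₂, ?_, hs₂⟩
    rw [Nat.succ_mul]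
    omega

end Run

/-! ### Loops over the stored vectors -/

namespace Prog

/-- Run `body` for the values `0, …, K - 1` of register `50`, where `K` is the value of register
`k`.  Register `51` holds the constant `1`. -/
def loop (k : ℕ) (body : List Prog) : Prog :=
  .seq (block [.const 50 0, .const 51 1])
    (.whileLt 50 k (.seq (block body) (block [.op .add 50 50 51])))

end Prog

/-- The state `s'` differs from `s` only in the registers from `50` on and in the block of
coordinates that starts at `dst`, whose first `j` cells hold the values of `F`. -/
structure Filled (s s' : State) (dst : ℕ) (F : ℕ → ℕ) (j : ℕ) : Prop where
  reg : ∀ r < 50, s'.reg r = s.reg r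
  mem : ∀ A, A ≠ Arr.coord → s'.mem A = s.mem A
  filled : ∀ i < j, s'.mem .coord (dst + i) = F i
  other : ∀ a, a < dst ∨ dst + j ≤ a → s'.mem .coord a = s.mem .coord a

theorem run_loop {W : ℕ} {s : State} {k K dst c : ℕ} {body : List Prog} {F : ℕ → ℕ} (hk : k < 50)
    (hK : s.reg k = K) (hW : K + 1 < 2 ^ W)
    (hbody : ∀ j s', j < K → Filled s s' dst F j → s'.reg 50 = j →
      Run W (Prog.block body) s' c fun s'' =>
        s''.mem = (s'.setMem .coord (dst + j) (F j)).mem ∧ ∀ r < 52, s''.reg r = s'.reg r) :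
    Run W (Prog.loop k body) s (K * (c + 3) + 4) fun s' => Filled s s' dst F K := by
  refine (Run.seq (c := 3) (c' := K * (c + 2 + 1) + 1) ?_).mono (by rw [Nat.add_assoc c 2 1]; omega)
    fun _ h => h
  refine Run.const (by omega) (Run.const (by omega) (Run.nil ?_))
  refine (Run.while_of_invariant (K := K)
    (fun j s' => Filled s s' dst F j ∧ s'.reg 50 = j ∧ s'.reg 51 = 1) ?_ ?_ K 0 _ (by omega)
    ⟨⟨?_, ?_, ?_, ?_⟩, ?_, ?_⟩).mono le_rfl fun _ h => h.1
  · rintro j s' ⟨h₁, h₂, -⟩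
    exact ⟨h₂, by rw [h₁.reg k hk, hK]⟩
  · rintro j s' hj ⟨h₁, h₂, h₃⟩
    refine Run.seq (c := c) (c' := 2) ((hbody j s' hj h₁ h₂).mono le_rfl ?_)
    rintro s'' ⟨hm, hr⟩
    refine Run.op (v := j + 1) ?_ (by omega) (Run.nil ⟨⟨?_, ?_, ?_, ?_⟩, ?_, ?_⟩)
    · rw [hr 50 (by omega), hr 51 (by omega), h₂, h₃]
      rfl
    · intro r hr'
      rw [State.setReg_reg, if_neg (by omega), hr r (by omega), h₁.reg r hr']
    · intro A hA
      rw [State.setReg_mem, hm, State.setMem_mem, if_neg hA, h₁.mem A hA]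
    · intro i hi
      rw [State.setReg_mem, hm, State.setMem_mem, if_pos rfl, Function.update_apply]
      split_ifs with h
      · rw [show i = j by omega]
      · exact h₁.filled i (by omega)
    · intro a ha
      rw [State.setReg_mem, hm, State.setMem_mem, if_pos rfl, Function.update_apply,
        if_neg (by omega), h₁.other a (by omega)]
    · simp
    · simp [hr 51 (by omega), h₃]
  · intro r hr
    simp only [State.setReg_reg]
    rw [if_neg (by omega), if_neg (by omega)]
  · simp
  · intro i hi
    omega
  · simp
  · simp
  · simp

namespace Prog

/-- Compute half of the sum of the coordinates in the blocks at the registers `a` and `c` minus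
that in the block at `b`. -/
def cornerBody (a b c dst : ℕ) : List Prog :=
  [.op .add 52 a 50, .load 52 .coord 52, .op .add 53 c 50, .load 53 .coord 53,
    .op .add 54 b 50, .load 54 .coord 54, .op .add 52 52 53, .op .sub 52 52 54, .const 53 2,
    .op .div 52 52 53, .op .add 53 dst 50, .store .coord 53 52]

/-- Compute the maximum of the sums of opposite sides minus the diagonal, whose block is at the
register `d`. -/
def flipBody (d n p tn tp : ℕ) : List Prog :=
  [.op .add 52 n 50, .load 52 .coord 52, .op .add 53 tn 50, .load 53 .coord 53,
    .op .add 52 52 53, .op .add 53 p 50, .load 53 .coord 53, .op .add 54 tp 50,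
    .load 54 .coord 54, .op .add 53 53 54, .op .sub 54 52 53, .op .add 53 53 54,
    .op .add 55 d 50, .load 54 .coord 55, .op .sub 53 53 54, .store .coord 55 53]

end Prog

theorem run_cornerBody {W B : ℕ} {s : State} {a b c dst j va vb vc : ℕ} (hB : 10 * B < 2 ^ W)
    (ha : a < 50) (hb : b < 50) (hc : c < 50) (hd : dst < 50) (hj : s.reg 50 = j)
    (hBa : s.reg a + j ≤ B) (hBb : s.reg b + j ≤ B) (hBc : s.reg c + j ≤ B)
    (hBd : s.reg dst + j ≤ B) (hB2 : 2 ≤ B)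
    (hva : s.mem .coord (s.reg a + j) = va) (hvb : s.mem .coord (s.reg b + j) = vb)
    (hvc : s.mem .coord (s.reg c + j) = vc) (hla : va ≤ B) (hlb : vb ≤ B) (hlc : vc ≤ B) :
    Run W (Prog.block (Prog.cornerBody a b c dst)) s 13 fun s' =>
      s'.mem = (s.setMem .coord (s.reg dst + j) ((va + vc - vb) / 2)).mem ∧
        ∀ r < 52, s'.reg r = s.reg r := by
  have na : a ≠ 52 ∧ a ≠ 53 ∧ a ≠ 54 := by omega
  have nb : b ≠ 52 ∧ b ≠ 53 ∧ b ≠ 54 := by omega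
  have nc : c ≠ 52 ∧ c ≠ 53 ∧ c ≠ 54 := by omega
  have nd : dst ≠ 52 ∧ dst ≠ 53 ∧ dst ≠ 54 := by omega
  refine Run.op (v := s.reg a + j) (by simp [Op.eval, hj]) (by omega) ?_
  refine Run.load (v := va) (by simp [hva]) (by omega) ?_
  refine Run.op (v := s.reg c + j) (by simp [Op.eval, hj, nc]) (by omega) ?_
  refine Run.load (v := vc) (by simp [hvc]) (by omega) ?_
  refine Run.op (v := s.reg b + j) (by simp [Op.eval, hj, nb]) (by omega) ?_
  refine Run.load (v := vb) (by simp [hvb]) (by omega) ?_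
  refine Run.op (v := va + vc) (by simp [Op.eval]) (by omega) ?_
  refine Run.op (v := va + vc - vb) (by simp [Op.eval]) (by omega) ?_
  refine Run.const (by omega) ?_
  refine Run.op (v := (va + vc - vb) / 2) (by simp [Op.eval]) (by omega) ?_
  refine Run.op (v := s.reg dst + j) (by simp [Op.eval, hj, nd]) (by omega) ?_
  refine Run.store (Run.nil ⟨?_, ?_⟩)
  · simp [State.setMem]
  · intro r hr
    have nr : r ≠ 52 ∧ r ≠ 53 ∧ r ≠ 54 := by omega
    simp [nr]

theorem run_flipBody {W B : ℕ} {s : State} {d n p tn tp j vd vn vp vtn vtp : ℕ}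
    (hB : 10 * B < 2 ^ W) (hd : d < 50) (hn : n < 50) (hp : p < 50) (htn : tn < 50) (htp : tp < 50)
    (hj : s.reg 50 = j) (hBd : s.reg d + j ≤ B) (hBn : s.reg n + j ≤ B) (hBp : s.reg p + j ≤ B)
    (hBtn : s.reg tn + j ≤ B) (hBtp : s.reg tp + j ≤ B)
    (hvd : s.mem .coord (s.reg d + j) = vd) (hvn : s.mem .coord (s.reg n + j) = vn)
    (hvp : s.mem .coord (s.reg p + j) = vp) (hvtn : s.mem .coord (s.reg tn + j) = vtn)
    (hvtp : s.mem .coord (s.reg tp + j) = vtp) (hld : vd ≤ B) (hln : vn ≤ B) (hlp : vp ≤ B)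
    (hltn : vtn ≤ B) (hltp : vtp ≤ B) :
    Run W (Prog.block (Prog.flipBody d n p tn tp)) s 17 fun s' =>
      s'.mem = (s.setMem .coord (s.reg d + j) (max (vn + vtn) (vp + vtp) - vd)).mem ∧
        ∀ r < 52, s'.reg r = s.reg r := by
  have nd : d ≠ 52 ∧ d ≠ 53 ∧ d ≠ 54 ∧ d ≠ 55 := by omega
  have nn : n ≠ 52 ∧ n ≠ 53 ∧ n ≠ 54 := by omega
  have np : p ≠ 52 ∧ p ≠ 53 ∧ p ≠ 54 := by omega
  have ntn : tn ≠ 52 ∧ tn ≠ 53 ∧ tn ≠ 54 := by omega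
  have ntp : tp ≠ 52 ∧ tp ≠ 53 ∧ tp ≠ 54 := by omega
  refine Run.op (v := s.reg n + j) (by simp [Op.eval, hj]) (by omega) ?_
  refine Run.load (v := vn) (by simp [hvn]) (by omega) ?_
  refine Run.op (v := s.reg tn + j) (by simp [Op.eval, hj, ntn]) (by omega) ?_
  refine Run.load (v := vtn) (by simp [hvtn]) (by omega) ?_
  refine Run.op (v := vn + vtn) (by simp [Op.eval]) (by omega) ?_
  refine Run.op (v := s.reg p + j) (by simp [Op.eval, hj, np]) (by omega) ?_
  refine Run.load (v := vp) (by simp [hvp]) (by omega) ?_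
  refine Run.op (v := s.reg tp + j) (by simp [Op.eval, hj, ntp]) (by omega) ?_
  refine Run.load (v := vtp) (by simp [hvtp]) (by omega) ?_
  refine Run.op (v := vp + vtp) (by simp [Op.eval]) (by omega) ?_
  refine Run.op (v := vn + vtn - (vp + vtp)) (by simp [Op.eval]) (by omega) ?_
  refine Run.op (v := max (vn + vtn) (vp + vtp)) (by simp [Op.eval]; omega) (by omega) ?_
  refine Run.op (v := s.reg d + j) (by simp [Op.eval, hj, nd]) (by omega) ?_
  refine Run.load (v := vd) (by simp [hvd]) (by omega) ?_
  refine Run.op (v := max (vn + vtn) (vp + vtp) - vd) (by simp [Op.eval]) (by omega) ?_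
  refine Run.store (Run.nil ⟨?_, ?_⟩)
  · simp [State.setMem]
  · intro r hr
    have nr : r ≠ 52 ∧ r ≠ 53 ∧ r ≠ 54 ∧ r ≠ 55 := by omega
    simp [nr]

/-! ### The data structure: auxiliary facts -/

namespace Tri

variable {D D' : Type}

/-- A numbering of the triangles is checked on representatives. -/
theorem face_iff_of_rep {T : Tri D} {φ : D → ℕ} {rep : D → Prop} (hφ : ∀ x, φ (T.next x) = φ x)
    (hrep : ∀ x, ∃ r, rep r ∧ (x = r ∨ x = T.next r ∨ x = T.prev r))
    (hinj : ∀ r r', rep r → rep r' → φ r = φ r' → (r' = r ∨ r' = T.next r ∨ r' = T.prev r))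
    (x y : D) : φ x = φ y ↔ y = x ∨ y = T.next x ∨ y = T.prev x := by
  have hφ' : ∀ x, φ (T.prev x) = φ x := fun x => by rw [prev, hφ, hφ]
  constructor
  · intro h
    obtain ⟨r, hr, hx⟩ := hrep x
    obtain ⟨r', hr', hy⟩ := hrep y
    have hx' : φ x = φ r := by rcases hx with rfl | rfl | rfl <;> simp [hφ, hφ']
    have hy' : φ y = φ r' := by rcases hy with rfl | rfl | rfl <;> simp [hφ, hφ']
    have := hinj r r' hr hr' (by rw [← hx', ← hy', h])
    rcases hx with rfl | rfl | rfl <;> rcases hy with rfl | rfl | rfl <;>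
      rcases this with rfl | rfl | rfl <;> simp [next_next_eq_prev]
  · rintro (rfl | rfl | rfl)
    · rfl
    · rw [hφ]
    · rw [hφ']

end Tri

namespace Storage

variable {D D' : Type} {g : ℕ} {β : Fin g → D → ℕ} {β' : Fin g → D' → ℕ}

theorem forall₂_vectors {P : (D → ℕ) → (D' → ℕ) → Prop} (h : ∀ k, P (β k) (β' k))
    (h' : P (Tri.total β) (Tri.total β')) (st : Storage) :
    List.Forall₂ P (st.vectors β) (st.vectors β') := by
  cases st with
  | byComponent =>
    rw [List.forall₂_iff_get]
    exact ⟨by simp [vectors], fun i h₁ h₂ => by simpa [vectors] using h _⟩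
  | aggregate => exact .cons h' .nil

theorem le_total (st : Storage) {v : D → ℕ} (hv : v ∈ st.vectors β) (x : D) :
    v x ≤ Tri.total β x := by
  cases st with
  | byComponent =>
    obtain ⟨k, rfl⟩ := List.mem_ofFn.1 hv
    exact Tri.IsLabelling.le_total β k x
  | aggregate =>
    rw [List.mem_singleton.1 hv]

end Storage

/-- Blocks of consecutive cells for different edges are disjoint. -/
theorem block_disjoint {e e' K j i : ℕ} (h : e ≠ e') (hj : j < K) (hi : i ≤ K) :
    e * K + j < e' * K ∨ e' * K + i ≤ e * K + j := by
  rcases Nat.lt_or_gt_of_ne h with h | h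
  · have := Nat.mul_le_mul_right K (Nat.succ_le_of_lt h)
    rw [Nat.succ_mul] at this
    omega
  · have := Nat.mul_le_mul_right K (Nat.succ_le_of_lt h)
    rw [Nat.succ_mul] at this
    omega

/-- The names and coordinates in the memory, and the number of cells for coordinates, are at most
`B`. -/
structure Bounds {D : Type} (m : Arr → ℕ → ℕ) (vs : List (D → ℕ)) (B : ℕ) : Prop where
  size₀ : m .size 0 ≤ B
  size₁ : m .size 1 ≤ B
  size₂ : m .size 2 * (vs.length + 1) ≤ B
  size₃ : m .size 3 ≤ B
  one_le : 1 ≤ B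
  coord : ∀ v ∈ vs, ∀ x, v x ≤ B

namespace Encodes

variable {D : Type} {T : Tri D} {g : ℕ} {α : Fin g → List D} {vs : List (D → ℕ)}
  {m : Arr → ℕ → ℕ} {L : Layout D} {B : ℕ}

theorem length_lt (hE : Encodes T α vs m L) (hB : Bounds m vs B) (x : D) : vs.length < B := by
  have h₁ := hE.edge_lt x
  have h₂ := hB.size₂
  have := Nat.mul_le_mul_right (vs.length + 1) (show 1 ≤ m .size 2 by omega)
  omega

theorem edge_le (hE : Encodes T α vs m L) (hB : Bounds m vs B) (x : D) :
    L.edge x * vs.length + vs.length ≤ B := by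
  have h₁ := hE.edge_lt x
  have h₂ := hB.size₂
  have := Nat.mul_le_mul_right (vs.length + 1) (show L.edge x + 1 ≤ m .size 2 by omega)
  rw [Nat.mul_succ, Nat.succ_mul] at this
  omega

theorem edge_lt_bound (hE : Encodes T α vs m L) (hB : Bounds m vs B) (x : D) : L.edge x < B := by
  have h₁ := hE.edge_lt x
  have h₂ := hB.size₂
  have := Nat.mul_le_mul_left (m .size 2) (show 1 ≤ vs.length + 1 by omega)
  omega

end Encodes

/-! ### The program for a flip -/

namespace Prog

/-- The darts `d`, `n`, `p`, `t`, `tn`, `tp` of the two triangles go to the registers `1` to `6`,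
the origins of `n`, `p`, `tn`, `tp` to `7` to `10`, the two triangles to `11` and `12`, the number
of vectors to `13`, and the blocks of coordinates of `d`, `n`, `p`, `tn`, `tp` to `14` to `18`. -/
def flipLoad : List Prog :=
  [.load 2 .next 1, .load 3 .next 2, .load 4 .twin 1, .load 5 .next 4, .load 6 .next 5,
    .load 7 .vert 2, .load 8 .vert 3, .load 9 .vert 5, .load 10 .vert 6,
    .load 11 .face 1, .load 12 .face 4, .const 13 4, .load 13 .size 13,
    .load 14 .edge 1, .op .mul 14 14 13, .load 15 .edge 2, .op .mul 15 15 13,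
    .load 16 .edge 3, .op .mul 16 16 13, .load 17 .edge 5, .op .mul 17 17 13,
    .load 18 .edge 6, .op .mul 18 18 13]

/-- The changes of the pointers: `d`, `p`, `tn` and `t`, `tp`, `n` are the new triangles, and `d` and
`t` get new origins; the old origins must not point to them. -/
def flipStore : List Prog :=
  [.store .next 1 3, .store .next 3 5, .store .next 5 1,
    .store .next 4 6, .store .next 6 2, .store .next 2 4,
    .store .vert 1 10, .store .vert 4 8, .store .vertDart 7 2, .store .vertDart 9 5,
    .store .face 5 11, .store .face 2 12, .store .faceDart 11 1, .store .faceDart 12 4]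

/-- The flip of the edge of the dart in register `1`. -/
def flip : Prog :=
  .seq (block flipLoad) (.seq (block flipStore) (loop 13 (flipBody 14 15 16 17 18)))

end Prog

open Function in
/-- The memory `m'` arises from `m` by the update for the flip of the edge of `d`. -/
structure IsFlipUpdate {D : Type} (T : Tri D) (d : D) (L : Layout D) (vs : List (D → ℕ))
    (m m' : Arr → ℕ → ℕ) : Prop where
  next : m' .next = update (update (update (update (update (update (m .next)
    (L.dart d) (L.dart (T.prev d))) (L.dart (T.prev d)) (L.dart (T.next (T.twin d))))
    (L.dart (T.next (T.twin d))) (L.dart d))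
    (L.dart (T.twin d)) (L.dart (T.prev (T.twin d)))) (L.dart (T.prev (T.twin d)))
    (L.dart (T.next d))) (L.dart (T.next d)) (L.dart (T.twin d))
  vert : m' .vert = update (update (m .vert) (L.dart d) (L.vert (T.prev (T.twin d))))
    (L.dart (T.twin d)) (L.vert (T.prev d))
  vertDart : m' .vertDart = update (update (m .vertDart) (L.vert (T.next d)) (L.dart (T.next d)))
    (L.vert (T.next (T.twin d))) (L.dart (T.next (T.twin d)))
  face : m' .face = update (update (m .face) (L.dart (T.next (T.twin d))) (L.face d))
    (L.dart (T.next d)) (L.face (T.twin d))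
  faceDart : m' .faceDart = update (update (m .faceDart) (L.face d) (L.dart d))
    (L.face (T.twin d)) (L.dart (T.twin d))
  coord : ∀ j (h : j < vs.length), m' .coord (L.edge d * vs.length + j) =
    max (vs[j] (T.next d) + vs[j] (T.next (T.twin d)))
      (vs[j] (T.prev d) + vs[j] (T.prev (T.twin d))) - vs[j] d
  coord_other : ∀ a, a < L.edge d * vs.length ∨ L.edge d * vs.length + vs.length ≤ a →
    m' .coord a = m .coord a
  rest : ∀ A, A ≠ .next → A ≠ .vert → A ≠ .vertDart → A ≠ .face → A ≠ .faceDart → A ≠ .coord →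
    m' A = m A

theorem run_flip {D D' : Type} {T : Tri D} {T' : Tri D'} {e : D ≃ D'} {d : D} {g : ℕ}
    {α : Fin g → List D} {vs : List (D → ℕ)} {L : Layout D} {s : State} {W B : ℕ}
    (h : T.IsFlipAlong T' e d) (hE : Encodes T α vs s.mem L) (hs : s.reg 1 = L.dart d)
    (hB : Bounds s.mem vs B) (hW : 100 * B ≤ 2 ^ W) :
    Run W Prog.flip s (vs.length * 20 + 100) fun s' => IsFlipUpdate T d L vs s.mem s'.mem := by
  have hb₁ := hB.one_le
  have hdart : ∀ x, L.dart x < 2 ^ W := fun x => by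
    have := hE.dart_lt x; have := hB.size₀; omega
  have hvert : ∀ x, L.vert x < 2 ^ W := fun x => by
    have := hE.vert_lt x; have := hB.size₁; omega
  have hface : ∀ x, L.face x < 2 ^ W := fun x => by
    have := hE.face_lt x; have := hB.size₃; omega
  have hedge : ∀ x, L.edge x < 2 ^ W := fun x => by
    have := hE.edge_lt_bound hB x; omega
  have hblock := hE.edge_le hB
  have hblock' : ∀ x, L.edge x * vs.length < 2 ^ W := fun x => by
    have := hblock x; omega
  have hlen := hE.length_lt hB d
  refine (Run.seq (c := 24) (c' := vs.length * 20 + 19) (Run.mono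
    (Q := fun s₁ => s₁.mem = s.mem ∧ s₁.reg 1 = L.dart d ∧ s₁.reg 2 = L.dart (T.next d) ∧
      s₁.reg 3 = L.dart (T.prev d) ∧ s₁.reg 4 = L.dart (T.twin d) ∧
      s₁.reg 5 = L.dart (T.next (T.twin d)) ∧ s₁.reg 6 = L.dart (T.prev (T.twin d)) ∧
      s₁.reg 7 = L.vert (T.next d) ∧ s₁.reg 8 = L.vert (T.prev d) ∧
      s₁.reg 9 = L.vert (T.next (T.twin d)) ∧ s₁.reg 10 = L.vert (T.prev (T.twin d)) ∧
      s₁.reg 11 = L.face d ∧ s₁.reg 12 = L.face (T.twin d) ∧ s₁.reg 13 = vs.length ∧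
      s₁.reg 14 = L.edge d * vs.length ∧ s₁.reg 15 = L.edge (T.next d) * vs.length ∧
      s₁.reg 16 = L.edge (T.prev d) * vs.length ∧
      s₁.reg 17 = L.edge (T.next (T.twin d)) * vs.length ∧
      s₁.reg 18 = L.edge (T.prev (T.twin d)) * vs.length) ?_ le_rfl ?_)).mono (by omega)
    fun _ h => h
  · refine Run.load (v := L.dart (T.next d)) (by simp [hs, hE.next]) (hdart _) ?_
    refine Run.load (v := L.dart (T.prev d))
      (by simp [hE.next, Tri.next_next_eq_prev]) (hdart _) ?_
    refine Run.load (v := L.dart (T.twin d)) (by simp [hs, hE.twin]) (hdart _) ?_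
    refine Run.load (v := L.dart (T.next (T.twin d))) (by simp [hE.next]) (hdart _) ?_
    refine Run.load (v := L.dart (T.prev (T.twin d)))
      (by simp [hE.next, Tri.next_next_eq_prev]) (hdart _) ?_
    refine Run.load (v := L.vert (T.next d)) (by simp [hE.vert]) (hvert _) ?_
    refine Run.load (v := L.vert (T.prev d)) (by simp [hE.vert]) (hvert _) ?_
    refine Run.load (v := L.vert (T.next (T.twin d))) (by simp [hE.vert]) (hvert _) ?_
    refine Run.load (v := L.vert (T.prev (T.twin d))) (by simp [hE.vert]) (hvert _) ?_
    refine Run.load (v := L.face d) (by simp [hs, hE.face]) (hface _) ?_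
    refine Run.load (v := L.face (T.twin d)) (by simp [hE.face]) (hface _) ?_
    refine Run.const (by omega) ?_
    refine Run.load (v := vs.length) (by simp [hE.numVectors]) (by omega) ?_
    refine Run.load (v := L.edge d) (by simp [hs, hE.edge]) (hedge _) ?_
    refine Run.op (v := L.edge d * vs.length) (by simp [Op.eval]) (hblock' _) ?_
    refine Run.load (v := L.edge (T.next d)) (by simp [hE.edge]) (hedge _) ?_
    refine Run.op (v := L.edge (T.next d) * vs.length) (by simp [Op.eval]) (hblock' _) ?_
    refine Run.load (v := L.edge (T.prev d)) (by simp [hE.edge]) (hedge _) ?_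
    refine Run.op (v := L.edge (T.prev d) * vs.length) (by simp [Op.eval]) (hblock' _) ?_
    refine Run.load (v := L.edge (T.next (T.twin d))) (by simp [hE.edge]) (hedge _) ?_
    refine Run.op (v := L.edge (T.next (T.twin d)) * vs.length) (by simp [Op.eval])
      (hblock' _) ?_
    refine Run.load (v := L.edge (T.prev (T.twin d))) (by simp [hE.edge]) (hedge _) ?_
    refine Run.op (v := L.edge (T.prev (T.twin d)) * vs.length) (by simp [Op.eval])
      (hblock' _) ?_
    exact Run.nil (by simp [hs])
  rintro s₁ ⟨hm, r₁, r₂, r₃, r₄, r₅, r₆, r₇, r₈, r₉, r₁₀, r₁₁, r₁₂, r₁₃, r₁₄, r₁₅, r₁₆, r₁₇, r₁₈⟩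
  refine (Run.seq (c := 15) (c' := vs.length * 20 + 4) ?_).mono (by omega) fun _ h => h
  iterate 14 refine Run.store ?_
  refine Run.nil ?_
  refine (run_loop (K := vs.length) (dst := L.edge d * vs.length) (c := 17)
    (F := fun j => if h : j < vs.length then max (vs[j] (T.next d) + vs[j] (T.next (T.twin d)))
      (vs[j] (T.prev d) + vs[j] (T.prev (T.twin d))) - vs[j] d else 0)
    (by omega) (by simp [r₁₃]) (by omega) ?_).mono le_rfl ?_
  · intro j s₂ hj hF h50
    have hreg : ∀ r < 50, s₂.reg r = s₁.reg r := fun r hr => by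
      rw [hF.reg r hr]; simp
    have hcoord : ∀ a, (a < L.edge d * vs.length ∨ L.edge d * vs.length + j ≤ a) →
        s₂.mem .coord a = s.mem .coord a := fun a ha => by
      rw [hF.other a ha]; simp [State.setMem_mem, hm]
    have hne : ∀ x, x ≠ d → x ≠ T.twin d → s₂.mem .coord (L.edge x * vs.length + j) = vs[j] x := by
      intro x h₁ h₂
      rw [hcoord, hE.coord x j hj]
      refine block_disjoint ?_ hj hj.le
      rw [Ne, hE.edge_iff]
      rintro (h' | h')
      · exact h₁ h'.symm
      · exact h₂ (by rw [h', T.twin_twin])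
    have hle : ∀ x, vs[j] x ≤ B := fun x => hB.coord _ (List.getElem_mem hj) x
    have hbj : ∀ x, L.edge x * vs.length + j ≤ B := fun x => by have := hblock x; omega
    have := @run_flipBody W B s₂ 14 15 16 17 18 j (vs[j] d) (vs[j] (T.next d)) (vs[j] (T.prev d))
      (vs[j] (T.next (T.twin d))) (vs[j] (T.prev (T.twin d))) (by omega) (by omega) (by omega)
      (by omega) (by omega) (by omega) h50
    rw [hreg 14 (by omega), hreg 15 (by omega), hreg 16 (by omega), hreg 17 (by omega),
      hreg 18 (by omega), r₁₄, r₁₅, r₁₆, r₁₇, r₁₈] at this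
    have := this (hbj _) (hbj _) (hbj _) (hbj _) (hbj _)
      (by rw [hcoord _ (.inr le_rfl), hE.coord d j hj]) (hne _ (T.next_ne d) h.ne_next.symm)
      (hne _ (T.prev_ne d) h.ne_prev.symm) (hne _ h.next_twin_ne (T.next_ne _))
      (hne _ h.prev_twin_ne (T.prev_ne _)) (hle _) (hle _) (hle _) (hle _) (hle _)
    refine this.mono le_rfl ?_
    rintro s₃ ⟨h₁, h₂⟩
    exact ⟨by rw [h₁, dif_pos hj], h₂⟩
  · intro s₂ hF
    constructor
    · rw [hF.mem _ (by decide)]; simp [State.setMem_mem, *]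
    · rw [hF.mem _ (by decide)]; simp [State.setMem_mem, *]
    · rw [hF.mem _ (by decide)]; simp [State.setMem_mem, *]
    · rw [hF.mem _ (by decide)]; simp [State.setMem_mem, *]
    · rw [hF.mem _ (by decide)]; simp [State.setMem_mem, *]
    · intro j hj
      rw [hF.filled j hj, dif_pos hj]
    · intro a ha
      rw [hF.other a ha]; simp [State.setMem_mem, hm]
    · intro A h₁ h₂ h₃ h₄ h₅ h₆
      rw [hF.mem A h₆]; simp [State.setMem_mem, h₁, h₂, h₃, h₄, h₅, hm]

namespace Tri.IsFlipAlong

variable {D D' : Type} {T : Tri D} {T' : Tri D'} {e : D ≃ D'} {d : D}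

open Classical in
/-- The names after a flip: all darts, edges and triangles keep their names, where the two new
triangles inherit the names of the old ones. -/
noncomputable def layout (T : Tri D) (e : D ≃ D') (d : D) (L : Layout D) : Layout D' where
  dart b := L.dart (e.symm b)
  vert b := if e.symm b = d then L.vert (T.prev (T.twin d)) else
    if e.symm b = T.twin d then L.vert (T.prev d) else L.vert (e.symm b)
  edge b := L.edge (e.symm b)
  face b := if e.symm b = T.next (T.twin d) then L.face d else
    if e.symm b = T.next d then L.face (T.twin d) else L.face (e.symm b)

theorem encodes (h : IsFlipAlong T T' e d) {g : ℕ} {α : Fin g → List D} {α' : Fin g → List D'}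
    {vs : List (D → ℕ)} {vs' : List (D' → ℕ)} {L : Layout D} {m m' : Arr → ℕ → ℕ}
    (hE : Encodes T α vs m L) (hm : IsFlipUpdate T d L vs m m')
    (hα : ∀ i, List.Forall₂ (fun a b => b = e a ∧ a ≠ d ∧ a ≠ T.twin d) (α i) (α' i))
    (hvs : List.Forall₂ (fun v v' => Coord T e d v v') vs vs') :
    Encodes T' α' vs' m' (layout T e d L) := by
  classical
  have hlen := hvs.length_eq
  have nd₁ := T.next_ne d
  have nd₂ := T.prev_ne d
  have nd₃ := T.prev_ne_next d
  have nd₄ := T.twin_ne d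
  have nd₅ := h.ne_next
  have nd₆ := h.ne_prev
  have nd₇ := h.next_twin_ne
  have nd₈ := h.next_twin_ne_next
  have nd₉ := h.next_twin_ne_prev
  have nd₁₀ := T.next_ne (T.twin d)
  have nd₁₁ := h.prev_twin_ne
  have nd₁₂ := h.prev_twin_ne_next
  have nd₁₃ := h.prev_twin_ne_prev
  have nd₁₄ := T.prev_ne (T.twin d)
  have nd₁₅ := T.prev_ne_next (T.twin d)
  have hsize : m' .size = m .size := hm.rest _ (by decide) (by decide) (by decide) (by decide)
    (by decide) (by decide)
  obtain ⟨f', hf'⟩ := h.exists_isCornerMap_symm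
  have hf := h.isCornerMap
  -- the origins of the darts of the new diagonal
  have hd : T'.SameVertex (e d) (e (T.prev (T.twin d))) :=
    .symm _ _ (.rel _ _ (by rw [rot, h.prev_prev_twin', h.twin, T.twin_twin]))
  have ht : T'.SameVertex (e (T.twin d)) (e (T.prev d)) :=
    .symm _ _ (.rel _ _ (by rw [rot, h.prev_prev', h.twin]))
  have hrep : ∀ a, ∃ c, c ≠ d ∧ c ≠ T.twin d ∧ T'.SameVertex (e a) (e c) ∧
      (layout T e d L).vert (e a) = L.vert c := by
    intro a
    by_cases h₁ : a = d
    · exact ⟨_, nd₁₁, nd₁₄, h₁ ▸ hd, by simp [layout, h₁]⟩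
    by_cases h₂ : a = T.twin d
    · exact ⟨_, nd₂, nd₆.symm, h₂ ▸ ht, by simp [layout, h₂, nd₄]⟩
    exact ⟨a, h₁, h₂, .refl _, by simp [layout, h₁, h₂]⟩
  have hvert : ∀ c, c ≠ d → c ≠ T.twin d → (layout T e d L).vert (e c) = L.vert c :=
    fun c h₁ h₂ => by simp [layout, h₁, h₂]
  constructor
  · exact hE.dart_injective.comp e.symm.injective
  · intro x y
    obtain ⟨a, rfl⟩ := e.surjective x
    obtain ⟨b, rfl⟩ := e.surjective y
    obtain ⟨a', h₁, h₂, h₃, h₄⟩ := hrep a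
    obtain ⟨b', h₁', h₂', h₃', h₄'⟩ := hrep b
    rw [h₄, h₄', hE.vert_iff, sameVertex_iff hf hf' ⟨rfl, h₁, h₂⟩ ⟨rfl, h₁', h₂'⟩]
    exact ⟨fun h => h₃.trans' (h.trans' h₃'.symm'), fun h => h₃.symm'.trans' (h.trans' h₃')⟩
  · intro x y
    obtain ⟨a, rfl⟩ := e.surjective x
    obtain ⟨b, rfl⟩ := e.surjective y
    simp [layout, hE.edge_iff, h.twin]
  · have fd : (layout T e d L).face (e d) = L.face d := by
      simp [layout, nd₇.symm, nd₁.symm]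
    have fp : (layout T e d L).face (e (T.prev d)) = L.face d := by
      simp [layout, nd₉.symm, nd₃, hE.face_iff]
    have ftn : (layout T e d L).face (e (T.next (T.twin d))) = L.face d := by
      simp [layout]
    have ft : (layout T e d L).face (e (T.twin d)) = L.face (T.twin d) := by
      simp [layout, nd₁₀.symm, nd₅]
    have ftp : (layout T e d L).face (e (T.prev (T.twin d))) = L.face (T.twin d) := by
      simp [layout, nd₁₅, nd₁₂, hE.face_iff]
    have fn : (layout T e d L).face (e (T.next d)) = L.face (T.twin d) := by
      simp [layout, nd₈.symm]
    have fo : ∀ x, x ≠ T.next d → x ≠ T.next (T.twin d) →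
        (layout T e d L).face (e x) = L.face x := fun x h₁ h₂ => by simp [layout, h₁, h₂]
    refine face_iff_of_rep (rep := fun b => b = e d ∨ b = e (T.twin d) ∨ ∃ x, b = e x ∧
      x ≠ d ∧ x ≠ T.next d ∧ x ≠ T.prev d ∧ x ≠ T.twin d ∧ x ≠ T.next (T.twin d) ∧
      x ≠ T.prev (T.twin d)) ?_ ?_ ?_
    · intro b
      obtain ⟨z, rfl⟩ := e.surjective b
      refine cases T d (fun z => (layout T e d L).face (T'.next (e z)) =
        (layout T e d L).face (e z)) ?_ ?_ ?_ ?_ ?_ ?_ ?_ z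
      · rw [h.next_d, fp, fd]
      · rw [h.next_next, ft, fn]
      · rw [h.next_prev, ftn, fp]
      · rw [h.next_twin, ftp, ft]
      · rw [h.next_next_twin, fd, ftn]
      · rw [h.next_prev_twin, fn, ftp]
      · intro x h₁ h₂ h₃ h₄ h₅ h₆
        rw [h.next_other x h₁ h₂ h₃ h₄ h₅ h₆, fo x h₂ h₅, fo, hE.face_iff]
        · simp
        · exact fun h' => h₁ (T.next_injective h')
        · exact fun h' => h₄ (T.next_injective h')
    · intro b
      obtain ⟨z, rfl⟩ := e.surjective b
      refine cases T d (fun z => ∃ r, (r = e d ∨ r = e (T.twin d) ∨ ∃ x, r = e x ∧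
        x ≠ d ∧ x ≠ T.next d ∧ x ≠ T.prev d ∧ x ≠ T.twin d ∧ x ≠ T.next (T.twin d) ∧
        x ≠ T.prev (T.twin d)) ∧ (e z = r ∨ e z = T'.next r ∨ e z = T'.prev r))
        ?_ ?_ ?_ ?_ ?_ ?_ ?_ z
      · exact ⟨_, .inl rfl, .inl rfl⟩
      · exact ⟨_, .inr (.inl rfl), .inr (.inr h.prev_twin'.symm)⟩
      · exact ⟨_, .inl rfl, .inr (.inl h.next_d.symm)⟩
      · exact ⟨_, .inr (.inl rfl), .inl rfl⟩
      · exact ⟨_, .inl rfl, .inr (.inr h.prev_d.symm)⟩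
      · exact ⟨_, .inr (.inl rfl), .inr (.inl h.next_twin.symm)⟩
      · exact fun x h₁ h₂ h₃ h₄ h₅ h₆ =>
          ⟨_, .inr (.inr ⟨x, rfl, h₁, h₂, h₃, h₄, h₅, h₆⟩), .inl rfl⟩
    · have ho : ∀ x, x ≠ d → x ≠ T.next d → x ≠ T.prev d → x ≠ T.twin d →
          x ≠ T.next (T.twin d) → x ≠ T.prev (T.twin d) →
          L.face x ≠ L.face d ∧ L.face x ≠ L.face (T.twin d) := by
        intro x h₁ h₂ h₃ h₄ h₅ h₆
        rw [ne_comm (b := L.face d), ne_comm (b := L.face (T.twin d)), Ne, hE.face_iff, Ne,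
          hE.face_iff]
        tauto
      have hdt : L.face d ≠ L.face (T.twin d) := by
        rw [Ne, hE.face_iff]
        tauto
      rintro r r' (rfl | rfl | ⟨x, rfl, h₁, h₂, h₃, h₄, h₅, h₆⟩)
        (rfl | rfl | ⟨y, rfl, h₁', h₂', h₃', h₄', h₅', h₆'⟩) hr
      · exact .inl rfl
      · rw [fd, ft] at hr
        exact (hdt hr).elim
      · rw [fd, fo y h₂' h₅'] at hr
        exact ((ho y h₁' h₂' h₃' h₄' h₅' h₆').1 hr.symm).elim
      · rw [fd, ft] at hr
        exact (hdt hr.symm).elim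
      · exact .inl rfl
      · rw [ft, fo y h₂' h₅'] at hr
        exact ((ho y h₁' h₂' h₃' h₄' h₅' h₆').2 hr.symm).elim
      · rw [fd, fo x h₂ h₅] at hr
        exact ((ho x h₁ h₂ h₃ h₄ h₅ h₆).1 hr).elim
      · rw [ft, fo x h₂ h₅] at hr
        exact ((ho x h₁ h₂ h₃ h₄ h₅ h₆).2 hr).elim
      · rw [fo x h₂ h₅, fo y h₂' h₅', hE.face_iff] at hr
        rw [h.next_other x h₁ h₂ h₃ h₄ h₅ h₆, h.prev_other h₁ h₂ h₃ h₄ h₅ h₆]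
        simpa using hr
  · intro b
    obtain ⟨z, rfl⟩ := e.surjective b
    simp only [hm.next, layout, Equiv.symm_apply_apply, Function.update_apply,
      hE.dart_injective.eq_iff]
    refine cases T d (fun z => (if z = T.next d then L.dart (T.twin d) else
      if z = T.prev (T.twin d) then L.dart (T.next d) else
      if z = T.twin d then L.dart (T.prev (T.twin d)) else
      if z = T.next (T.twin d) then L.dart d else
      if z = T.prev d then L.dart (T.next (T.twin d)) else
      if z = d then L.dart (T.prev d) else m .next (L.dart z)) = L.dart (e.symm (T'.next (e z))))
      ?_ ?_ ?_ ?_ ?_ ?_ ?_ z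
    · simp [h.next_d, nd₁.symm, nd₁₁.symm, nd₄.symm, nd₇.symm, nd₂.symm]
    · simp [h.next_next]
    · simp [h.next_prev, nd₃, nd₁₃.symm, nd₆.symm, nd₉.symm]
    · simp [h.next_twin, nd₅, nd₁₄.symm]
    · simp [h.next_next_twin, nd₈, nd₁₅.symm, nd₁₀]
    · simp [h.next_prev_twin, nd₁₂]
    · intro x h₁ h₂ h₃ h₄ h₅ h₆
      simp [h₁, h₂, h₃, h₄, h₅, h₆, h.next_other x h₁ h₂ h₃ h₄ h₅ h₆, hE.next]
  · intro b
    obtain ⟨z, rfl⟩ := e.surjective b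
    rw [hm.rest _ (by decide) (by decide) (by decide) (by decide) (by decide) (by decide), h.twin]
    simp [layout, hE.twin]
  · intro b
    obtain ⟨z, rfl⟩ := e.surjective b
    simp only [hm.vert, layout, Equiv.symm_apply_apply, Function.update_apply,
      hE.dart_injective.eq_iff, hE.vert]
    by_cases h₁ : z = d
    · simp [h₁, nd₄.symm]
    · simp [h₁]
  · intro b
    rw [hm.rest _ (by decide) (by decide) (by decide) (by decide) (by decide) (by decide)]
    exact hE.edge _
  · intro b
    obtain ⟨z, rfl⟩ := e.surjective b
    simp only [hm.face, layout, Equiv.symm_apply_apply, Function.update_apply,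
      hE.dart_injective.eq_iff, hE.face]
    by_cases h₁ : z = T.next d
    · simp [h₁, nd₈.symm]
    · simp [h₁]
  · intro b
    obtain ⟨a, rfl⟩ := e.surjective b
    obtain ⟨c, h₁, h₂, -, h₃⟩ := hrep a
    rw [h₃, hm.vertDart]
    by_cases e₁ : L.vert c = L.vert (T.next (T.twin d))
    · exact ⟨e (T.next (T.twin d)), by rw [hvert _ nd₇ nd₁₀, e₁], by simp [e₁, layout]⟩
    by_cases e₂ : L.vert c = L.vert (T.next d)
    · refine ⟨e (T.next d), by rw [hvert _ nd₁ nd₅.symm, e₂], ?_⟩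
      rw [Function.update_apply, if_neg e₁, e₂]
      simp [layout]
    rw [Function.update_apply, if_neg e₁, Function.update_apply, if_neg e₂]
    obtain ⟨y, hy, hy'⟩ := hE.vertDart c
    refine ⟨e y, ?_, by simp [hy', layout]⟩
    rw [hvert, hy]
    · rintro rfl
      refine e₁ (hy.symm.trans ((hE.vert_iff _ _).2 ?_))
      exact .symm _ _ (.rel _ _ (by rw [rot, T.prev_next, T.twin_twin]))
    · rintro rfl
      refine e₂ (hy.symm.trans ((hE.vert_iff _ _).2 ?_))
      exact .symm _ _ (.rel _ _ (by rw [rot, T.prev_next]))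
  · intro b
    obtain ⟨z, rfl⟩ := e.surjective b
    rw [hm.rest _ (by decide) (by decide) (by decide) (by decide) (by decide) (by decide)]
    obtain ⟨y, hy, hy'⟩ := hE.edgeDart z
    exact ⟨e y, by simpa [layout] using hy, by simpa [layout] using hy'⟩
  · have fd : (layout T e d L).face (e d) = L.face d := by
      simp [layout, nd₇.symm, nd₁.symm]
    have ft : (layout T e d L).face (e (T.twin d)) = L.face (T.twin d) := by
      simp [layout, nd₁₀.symm, nd₅]
    intro b
    rw [hm.faceDart]
    by_cases e₁ : (layout T e d L).face b = L.face (T.twin d)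
    · exact ⟨e (T.twin d), by rw [ft, e₁], by rw [e₁]; simp [layout]⟩
    by_cases e₂ : (layout T e d L).face b = L.face d
    · refine ⟨e d, by rw [fd, e₂], ?_⟩
      rw [Function.update_apply, if_neg e₁, e₂]
      simp [layout]
    rw [Function.update_apply, if_neg e₁, Function.update_apply, if_neg e₂]
    obtain ⟨z, rfl⟩ := e.surjective b
    have hz : (layout T e d L).face (e z) = L.face z := by
      by_cases h₁ : z = T.next (T.twin d)
      · simp [layout, h₁] at e₂
      by_cases h₂ : z = T.next d
      · simp [layout, h₂, nd₈.symm] at e₁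
      simp [layout, h₁, h₂]
    rw [hz] at e₁ e₂ ⊢
    obtain ⟨y, hy, hy'⟩ := hE.faceDart z
    refine ⟨e y, ?_, by simp [hy', layout]⟩
    have h₁ : y ≠ T.next (T.twin d) := by
      rintro rfl
      exact e₁ (hy.symm.trans ((hE.face_iff _ _).2 (by simp)))
    have h₂ : y ≠ T.next d := by
      rintro rfl
      exact e₂ (hy.symm.trans ((hE.face_iff _ _).2 (by simp)))
    simp [layout, h₁, h₂, hy]
  · intro b j hj
    obtain ⟨z, rfl⟩ := e.surjective b
    have hj' : j < vs.length := hlen ▸ hj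
    have hc : Coord T e d vs[j] vs'[j] := (List.forall₂_iff_get.1 hvs).2 j hj' hj
    rw [← hlen]
    simp only [layout, Equiv.symm_apply_apply]
    have hdiag := hc.diag
    by_cases h₁ : z = d
    · rw [h₁, hm.coord j hj']
      omega
    by_cases h₂ : z = T.twin d
    · rw [h₂, (hE.edge_iff (T.twin d) d).2 (by simp), hm.coord j hj', hc.diag_twin]
      omega
    rw [hm.coord_other, hE.coord z j hj', hc.other z h₁ h₂]
    refine block_disjoint ?_ hj' le_rfl
    rw [Ne, hE.edge_iff]
    rintro (h' | h')
    · exact h₁ h'.symm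
    · exact h₂ (by rw [h', T.twin_twin])
  · intro i
    rw [hm.rest _ (by decide) (by decide) (by decide) (by decide) (by decide) (by decide),
      hE.curveLength, (hα i).length_eq]
  · intro i j hj
    have hj' : j < (α i).length := (hα i).length_eq ▸ hj
    rw [hm.rest .curveEdge (by decide) (by decide) (by decide) (by decide) (by decide) (by decide),
      hm.rest .curveStart (by decide) (by decide) (by decide) (by decide) (by decide) (by decide),
      hE.curveEdge i j hj']
    have : (α' i)[j] = e (α i)[j] := ((List.forall₂_iff_get.1 (hα i)).2 j hj' hj).1
    rw [this]
    simp [layout]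
  · intro b
    rw [hsize]
    exact hE.dart_lt _
  · intro b
    obtain ⟨a, rfl⟩ := e.surjective b
    obtain ⟨c, -, -, -, h₃⟩ := hrep a
    rw [hsize, h₃]
    exact hE.vert_lt _
  · intro b
    rw [hsize]
    exact hE.edge_lt _
  · intro b
    rw [hsize]
    simp only [layout]
    split_ifs
    · exact hE.face_lt _
    · exact hE.face_lt _
    · exact hE.face_lt _
  · rw [hsize, hE.numVectors, hlen]
  · rw [hsize, hE.genus]

end Tri.IsFlipAlong

/-! ### The program for a subdivision -/

namespace Prog

/-- The darts `x`, `next x`, `prev x` of the triangle go to the registers `1` to `3`, their origins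
to `4` to `6`, and the triangle to `7`; the new spokes and their twins get the names in the
registers `8`, `14`, `15` and `16`, `17`, `18`, the new vertex that in `9`, the new edges those in
`10`, `20`, `21`, and the new triangles those in `11`, `24`; the blocks of coordinates of the old
and new edges start at the numbers in `26` to `28` and `29` to `31`. -/
def splitLoad : List Prog :=
  [.load 2 .next 1, .load 3 .next 2, .load 4 .vert 1, .load 5 .vert 2, .load 6 .vert 3,
    .load 7 .face 1, .const 32 0, .load 8 .size 32, .const 33 1, .load 9 .size 33,
    .const 34 2, .load 10 .size 34, .const 35 3, .load 11 .size 35, .const 36 4,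
    .load 12 .size 36,
    .op .add 14 8 33, .op .add 15 14 33, .op .add 16 15 33, .op .add 17 16 33,
    .op .add 18 17 33, .op .add 19 18 33, .op .add 20 10 33, .op .add 21 20 33,
    .op .add 22 21 33, .op .add 23 9 33, .op .add 24 11 33, .op .add 25 24 33,
    .load 26 .edge 1, .op .mul 26 26 12, .load 27 .edge 2, .op .mul 27 27 12,
    .load 28 .edge 3, .op .mul 28 28 12, .op .mul 29 10 12, .op .mul 30 20 12,
    .op .mul 31 21 12]

/-- The changes of the pointers; the new triangles consist of an old side, the twin of a spoke and a
spoke. -/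
def splitStore : List Prog :=
  [.store .next 8 1, .store .next 1 17, .store .next 17 8,
    .store .next 14 2, .store .next 2 18, .store .next 18 14,
    .store .next 15 3, .store .next 3 16, .store .next 16 15,
    .store .twin 8 16, .store .twin 14 17, .store .twin 15 18,
    .store .twin 16 8, .store .twin 17 14, .store .twin 18 15,
    .store .vert 8 9, .store .vert 14 9, .store .vert 15 9,
    .store .vert 16 4, .store .vert 17 5, .store .vert 18 6,
    .store .edge 8 10, .store .edge 14 20, .store .edge 15 21,
    .store .edge 16 10, .store .edge 17 20, .store .edge 18 21,
    .store .face 8 7, .store .face 17 7, .store .face 14 11, .store .face 2 11,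
    .store .face 18 11, .store .face 15 24, .store .face 3 24, .store .face 16 24,
    .store .vertDart 9 8, .store .edgeDart 10 8, .store .edgeDart 20 14,
    .store .edgeDart 21 15, .store .faceDart 7 1, .store .faceDart 11 2,
    .store .faceDart 24 3, .store .size 32 19, .store .size 33 23, .store .size 34 22,
    .store .size 35 25]

/-- The subdivision of the triangle of the dart in register `1`. -/
def split : Prog :=
  .seq (block splitLoad) (.seq (block splitStore) (.seq (loop 12 (cornerBody 26 27 28 29))
    (.seq (loop 12 (cornerBody 27 28 26 30)) (loop 12 (cornerBody 28 26 27 31)))))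

end Prog

/-- The names of the three triangles after a subdivision: the first one inherits the name of the
subdivided triangle. -/
def splitFace {D : Type} (x : D) (L : Layout D) (m : Arr → ℕ → ℕ) (k : Fin 3) : ℕ :=
  ![L.face x, m .size 3, m .size 3 + 1] k

/-- The memory `m'` arises from `m` by the update for the subdivision of the triangle of `x`. -/
structure IsSplitUpdate {D : Type} (T : Tri D) (x : D) (L : Layout D) (vs : List (D → ℕ))
    (m m' : Arr → ℕ → ℕ) : Prop where
  next_side : ∀ k : Fin 3, m' .next (L.dart (T.next^[k] x)) = m .size 0 + 3 + ((k + 1 : Fin 3) : ℕ)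
  next_spoke : ∀ k : Fin 3, m' .next (m .size 0 + k) = L.dart (T.next^[k] x)
  next_twin : ∀ k : Fin 3, m' .next (m .size 0 + 3 + k) = m .size 0 + ((k + 2 : Fin 3) : ℕ)
  next_other : ∀ y, y ≠ x → y ≠ T.next x → y ≠ T.prev x →
    m' .next (L.dart y) = m .next (L.dart y)
  twin_spoke : ∀ k : Fin 3, m' .twin (m .size 0 + k) = m .size 0 + 3 + k
  twin_twin : ∀ k : Fin 3, m' .twin (m .size 0 + 3 + k) = m .size 0 + k
  twin_side : ∀ y, m' .twin (L.dart y) = m .twin (L.dart y)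
  vert_spoke : ∀ k : Fin 3, m' .vert (m .size 0 + k) = m .size 1
  vert_twin : ∀ k : Fin 3, m' .vert (m .size 0 + 3 + k) = L.vert (T.next^[k] x)
  vert_side : ∀ y, m' .vert (L.dart y) = m .vert (L.dart y)
  edge_spoke : ∀ k : Fin 3, m' .edge (m .size 0 + k) = m .size 2 + k
  edge_twin : ∀ k : Fin 3, m' .edge (m .size 0 + 3 + k) = m .size 2 + k
  edge_side : ∀ y, m' .edge (L.dart y) = m .edge (L.dart y)
  face_side : ∀ k : Fin 3, m' .face (L.dart (T.next^[k] x)) = splitFace x L m k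
  face_spoke : ∀ k : Fin 3, m' .face (m .size 0 + k) = splitFace x L m k
  face_twin : ∀ k : Fin 3, m' .face (m .size 0 + 3 + k) = splitFace x L m (k + 2)
  face_other : ∀ y, y ≠ x → y ≠ T.next x → y ≠ T.prev x →
    m' .face (L.dart y) = m .face (L.dart y)
  vertDart_new : m' .vertDart (m .size 1) = m .size 0
  vertDart_other : ∀ a < m .size 1, m' .vertDart a = m .vertDart a
  edgeDart_new : ∀ k : Fin 3, m' .edgeDart (m .size 2 + k) = m .size 0 + k
  edgeDart_other : ∀ a < m .size 2, m' .edgeDart a = m .edgeDart a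
  faceDart_new : ∀ k : Fin 3, m' .faceDart (splitFace x L m k) = L.dart (T.next^[k] x)
  faceDart_other : ∀ a < m .size 3, a ≠ L.face x → m' .faceDart a = m .faceDart a
  size₀ : m' .size 0 = m .size 0 + 6
  size₁ : m' .size 1 = m .size 1 + 1
  size₂ : m' .size 2 = m .size 2 + 3
  size₃ : m' .size 3 = m .size 3 + 2
  size₄ : m' .size 4 = m .size 4
  size₅ : m' .size 5 = m .size 5
  coord_new : ∀ (k : Fin 3) (j : ℕ) (h : j < vs.length),
    m' .coord ((m .size 2 + k) * vs.length + j) = T.corner vs[j] (T.next^[k] x)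
  coord_other : ∀ a < m .size 2 * vs.length, m' .coord a = m .coord a
  curveStart : m' .curveStart = m .curveStart
  curveLength : m' .curveLength = m .curveLength
  curveEdge : m' .curveEdge = m .curveEdge

theorem run_split {D : Type} {T : Tri D} {x : D} {g : ℕ} {α : Fin g → List D}
    {vs : List (D → ℕ)} {L : Layout D} {s : State} {W B : ℕ}
    (hE : Encodes T α vs s.mem L) (hs : s.reg 1 = L.dart x)
    (hB : Bounds s.mem vs B) (hW : 100 * B ≤ 2 ^ W) :
    Run W Prog.split s (vs.length * 48 + 100) fun s' => IsSplitUpdate T x L vs s.mem s'.mem := by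
  have hb₁ := hB.one_le
  have hb₂ := hB.size₀
  have hb₃ := hB.size₁
  have hb₄ := hB.size₃
  have hdart : ∀ x, L.dart x < 2 ^ W := fun x => by
    have := hE.dart_lt x; omega
  have hvert : ∀ x, L.vert x < 2 ^ W := fun x => by
    have := hE.vert_lt x; omega
  have hface : ∀ x, L.face x < 2 ^ W := fun x => by
    have := hE.face_lt x; omega
  have hedge : ∀ x, L.edge x < 2 ^ W := fun x => by
    have := hE.edge_lt_bound hB x; omega
  have hblock := hE.edge_le hB
  have hblock' : ∀ x, L.edge x * vs.length < 2 ^ W := fun x => by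
    have := hblock x; omega
  have hlen := hE.length_lt hB x
  have hS₂ : s.mem .size 2 * vs.length ≤ B ∧ s.mem .size 2 ≤ B := by
    have := hB.size₂
    rw [Nat.mul_succ] at this
    omega
  have hm₁ : (s.mem .size 2 + 1) * vs.length = s.mem .size 2 * vs.length + vs.length :=
    Nat.succ_mul _ _
  have hm₂ : (s.mem .size 2 + 2) * vs.length = s.mem .size 2 * vs.length + vs.length + vs.length := by
    rw [Nat.add_mul, Nat.two_mul, Nat.add_assoc]
  refine (Run.seq (c := 38) (c' := vs.length * 48 + 60) (Run.mono
    (Q := fun s₁ => s₁.mem = s.mem ∧ s₁.reg 1 = L.dart x ∧ s₁.reg 2 = L.dart (T.next x) ∧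
      s₁.reg 3 = L.dart (T.prev x) ∧ s₁.reg 4 = L.vert x ∧
      s₁.reg 5 = L.vert (T.next x) ∧ s₁.reg 6 = L.vert (T.prev x) ∧
      s₁.reg 7 = L.face x ∧ s₁.reg 8 = s.mem .size 0 ∧
      s₁.reg 9 = s.mem .size 1 ∧ s₁.reg 10 = s.mem .size 2 ∧
      s₁.reg 11 = s.mem .size 3 ∧ s₁.reg 12 = vs.length ∧ s₁.reg 14 = s.mem .size 0 + 1 ∧
      s₁.reg 15 = s.mem .size 0 + 2 ∧ s₁.reg 16 = s.mem .size 0 + 3 ∧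
      s₁.reg 17 = s.mem .size 0 + 4 ∧ s₁.reg 18 = s.mem .size 0 + 5 ∧
      s₁.reg 19 = s.mem .size 0 + 6 ∧ s₁.reg 20 = s.mem .size 2 + 1 ∧
      s₁.reg 21 = s.mem .size 2 + 2 ∧ s₁.reg 22 = s.mem .size 2 + 3 ∧
      s₁.reg 23 = s.mem .size 1 + 1 ∧ s₁.reg 24 = s.mem .size 3 + 1 ∧
      s₁.reg 25 = s.mem .size 3 + 2 ∧ s₁.reg 26 = L.edge x * vs.length ∧
      s₁.reg 27 = L.edge (T.next x) * vs.length ∧ s₁.reg 28 = L.edge (T.prev x) * vs.length ∧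
      s₁.reg 29 = s.mem .size 2 * vs.length ∧ s₁.reg 30 = (s.mem .size 2 + 1) * vs.length ∧
      s₁.reg 31 = (s.mem .size 2 + 2) * vs.length ∧ s₁.reg 32 = 0 ∧ s₁.reg 33 = 1 ∧
      s₁.reg 34 = 2 ∧ s₁.reg 35 = 3) ?_ le_rfl ?_)).mono (by omega)
    fun _ h => h
  · refine Run.load (v := L.dart (T.next x)) (by simp [hs, hE.next]) (hdart _) ?_
    refine Run.load (v := L.dart (T.prev x))
      (by simp [hE.next, Tri.next_next_eq_prev]) (hdart _) ?_
    refine Run.load (v := L.vert x) (by simp [hs, hE.vert]) (hvert _) ?_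
    refine Run.load (v := L.vert (T.next x)) (by simp [hE.vert]) (hvert _) ?_
    refine Run.load (v := L.vert (T.prev x)) (by simp [hE.vert]) (hvert _) ?_
    refine Run.load (v := L.face x) (by simp [hs, hE.face]) (hface _) ?_
    refine Run.const (by omega) ?_
    refine Run.load (v := s.mem .size 0) (by simp) (by omega) ?_
    refine Run.const (by omega) ?_
    refine Run.load (v := s.mem .size 1) (by simp) (by omega) ?_
    refine Run.const (by omega) ?_
    refine Run.load (v := s.mem .size 2) (by simp) (by omega) ?_
    refine Run.const (by omega) ?_
    refine Run.load (v := s.mem .size 3) (by simp) (by omega) ?_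
    refine Run.const (by omega) ?_
    refine Run.load (v := vs.length) (by simp [hE.numVectors]) (by omega) ?_
    refine Run.op (v := s.mem .size 0 + 1) (by simp [Op.eval]) (by omega) ?_
    refine Run.op (v := s.mem .size 0 + 2) (by simp [Op.eval]) (by omega) ?_
    refine Run.op (v := s.mem .size 0 + 3) (by simp [Op.eval]) (by omega) ?_
    refine Run.op (v := s.mem .size 0 + 4) (by simp [Op.eval]) (by omega) ?_
    refine Run.op (v := s.mem .size 0 + 5) (by simp [Op.eval]) (by omega) ?_
    refine Run.op (v := s.mem .size 0 + 6) (by simp [Op.eval]) (by omega) ?_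
    refine Run.op (v := s.mem .size 2 + 1) (by simp [Op.eval]) (by omega) ?_
    refine Run.op (v := s.mem .size 2 + 2) (by simp [Op.eval]) (by omega) ?_
    refine Run.op (v := s.mem .size 2 + 3) (by simp [Op.eval]) (by omega) ?_
    refine Run.op (v := s.mem .size 1 + 1) (by simp [Op.eval]) (by omega) ?_
    refine Run.op (v := s.mem .size 3 + 1) (by simp [Op.eval]) (by omega) ?_
    refine Run.op (v := s.mem .size 3 + 2) (by simp [Op.eval]) (by omega) ?_
    refine Run.load (v := L.edge x) (by simp [hs, hE.edge]) (hedge _) ?_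
    refine Run.op (v := L.edge x * vs.length) (by simp [Op.eval]) (hblock' _) ?_
    refine Run.load (v := L.edge (T.next x)) (by simp [hE.edge]) (hedge _) ?_
    refine Run.op (v := L.edge (T.next x) * vs.length) (by simp [Op.eval]) (hblock' _) ?_
    refine Run.load (v := L.edge (T.prev x)) (by simp [hE.edge]) (hedge _) ?_
    refine Run.op (v := L.edge (T.prev x) * vs.length) (by simp [Op.eval]) (hblock' _) ?_
    refine Run.op (v := s.mem .size 2 * vs.length) (by simp [Op.eval]) (by omega) ?_
    refine Run.op (v := (s.mem .size 2 + 1) * vs.length) (by simp [Op.eval]) (by omega) ?_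
    refine Run.op (v := (s.mem .size 2 + 2) * vs.length) (by simp [Op.eval]) (by omega) ?_
    exact Run.nil (by simp [hs])
  rintro s₁ ⟨hm, r₁, r₂, r₃, r₄, r₅, r₆, r₇, r₈, r₉, r₁₀, r₁₁, r₁₂, r₁₄, r₁₅, r₁₆, r₁₇, r₁₈, r₁₉,
    r₂₀, r₂₁, r₂₂, r₂₃, r₂₄, r₂₅, r₂₆, r₂₇, r₂₈, r₂₉, r₃₀, r₃₁, r₃₂, r₃₃, r₃₄, r₃₅⟩
  refine (Run.seq (c := 47) (c' := vs.length * 48 + 12) ?_).mono (by omega) fun _ h => h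
  iterate 46 refine Run.store ?_
  refine Run.nil ?_
  -- the corner coordinates are computed from blocks below the new ones
  have body : ∀ {s₂ : State} {j a b c dst : ℕ} {y : D}, j < vs.length → s₂.reg 50 = j →
      a < 50 → b < 50 → c < 50 → dst < 50 → s₂.reg a = L.edge y * vs.length →
      s₂.reg b = L.edge (T.next y) * vs.length → s₂.reg c = L.edge (T.prev y) * vs.length →
      s₂.reg dst ≤ (s.mem .size 2 + 2) * vs.length →
      (∀ i < s.mem .size 2 * vs.length, s₂.mem .coord i = s.mem .coord i) →
      Run W (Prog.block (Prog.cornerBody a b c dst)) s₂ 13 fun s₃ =>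
        s₃.mem = (s₂.setMem .coord (s₂.reg dst + j)
          ((fun j => if h : j < vs.length then T.corner vs[j] y else 0) j)).mem ∧
          ∀ r < 52, s₃.reg r = s₂.reg r := by
    intro s₂ j a b c dst y hj h50 ha hb hc hd ra rb rc rd hco
    have hval : ∀ z, s₂.mem .coord (L.edge z * vs.length + j) = vs[j] z := fun z => by
      have h₁ := hE.edge_lt z
      have h₂ := Nat.mul_le_mul_right vs.length (Nat.succ_le_of_lt h₁)
      rw [Nat.succ_mul] at h₂
      rw [hco _ (by omega), hE.coord z j hj]
    -- the new blocks lie above the old cells, but below `4 * B`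
    have hle : ∀ z, vs[j] z ≤ 4 * B := fun z =>
      (hB.coord _ (List.getElem_mem hj) z).trans (by omega)
    have hbj : ∀ z, L.edge z * vs.length + j ≤ 4 * B := fun z => by have := hblock z; omega
    refine (run_cornerBody (B := 4 * B) (va := vs[j] y) (vb := vs[j] (T.next y))
      (vc := vs[j] (T.prev y)) (by omega) ha hb hc hd h50 (by rw [ra]; exact hbj _)
      (by rw [rb]; exact hbj _) (by rw [rc]; exact hbj _) (by omega) (by omega)
      (by rw [ra]; exact hval _) (by rw [rb]; exact hval _) (by rw [rc]; exact hval _)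
      (hle _) (hle _) (hle _)).mono le_rfl ?_
    rintro s₃ ⟨h₁, h₂⟩
    refine ⟨?_, h₂⟩
    dsimp only
    rw [h₁, dif_pos hj]
    rfl
  refine (Run.seq (c := vs.length * 16 + 4) (c' := vs.length * 32 + 8)
    (Run.mono (run_loop (K := vs.length) (dst := s.mem .size 2 * vs.length) (c := 13)
    (F := fun j => if h : j < vs.length then T.corner vs[j] x else 0)
    (by omega) (by simp [r₁₂]) (by omega) ?_) le_rfl ?_)).mono (by omega) fun _ h => h
  · intro j s₂ hj hF h50
    have hreg : ∀ r < 50, s₂.reg r = s₁.reg r := fun r hr => by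
      rw [hF.reg r hr]; simp
    have := body (s₂ := s₂) (y := x) (a := 26) (b := 27) (c := 28) (dst := 29) hj h50 (by omega)
      (by omega) (by omega) (by omega) (by rw [hreg 26 (by omega), r₂₆])
      (by rw [hreg 27 (by omega), r₂₇]) (by rw [hreg 28 (by omega), r₂₈])
      (by rw [hreg 29 (by omega), r₂₉]; omega)
      (fun i hi => by rw [hF.other i (by omega)]; simp [State.setMem_mem, hm])
    rwa [hreg 29 (by omega), r₂₉] at this
  intro s₂ hF
  have hreg₂ : ∀ r < 50, s₂.reg r = s₁.reg r := fun r hr => by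
    rw [hF.reg r hr]; simp
  have hco₂ : ∀ i < s.mem .size 2 * vs.length, s₂.mem .coord i = s.mem .coord i := fun i hi => by
    rw [hF.other i (by omega)]; simp [State.setMem_mem, hm]
  refine (Run.seq (c := vs.length * 16 + 4) (c' := vs.length * 16 + 4)
    (Run.mono (run_loop (K := vs.length) (dst := (s.mem .size 2 + 1) * vs.length) (c := 13)
    (F := fun j => if h : j < vs.length then T.corner vs[j] (T.next x) else 0)
    (by omega) (by rw [hreg₂ 12 (by omega), r₁₂]) (by omega) ?_) le_rfl ?_)).mono (by omega)
    fun _ h => h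
  · intro j s₃ hj hF' h50
    have hreg : ∀ r < 50, s₃.reg r = s₁.reg r := fun r hr => by
      rw [hF'.reg r hr, hreg₂ r hr]
    have := body (s₂ := s₃) (y := T.next x) (a := 27) (b := 28) (c := 26) (dst := 30) hj h50
      (by omega) (by omega) (by omega) (by omega) (by rw [hreg 27 (by omega), r₂₇])
      (by rw [hreg 28 (by omega), r₂₈, Tri.next_next_eq_prev])
      (by rw [hreg 26 (by omega), r₂₆, Tri.prev_next])
      (by rw [hreg 30 (by omega), r₃₀]; omega)
      (fun i hi => by rw [hF'.other i (by omega), hco₂ i hi])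
    rwa [hreg 30 (by omega), r₃₀] at this
  intro s₃ hF'
  have hreg₃ : ∀ r < 50, s₃.reg r = s₁.reg r := fun r hr => by
    rw [hF'.reg r hr, hreg₂ r hr]
  have hco₃ : ∀ i < s.mem .size 2 * vs.length, s₃.mem .coord i = s.mem .coord i := fun i hi => by
    rw [hF'.other i (by omega), hco₂ i hi]
  refine Run.mono (run_loop (K := vs.length) (dst := (s.mem .size 2 + 2) * vs.length) (c := 13)
    (F := fun j => if h : j < vs.length then T.corner vs[j] (T.prev x) else 0)
    (by omega) (by rw [hreg₃ 12 (by omega), r₁₂]) (by omega) ?_) le_rfl ?_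
  · intro j s₄ hj hF'' h50
    have hreg : ∀ r < 50, s₄.reg r = s₁.reg r := fun r hr => by
      rw [hF''.reg r hr, hreg₃ r hr]
    have := body (s₂ := s₄) (y := T.prev x) (a := 28) (b := 26) (c := 27) (dst := 31) hj h50
      (by omega) (by omega) (by omega) (by omega) (by rw [hreg 28 (by omega), r₂₈])
      (by rw [hreg 26 (by omega), r₂₆, T.next_prev])
      (by rw [hreg 27 (by omega), r₂₇, Tri.prev_prev])
      (by rw [hreg 31 (by omega), r₃₁])
      (fun i hi => by rw [hF''.other i (by omega), hco₃ i hi])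
    rwa [hreg 31 (by omega), r₃₁] at this
  intro s₄ hF''
  have hmem : ∀ A, A ≠ Arr.coord → s₄.mem A = s₂.mem A := fun A hA => by
    rw [hF''.mem A hA, hF'.mem A hA]
  have hco₄ : ∀ i < s.mem .size 2 * vs.length, s₄.mem .coord i = s.mem .coord i := fun i hi => by
    rw [hF''.other i (by omega), hco₃ i hi]
  -- old and new names are distinct
  have d₀ : ∀ y, L.dart y ≠ s.mem .size 0 := fun y => (hE.dart_lt y).ne
  have d₁ : ∀ y n, L.dart y ≠ s.mem .size 0 + n := fun y n => by have := hE.dart_lt y; omega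
  have d₂ : ∀ y, s.mem .size 0 ≠ L.dart y := fun y => (d₀ y).symm
  have d₃ : ∀ y n, s.mem .size 0 + n ≠ L.dart y := fun y n => (d₁ y n).symm
  have e₁ : L.dart x ≠ L.dart (T.next x) := fun h => T.next_ne x (hE.dart_injective h).symm
  have e₂ : L.dart x ≠ L.dart (T.prev x) := fun h => T.prev_ne x (hE.dart_injective h).symm
  have e₃ : L.dart (T.next x) ≠ L.dart (T.prev x) := fun h =>
    T.prev_ne_next x (hE.dart_injective h).symm
  have f₁ : L.face x ≠ s.mem .size 3 := (hE.face_lt x).ne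
  have f₂ : L.face x ≠ s.mem .size 3 + 1 := by have := hE.face_lt x; omega
  have hnext := hmem .next (by decide)
  have htwin := hmem .twin (by decide)
  have hvert' := hmem .vert (by decide)
  have hedge' := hmem .edge (by decide)
  have hface' := hmem .face (by decide)
  have hvd := hmem .vertDart (by decide)
  have hed := hmem .edgeDart (by decide)
  have hfd := hmem .faceDart (by decide)
  have hsz := hmem .size (by decide)
  rw [hF.mem _ (by decide)] at hnext htwin hvert' hedge' hface' hvd hed hfd hsz
  simp only [State.setMem_mem, State.setMem_reg, hm, reduceCtorEq, if_true, if_false, r₁, r₂, r₃,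
    r₄, r₅, r₆, r₇, r₈, r₉, r₁₀, r₁₁, r₁₄, r₁₅, r₁₆, r₁₇, r₁₈, r₁₉, r₂₀, r₂₁, r₂₂, r₂₃, r₂₄, r₂₅,
    r₃₂, r₃₃, r₃₄, r₃₅] at hnext htwin hvert' hedge' hface' hvd hed hfd hsz
  have fin : ∀ {P : Fin 3 → Prop}, P 0 → P 1 → P 2 → ∀ k, P k := fun h₀ h₁ h₂ k => by
    fin_cases k
    · exact h₀
    · exact h₁
    · exact h₂
  constructor
  · rw [hnext]
    refine fin ?_ ?_ ?_
    · simp [d₁, e₁, e₂]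
    · simp [d₁, e₃]
    · simp [Tri.next_next_eq_prev, d₁]
  · rw [hnext]
    refine fin ?_ ?_ ?_
    · simp [d₂]
    · simp [d₃]
    · simp [Tri.next_next_eq_prev, d₃]
  · rw [hnext]
    refine fin ?_ ?_ ?_
    · simp
    · simp [d₃, Nat.add_assoc]
    · simp [d₃, Nat.add_assoc]
  · intro y h₁ h₂ h₃
    rw [hnext]
    simp [d₀, d₁, hE.dart_injective.eq_iff, h₁, h₂, h₃]
  · rw [htwin]
    refine fin ?_ ?_ ?_
    · simp
    · simp [Nat.add_assoc]
    · simp [Nat.add_assoc]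
  · rw [htwin]
    refine fin ?_ ?_ ?_
    · simp
    · simp [Nat.add_assoc]
    · simp [Nat.add_assoc]
  · intro y
    rw [htwin]
    simp [d₀, d₁]
  · rw [hvert']
    refine fin ?_ ?_ ?_
    · simp
    · simp
    · simp
  · rw [hvert']
    refine fin ?_ ?_ ?_
    · simp
    · simp [Nat.add_assoc]
    · simp [Tri.next_next_eq_prev, Nat.add_assoc]
  · intro y
    rw [hvert']
    simp [d₀, d₁]
  · rw [hedge']
    refine fin ?_ ?_ ?_
    · simp
    · simp
    · simp
  · rw [hedge']
    refine fin ?_ ?_ ?_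
    · simp
    · simp [Nat.add_assoc]
    · simp [Nat.add_assoc]
  · intro y
    rw [hedge']
    simp [d₀, d₁]
  · rw [hface']
    refine fin ?_ ?_ ?_
    · simp [d₀, d₁, e₁, e₂, splitFace, hE.face]
    · simp [d₁, e₃, splitFace]
    · simp [Tri.next_next_eq_prev, d₁, splitFace]
  · rw [hface']
    refine fin ?_ ?_ ?_
    · simp [d₂, splitFace]
    · simp [d₃, splitFace]
    · simp [d₃, splitFace]
  · rw [hface']
    refine fin ?_ ?_ ?_
    · simp [splitFace]
    · simp [d₃, splitFace, Nat.add_assoc]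
    · simp [d₃, splitFace, Nat.add_assoc]
  · intro y h₁ h₂ h₃
    rw [hface']
    simp [d₀, d₁, hE.dart_injective.eq_iff, h₂, h₃]
  · rw [hvd]
    simp
  · intro a ha
    rw [hvd, Function.update_of_ne ha.ne]
  · rw [hed]
    refine fin ?_ ?_ ?_
    · simp
    · simp
    · simp
  · intro a ha
    rw [hed, Function.update_of_ne (by omega), Function.update_of_ne (by omega),
      Function.update_of_ne ha.ne]
  · rw [hfd]
    refine fin ?_ ?_ ?_
    · simp [splitFace, f₁, f₂]
    · simp [splitFace]
    · simp [splitFace, Tri.next_next_eq_prev]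
  · intro a ha ha'
    rw [hfd, Function.update_of_ne (by omega), Function.update_of_ne (by omega),
      Function.update_of_ne ha']
  · rw [hsz]; simp
  · rw [hsz]; simp
  · rw [hsz]; simp
  · rw [hsz]; simp
  · rw [hsz]; simp
  · rw [hsz]; simp
  · refine fin ?_ ?_ ?_
    · intro j hj
      change s₄.mem .coord (s.mem .size 2 * vs.length + j) = _
      rw [hF''.other _ (by omega), hF'.other _ (by omega), hF.filled j hj, dif_pos hj]
      rfl
    · intro j hj
      change s₄.mem .coord ((s.mem .size 2 + 1) * vs.length + j) = _
      rw [hF''.other _ (by omega), hF'.filled j hj, dif_pos hj]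
      rfl
    · intro j hj
      change s₄.mem .coord ((s.mem .size 2 + 2) * vs.length + j) = _
      rw [hF''.filled j hj, dif_pos hj]
      rfl
  · exact hco₄
  · rw [hmem _ (by decide), hF.mem _ (by decide)]; simp [State.setMem_mem, hm]
  · rw [hmem _ (by decide), hF.mem _ (by decide)]; simp [State.setMem_mem, hm]
  · rw [hmem _ (by decide), hF.mem _ (by decide)]; simp [State.setMem_mem, hm]

namespace IsSubdivision

open Tri

variable {D D' : Type} {T : Tri D} {T' : Tri D'} {x : D} {ι : D → D'} {s : Fin 3 → D'}

open Classical in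
/-- The names after a subdivision: the old darts keep their names, the new ones get the names that
were free before. -/
noncomputable def layout (h : IsSubdivision T T' x ι s) (L : Layout D) (m : Arr → ℕ → ℕ) :
    Layout D' where
  dart := h.elim L.dart (fun k => m .size 0 + k) (fun k => m .size 0 + 3 + k)
  vert := h.elim L.vert (fun _ => m .size 1) (fun k => L.vert (T.next^[k] x))
  edge := h.elim L.edge (fun k => m .size 2 + k) (fun k => m .size 2 + k)
  face := h.elim (fun y => if y = T.next x then m .size 3 else
    if y = T.prev x then m .size 3 + 1 else L.face y) (splitFace x L m)
    (fun k => splitFace x L m (k + 2))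

theorem layout_face_side (h : IsSubdivision T T' x ι s) (L : Layout D) (m : Arr → ℕ → ℕ)
    (k : Fin 3) : (h.layout L m).face (ι (T.next^[k] x)) = splitFace x L m k := by
  have h₁ := T.next_ne x
  have h₂ := T.prev_ne x
  have h₃ := T.prev_ne_next x
  fin_cases k
  · simp [layout, splitFace, h₁.symm, h₂.symm]
  · simp [layout, splitFace]
  · simp [layout, splitFace, next_next_eq_prev, h₃]

theorem layout_face_other (h : IsSubdivision T T' x ι s) (L : Layout D) (m : Arr → ℕ → ℕ)
    {y : D} (h₁ : y ≠ T.next x) (h₂ : y ≠ T.prev x) : (h.layout L m).face (ι y) = L.face y := by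
  simp [layout, h₁, h₂]

theorem splitFace_injective {g : ℕ} {α : Fin g → List D} {vs : List (D → ℕ)} {L : Layout D}
    {m : Arr → ℕ → ℕ} (hE : Encodes T α vs m L) : Function.Injective (splitFace x L m) := by
  have := hE.face_lt x
  intro j k hjk
  fin_cases j <;> fin_cases k <;> simp [splitFace] at hjk ⊢ <;> omega

theorem ne_splitFace {g : ℕ} {α : Fin g → List D} {vs : List (D → ℕ)} {L : Layout D}
    {m : Arr → ℕ → ℕ} (hE : Encodes T α vs m L) {y : D} (h₀ : y ≠ x) (h₁ : y ≠ T.next x)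
    (h₂ : y ≠ T.prev x) (k : Fin 3) : L.face y ≠ splitFace x L m k := by
  have := hE.face_lt y
  have hx : L.face x ≠ L.face y := by
    rw [Ne, hE.face_iff]
    tauto
  fin_cases k
  · simpa [splitFace] using hx.symm
  · simp [splitFace]; omega
  · simp [splitFace]; omega

theorem encodes (h : IsSubdivision T T' x ι s) {g : ℕ} {α : Fin g → List D}
    {α' : Fin g → List D'} {vs : List (D → ℕ)} {vs' : List (D' → ℕ)} {L : Layout D}
    {m m' : Arr → ℕ → ℕ} (hE : Encodes T α vs m L) (hm : IsSplitUpdate T x L vs m m')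
    (hα : ∀ i, List.Forall₂ (fun a b => b = ι a) (α i) (α' i))
    (hvs : List.Forall₂ (fun v v' => Coord T T' x ι s v v') vs vs') :
    Encodes T' α' vs' m' (h.layout L m) := by
  have hlen := hvs.length_eq
  have hf := h.isCornerMap
  have hf' := h.isCornerMap_symm
  have dl := hE.dart_lt
  have vl := hE.vert_lt
  have el := hE.edge_lt
  have fl := hE.face_lt
  have hk : ∀ k : Fin 3, (k : ℕ) < 3 := fun k => k.2
  have hinj : ∀ {j k : Fin 3}, (j : ℕ) = k → j = k := fun h => Fin.ext h
  -- a dart starts at the new vertex, or at the same vertex as an old dart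
  have hrep : ∀ b, (∃ k, b = s k) ∨
      ∃ y, T'.SameVertex b (ι y) ∧ (h.layout L m).vert b = L.vert y :=
    h.cases (fun y => .inr ⟨y, .refl _, by simp [layout]⟩) (fun k => .inl ⟨k, rfl⟩)
      fun k => .inr ⟨_, h.sameVertex_twin_spoke k, by simp [layout]⟩
  -- a dart lies in one of the three new triangles, or is an old dart outside of them
  have hrep' : ∀ b, (∃ k, (h.layout L m).face b = splitFace x L m k) ∨
      ∃ y, b = ι y ∧ y ≠ x ∧ y ≠ T.next x ∧ y ≠ T.prev x :=
    h.cases (fun y => (h.eq_iterate_or y).elim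
      (fun ⟨k, hy⟩ => .inl ⟨k, by rw [hy, h.layout_face_side]⟩) fun hy => .inr ⟨y, rfl, hy⟩)
      (fun k => .inl ⟨k, by simp [layout]⟩) fun k => .inl ⟨k + 2, by simp [layout]⟩
  constructor
  · intro b
    revert b
    refine h.cases (fun y => ?_) (fun k => ?_) (fun k => ?_) <;>
    refine h.cases (fun z => ?_) (fun j => ?_) (fun j => ?_) <;> intro hbc <;>
      simp only [layout, elim_side, elim_spoke, elim_twin] at hbc
    · rw [hE.dart_injective hbc]
    · have := dl y; omega
    · have := dl y; omega
    · have := dl z; omega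
    · rw [hinj (j := k) (k := j) (by omega)]
    · have := hk k; omega
    · have := dl z; omega
    · have := hk j; omega
    · rw [hinj (j := k) (k := j) (by omega)]
  · intro b c
    obtain ⟨k, rfl⟩ | ⟨y, hy, hy'⟩ := hrep b
    · rw [h.sameVertex_spoke]
      obtain ⟨j, rfl⟩ | ⟨z, hz, hz'⟩ := hrep c
      · simp [layout]
      · rw [hz']
        refine iff_of_false ?_ ?_
        · simpa [layout] using (vl z).ne'
        · rintro ⟨j, rfl⟩
          obtain ⟨i, hi⟩ := h.sameVertex_spoke.1 hz
          exact h.ne_spoke _ _ hi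
    · obtain ⟨j, rfl⟩ | ⟨z, hz, hz'⟩ := hrep c
      · rw [hy']
        refine iff_of_false ?_ ?_
        · simpa [layout] using (vl y).ne
        · intro h'
          obtain ⟨i, hi⟩ := h.sameVertex_spoke.1 (h'.symm'.trans' hy)
          exact h.ne_spoke _ _ hi
      · rw [hy', hz', hE.vert_iff, sameVertex_iff hf hf' rfl rfl]
        exact ⟨fun h => hy.trans' (h.trans' hz.symm'), fun h => hy.symm'.trans' (h.trans' hz)⟩
  · have e₁ := h.ne_spoke
    have e₂ := h.ne_twin_spoke
    have e₃ := h.spoke_ne_twin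
    have e₄ := fun y => (el y).ne
    have e₅ : ∀ y n, L.edge y ≠ m .size 2 + n := fun y n => by have := el y; omega
    have e₆ : Function.Injective (fun k => T'.twin (s k)) := T'.twin_injective.comp h.spoke_injective
    refine h.cases (fun y => ?_) (fun k => ?_) (fun k => ?_) <;>
    refine h.cases (fun z => ?_) (fun j => ?_) (fun j => ?_) <;>
      simp only [layout, elim_side, elim_spoke, elim_twin, h.twin, T'.twin_twin]
    · rw [hE.edge_iff, h.injective.eq_iff, h.injective.eq_iff]
    · simp [e₅, (e₁ _ _).symm]
    · simp [e₅, (e₂ _ _).symm]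
    · simp [(e₅ _ _).symm, e₁, e₂]
    · simp [e₃, h.spoke_injective.eq_iff, Fin.ext_iff, eq_comm]
    · simp [(e₃ _ _).symm, e₆.eq_iff, Fin.ext_iff, eq_comm]
    · simp [(e₅ _ _).symm, e₁, e₂]
    · simp [e₃, h.spoke_injective.eq_iff, Fin.ext_iff, eq_comm]
    · simp [(e₃ _ _).symm, e₆.eq_iff, Fin.ext_iff, eq_comm]
  · refine face_iff_of_rep (rep := fun b => ∃ y, b = ι y) ?_ ?_ ?_
    · refine h.cases (fun y => ?_) (fun k => ?_) (fun k => ?_)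
      · obtain ⟨k, rfl⟩ | ⟨h₀, h₁, h₂⟩ := h.eq_iterate_or y
        · rw [h.next_side, h.layout_face_side]
          simp only [layout, elim_twin]
          rw [show k + 1 + 2 = k by omega]
        · rw [h.next_other y h₀ h₁ h₂, h.layout_face_other L m h₁ h₂, h.layout_face_other L m,
            hE.face_iff]
          · simp
          · exact fun h' => h₀ (T.next_injective h')
          · exact fun h' => h₁ (T.next_injective h')
      · rw [h.next_spoke, h.layout_face_side]
        simp [layout]
      · have := h.next_twin_spoke (k + 2)
        rw [show k + 2 + 1 = k by omega] at this
        rw [this]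
        simp [layout]
    · refine h.cases (fun y => ⟨_, ⟨y, rfl⟩, .inl rfl⟩)
        (fun k => ⟨ι (T.next^[k] x), ⟨_, rfl⟩, .inr (.inr ?_)⟩)
        (fun k => ⟨ι (T.next^[(k + 2 : Fin 3)] x), ⟨_, rfl⟩, .inr (.inl ?_)⟩)
      · rw [h.prev_side]
      · rw [h.next_side, show k + 2 + 1 = k by omega]
    · rintro _ _ ⟨y, rfl⟩ ⟨z, rfl⟩ hyz
      obtain ⟨k, rfl⟩ | ⟨h₀, h₁, h₂⟩ := h.eq_iterate_or y <;>
      obtain ⟨j, rfl⟩ | ⟨h₀', h₁', h₂'⟩ := h.eq_iterate_or z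
      · rw [h.layout_face_side, h.layout_face_side] at hyz
        rw [splitFace_injective hE hyz]
        exact .inl rfl
      · rw [h.layout_face_side, h.layout_face_other L m h₁' h₂'] at hyz
        exact (ne_splitFace hE h₀' h₁' h₂' _ hyz.symm).elim
      · rw [h.layout_face_side, h.layout_face_other L m h₁ h₂] at hyz
        exact (ne_splitFace hE h₀ h₁ h₂ _ hyz).elim
      · rw [h.layout_face_other L m h₁ h₂, h.layout_face_other L m h₁' h₂', hE.face_iff] at hyz
        rw [h.next_other y h₀ h₁ h₂, h.prev_other h₀ h₁ h₂]
        simpa [h.injective.eq_iff] using hyz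
  · refine h.cases (fun y => ?_) (fun k => ?_) (fun k => ?_)
    · obtain ⟨k, rfl⟩ | ⟨h₀, h₁, h₂⟩ := h.eq_iterate_or y
      · rw [h.next_side]
        simpa only [layout, elim_side, elim_twin] using hm.next_side k
      · rw [h.next_other y h₀ h₁ h₂]
        simpa only [layout, elim_side, hE.next] using hm.next_other y h₀ h₁ h₂
    · rw [h.next_spoke]
      simpa only [layout, elim_side, elim_spoke] using hm.next_spoke k
    · have := h.next_twin_spoke (k + 2)
      rw [show k + 2 + 1 = k by omega] at this
      rw [this]
      simpa only [layout, elim_spoke, elim_twin] using hm.next_twin k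
  · refine h.cases (fun y => ?_) (fun k => ?_) (fun k => ?_)
    · simpa only [h.twin, layout, elim_side, hE.twin] using hm.twin_side y
    · simpa only [layout, elim_spoke, elim_twin] using hm.twin_spoke k
    · simpa only [T'.twin_twin, layout, elim_spoke, elim_twin] using hm.twin_twin k
  · refine h.cases (fun y => ?_) (fun k => ?_) (fun k => ?_)
    · simpa only [layout, elim_side, hE.vert] using hm.vert_side y
    · simpa only [layout, elim_spoke] using hm.vert_spoke k
    · simpa only [layout, elim_twin] using hm.vert_twin k
  · refine h.cases (fun y => ?_) (fun k => ?_) (fun k => ?_)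
    · simpa only [layout, elim_side, hE.edge] using hm.edge_side y
    · simpa only [layout, elim_spoke] using hm.edge_spoke k
    · simpa only [layout, elim_twin] using hm.edge_twin k
  · refine h.cases (fun y => ?_) (fun k => ?_) (fun k => ?_)
    · obtain ⟨k, rfl⟩ | ⟨h₀, h₁, h₂⟩ := h.eq_iterate_or y
      · rw [h.layout_face_side]
        simpa only [layout, elim_side] using hm.face_side k
      · rw [h.layout_face_other L m h₁ h₂]
        simpa only [layout, elim_side, hE.face] using hm.face_other y h₀ h₁ h₂
    · simpa only [layout, elim_spoke] using hm.face_spoke k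
    · simpa only [layout, elim_twin] using hm.face_twin k
  · intro b
    obtain ⟨k, rfl⟩ | ⟨y, -, hy⟩ := hrep b
    · exact ⟨s 0, by simp [layout], by simp [layout, hm.vertDart_new]⟩
    · rw [hy, hm.vertDart_other _ (vl y)]
      obtain ⟨z, hz, hz'⟩ := hE.vertDart y
      exact ⟨ι z, by simpa [layout] using hz, by simpa [layout] using hz'⟩
  · refine h.cases (fun y => ?_) (fun k => ⟨s k, ?_⟩) (fun k => ⟨s k, ?_⟩)
    · obtain ⟨z, hz, hz'⟩ := hE.edgeDart y
      refine ⟨ι z, by simpa [layout] using hz, ?_⟩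
      simpa [layout, hm.edgeDart_other _ (el y)] using hz'
    · simp [layout, hm.edgeDart_new]
    · simp [layout, hm.edgeDart_new]
  · intro b
    obtain ⟨k, hk⟩ | ⟨y, rfl, h₀, h₁, h₂⟩ := hrep' b
    · refine ⟨ι (T.next^[k] x), by rw [h.layout_face_side, hk], ?_⟩
      rw [hk, hm.faceDart_new]
      simp [layout]
    · obtain ⟨z, hz, hz'⟩ := hE.faceDart y
      have hx := ne_splitFace hE h₀ h₁ h₂ 0
      rw [h.layout_face_other L m h₁ h₂, hm.faceDart_other _ (fl y) hx]
      refine ⟨ι z, ?_, by simpa [layout] using hz'⟩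
      have hz₁ : z ≠ T.next x := by
        rintro rfl
        exact hx (hz.symm.trans ((hE.face_iff _ _).2 (by simp)))
      have hz₂ : z ≠ T.prev x := by
        rintro rfl
        exact hx (hz.symm.trans ((hE.face_iff _ _).2 (by simp)))
      rw [h.layout_face_other L m hz₁ hz₂, hz]
  · intro b j hj
    have hj' : j < vs.length := hlen ▸ hj
    have hc : Coord T T' x ι s vs[j] vs'[j] := (List.forall₂_iff_get.1 hvs).2 j hj' hj
    rw [← hlen]
    revert b
    refine h.cases (fun y => ?_) (fun k => ?_) (fun k => ?_)
    · have := Nat.mul_le_mul_right vs.length (Nat.succ_le_of_lt (el y))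
      rw [Nat.succ_mul] at this
      simp only [layout, elim_side]
      rw [hm.coord_other _ (by omega), hE.coord y j hj', hc.side]
    · simp only [layout, elim_spoke]
      rw [hm.coord_new k j hj', hc.spoke]
    · simp only [layout, elim_twin]
      rw [hm.coord_new k j hj', hc.twin_spoke]
  · intro i
    rw [hm.curveLength, hE.curveLength, (hα i).length_eq]
  · intro i j hj
    have hj' : j < (α i).length := (hα i).length_eq ▸ hj
    have : (α' i)[j] = ι (α i)[j] := (List.forall₂_iff_get.1 (hα i)).2 j hj' hj
    rw [hm.curveEdge, hm.curveStart, hE.curveEdge i j hj', this]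
    simp [layout]
  · rw [hm.size₀]
    refine h.cases (fun y => ?_) (fun k => ?_) (fun k => ?_) <;>
      simp only [layout, elim_side, elim_spoke, elim_twin]
    · have := dl y; omega
    · omega
    · omega
  · rw [hm.size₁]
    intro b
    obtain ⟨k, rfl⟩ | ⟨y, -, hy⟩ := hrep b
    · simp [layout]
    · rw [hy]
      have := vl y; omega
  · rw [hm.size₂]
    refine h.cases (fun y => ?_) (fun k => ?_) (fun k => ?_) <;>
      simp only [layout, elim_side, elim_spoke, elim_twin]
    · have := el y; omega
    · omega
    · omega
  · rw [hm.size₃]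
    intro b
    obtain ⟨k, hk⟩ | ⟨y, rfl, h₀, h₁, h₂⟩ := hrep' b
    · rw [hk]
      have := fl x
      fin_cases k
      · simp [splitFace]; omega
      · simp [splitFace]
      · simp [splitFace]
    · rw [h.layout_face_other L m h₁ h₂]
      have := fl y; omega
  · rw [hm.size₄, hE.numVectors, hlen]
  · rw [hm.size₅, hE.genus]

end IsSubdivision

/-! ### The program for the removal of a vertex -/

namespace Prog

/-- The spokes go to the registers `1`, `4`, `7`, the sides of the triangle that contains the vertex
to `2`, `5`, `8`, their origins to `10`, `11`, `12`, and the triangle of the first side to `9`. -/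
def joinLoad : List Prog :=
  [.load 2 .next 1, .load 3 .next 2, .load 4 .twin 3, .load 5 .next 4, .load 6 .next 5,
    .load 7 .twin 6, .load 8 .next 7, .load 9 .face 2, .load 10 .vert 2, .load 11 .vert 5,
    .load 12 .vert 8]

/-- The changes of the pointers; the three vertices of the new triangle must not point to spokes. -/
def joinStore : List Prog :=
  [.store .next 2 5, .store .next 5 8, .store .next 8 2, .store .face 5 9, .store .face 8 9,
    .store .faceDart 9 2, .store .vertDart 10 2, .store .vertDart 11 5, .store .vertDart 12 8]

/-- The removal of the vertex at the origin of the dart in register `1`. -/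
def join : Prog := .seq (block joinLoad) (block joinStore)

end Prog

open Function in
/-- The memory `m'` arises from `m` by the update for the removal of the vertex at which the three
sides `ι x`, `ι (next x)`, `ι (prev x)` are connected by spokes. -/
structure IsJoinUpdate {D D' : Type} (T : Tri D) (x : D) (ι : D → D') (L : Layout D')
    (m m' : Arr → ℕ → ℕ) : Prop where
  next : m' .next = update (update (update (m .next)
    (L.dart (ι x)) (L.dart (ι (T.next x)))) (L.dart (ι (T.next x))) (L.dart (ι (T.prev x))))
    (L.dart (ι (T.prev x))) (L.dart (ι x))
  face : m' .face = update (update (m .face) (L.dart (ι (T.next x))) (L.face (ι x)))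
    (L.dart (ι (T.prev x))) (L.face (ι x))
  faceDart : m' .faceDart = update (m .faceDart) (L.face (ι x)) (L.dart (ι x))
  vertDart : m' .vertDart = update (update (update (m .vertDart)
    (L.vert (ι x)) (L.dart (ι x))) (L.vert (ι (T.next x))) (L.dart (ι (T.next x))))
    (L.vert (ι (T.prev x))) (L.dart (ι (T.prev x)))
  rest : ∀ A, A ≠ .next → A ≠ .face → A ≠ .faceDart → A ≠ .vertDart → m' A = m A

namespace IsSubdivision

open Tri

variable {D D' : Type} {T : Tri D} {T' : Tri D'} {x : D} {ι : D → D'} {s : Fin 3 → D'}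
  {g : ℕ} {α' : Fin g → List D'} {vs' : List (D' → ℕ)} {L : Layout D'}

theorem run_join {σ : State} {W B : ℕ} (h : IsSubdivision T T' x ι s)
    (hE : Encodes T' α' vs' σ.mem L) (hs : σ.reg 1 = L.dart (s 0))
    (hB : Bounds σ.mem vs' B) (hW : 100 * B ≤ 2 ^ W) :
    Run W Prog.join σ 100 fun σ' => IsJoinUpdate T x ι L σ.mem σ'.mem := by
  have hb₁ := hB.one_le
  have hdart : ∀ x, L.dart x < 2 ^ W := fun x => by
    have := hE.dart_lt x; have := hB.size₀; omega
  have hvert : ∀ x, L.vert x < 2 ^ W := fun x => by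
    have := hE.vert_lt x; have := hB.size₁; omega
  have hface : ∀ x, L.face x < 2 ^ W := fun x => by
    have := hE.face_lt x; have := hB.size₃; omega
  have n₀ : T'.next (s 0) = ι x := h.next_spoke 0
  have n₁ : T'.next (s 1) = ι (T.next x) := h.next_spoke 1
  have n₂ : T'.next (s 2) = ι (T.prev x) := h.next_spoke 2
  have t₀ : T'.next (ι x) = T'.twin (s 1) := h.next_side 0
  have t₁ : T'.next (ι (T.next x)) = T'.twin (s 2) := h.next_side 1
  refine (Run.seq (c := 12) (c' := 10) (Run.mono
    (Q := fun σ₁ => σ₁.mem = σ.mem ∧ σ₁.reg 2 = L.dart (ι x) ∧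
      σ₁.reg 5 = L.dart (ι (T.next x)) ∧ σ₁.reg 8 = L.dart (ι (T.prev x)) ∧
      σ₁.reg 9 = L.face (ι x) ∧ σ₁.reg 10 = L.vert (ι x) ∧
      σ₁.reg 11 = L.vert (ι (T.next x)) ∧ σ₁.reg 12 = L.vert (ι (T.prev x))) ?_ le_rfl ?_)).mono
    (by omega) fun _ h => h
  · refine Run.load (v := L.dart (ι x)) (by simp [hs, hE.next, n₀]) (hdart _) ?_
    refine Run.load (v := L.dart (T'.twin (s 1))) (by simp [hE.next, t₀]) (hdart _) ?_
    refine Run.load (v := L.dart (s 1)) (by simp [hE.twin]) (hdart _) ?_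
    refine Run.load (v := L.dart (ι (T.next x))) (by simp [hE.next, n₁]) (hdart _) ?_
    refine Run.load (v := L.dart (T'.twin (s 2))) (by simp [hE.next, t₁]) (hdart _) ?_
    refine Run.load (v := L.dart (s 2)) (by simp [hE.twin]) (hdart _) ?_
    refine Run.load (v := L.dart (ι (T.prev x))) (by simp [hE.next, n₂]) (hdart _) ?_
    refine Run.load (v := L.face (ι x)) (by simp [hE.face]) (hface _) ?_
    refine Run.load (v := L.vert (ι x)) (by simp [hE.vert]) (hvert _) ?_
    refine Run.load (v := L.vert (ι (T.next x))) (by simp [hE.vert]) (hvert _) ?_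
    refine Run.load (v := L.vert (ι (T.prev x))) (by simp [hE.vert]) (hvert _) ?_
    exact Run.nil (by simp)
  rintro σ₁ ⟨hm, r₂, r₅, r₈, r₉, r₁₀, r₁₁, r₁₂⟩
  iterate 9 refine Run.store ?_
  refine Run.nil ⟨?_, ?_, ?_, ?_, ?_⟩
  · simp [State.setMem_mem, *]
  · simp [State.setMem_mem, *]
  · simp [State.setMem_mem, *]
  · simp [State.setMem_mem, *]
  · intro A h₁ h₂ h₃ h₄
    simp [State.setMem_mem, h₁, h₂, h₃, h₄, hm]

open Classical in
/-- The names after the removal of a vertex: the remaining darts, edges and vertices keep their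
names, and the new triangle inherits the name of one of the three old ones. -/
noncomputable def joinLayout (T : Tri D) (x : D) (ι : D → D') (L : Layout D') : Layout D where
  dart y := L.dart (ι y)
  vert y := L.vert (ι y)
  edge y := L.edge (ι y)
  face y := if y = T.next x ∨ y = T.prev x then L.face (ι x) else L.face (ι y)

theorem joinLayout_face_iterate (k : Fin 3) :
    (joinLayout T x ι L).face (T.next^[k] x) = L.face (ι x) := by
  fin_cases k
  · simp [joinLayout]
  · simp [joinLayout]
  · simp [joinLayout, next_next_eq_prev]

theorem joinLayout_face_other {y : D} (h₁ : y ≠ T.next x) (h₂ : y ≠ T.prev x) :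
    (joinLayout T x ι L).face y = L.face (ι y) := by
  simp [joinLayout, h₁, h₂]

theorem encodes_symm (h : IsSubdivision T T' x ι s) {α : Fin g → List D} {vs : List (D → ℕ)}
    {m m' : Arr → ℕ → ℕ} (hE : Encodes T' α' vs' m L) (hm : IsJoinUpdate T x ι L m m')
    (hα : ∀ i, List.Forall₂ (fun b a => b = ι a) (α' i) (α i))
    (hvs : List.Forall₂ (fun v' v => ∀ y, v y = v' (ι y)) vs' vs) :
    Encodes T α vs m' (joinLayout T x ι L) := by
  classical
  have hlen := hvs.length_eq
  have hf := h.isCornerMap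
  have hf' := h.isCornerMap_symm
  have hdart : ∀ y z, L.dart (ι y) = L.dart (ι z) ↔ y = z := fun y z => by
    rw [hE.dart_injective.eq_iff, h.injective.eq_iff]
  have hsize : m' .size = m .size := hm.rest _ (by decide) (by decide) (by decide) (by decide)
  have n₀ := T.next_ne x
  have n₁ := T.prev_ne x
  have n₂ := T.prev_ne_next x
  -- an outer dart is in none of the three triangles at the vertex
  have hne : ∀ {y}, y ≠ x → y ≠ T.next x → y ≠ T.prev x → ∀ k : Fin 3,
      L.face (ι (T.next^[k] x)) ≠ L.face (ι y) := by
    intro y h₀ h₁ h₂ k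
    rw [Ne, hE.face_iff, h.injective.eq_iff, h.next_side, h.prev_side]
    rintro (h' | h' | h')
    · revert h'
      fin_cases k
      · exact h₀
      · exact h₁
      · exact h₂
    · exact h.ne_twin_spoke _ _ h'
    · exact h.ne_spoke _ _ h'
  constructor
  · exact hE.dart_injective.comp h.injective
  · intro y z
    exact (hE.vert_iff _ _).trans (sameVertex_iff hf hf' rfl rfl).symm
  · intro y z
    refine (hE.edge_iff _ _).trans ?_
    rw [h.twin, h.injective.eq_iff, h.injective.eq_iff]
  · refine face_iff_of_rep (rep := fun y => y = x ∨ (y ≠ x ∧ y ≠ T.next x ∧ y ≠ T.prev x)) ?_ ?_ ?_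
    · intro y
      obtain ⟨k, rfl⟩ | ⟨h₀, h₁, h₂⟩ := h.eq_iterate_or y
      · rw [← h.iterate_succ, joinLayout_face_iterate, joinLayout_face_iterate]
      · rw [joinLayout_face_other h₁ h₂, joinLayout_face_other, ← h.next_other y h₀ h₁ h₂,
          hE.face_iff]
        · simp
        · exact fun h' => h₀ (T.next_injective h')
        · exact fun h' => h₁ (T.next_injective h')
    · intro y
      by_cases hy : y = x ∨ y = T.next x ∨ y = T.prev x
      · exact ⟨x, .inl rfl, hy⟩
      · push Not at hy
        exact ⟨y, .inr hy, .inl rfl⟩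
    · have fx : (joinLayout T x ι L).face x = L.face (ι x) := joinLayout_face_iterate 0
      rintro y z (rfl | ⟨h₀, h₁, h₂⟩) (rfl | ⟨h₀', h₁', h₂'⟩) hyz
      · exact .inl rfl
      · rw [fx, joinLayout_face_other h₁' h₂'] at hyz
        exact (hne h₀' h₁' h₂' 0 hyz).elim
      · rw [fx, joinLayout_face_other h₁ h₂] at hyz
        exact (hne h₀ h₁ h₂ 0 hyz.symm).elim
      · rw [joinLayout_face_other h₁ h₂, joinLayout_face_other h₁' h₂', hE.face_iff,
          h.next_other y h₀ h₁ h₂, h.prev_other h₀ h₁ h₂] at hyz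
        simpa [h.injective.eq_iff] using hyz
  · intro y
    simp only [hm.next, joinLayout, Function.update_apply, hdart]
    obtain ⟨k, rfl⟩ | ⟨h₀, h₁, h₂⟩ := h.eq_iterate_or y
    · fin_cases k
      · simp [n₀.symm, n₁.symm]
      · simp [n₂.symm, next_next_eq_prev]
      · simp [next_next_eq_prev]
    · simp [h₀, h₁, h₂, hE.next, h.next_other y h₀ h₁ h₂]
  · intro y
    rw [hm.rest _ (by decide) (by decide) (by decide) (by decide)]
    simp [joinLayout, hE.twin, h.twin]
  · intro y
    rw [hm.rest _ (by decide) (by decide) (by decide) (by decide)]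
    exact hE.vert _
  · intro y
    rw [hm.rest _ (by decide) (by decide) (by decide) (by decide)]
    exact hE.edge _
  · intro y
    simp only [hm.face, joinLayout, Function.update_apply, hdart, hE.face]
    by_cases h₁ : y = T.prev x
    · simp [h₁]
    · simp [h₁]
  · intro y
    rw [hm.vertDart]
    simp only [joinLayout]
    by_cases e₂ : L.vert (ι y) = L.vert (ι (T.prev x))
    · exact ⟨T.prev x, e₂.symm, by simp [e₂]⟩
    by_cases e₁ : L.vert (ι y) = L.vert (ι (T.next x))
    · exact ⟨T.next x, e₁.symm, by rw [Function.update_of_ne e₂, e₁, Function.update_self]⟩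
    by_cases e₀ : L.vert (ι y) = L.vert (ι x)
    · exact ⟨x, e₀.symm, by
        rw [Function.update_of_ne e₂, Function.update_of_ne e₁, e₀, Function.update_self]⟩
    rw [Function.update_of_ne e₂, Function.update_of_ne e₁, Function.update_of_ne e₀]
    obtain ⟨b, hb, hb'⟩ := hE.vertDart (ι y)
    revert hb hb'
    -- the stored dart is not a new one, since the vertex is not a corner of the triangle
    refine h.cases (P := fun b => L.vert b = L.vert (ι y) → m .vertDart (L.vert (ι y)) = L.dart b →
      ∃ z, L.vert (ι z) = L.vert (ι y) ∧ m .vertDart (L.vert (ι y)) = L.dart (ι z))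
      (fun z hz hz' => ⟨z, hz, hz'⟩) (fun k hk _ => ?_) (fun k hk _ => ?_) b
    · obtain ⟨j, hj⟩ := h.sameVertex_spoke.1 ((hE.vert_iff _ _).1 hk)
      exact (h.ne_spoke _ _ hj).elim
    · have := hk.symm.trans ((hE.vert_iff _ _).2 (h.sameVertex_twin_spoke k))
      revert this
      fin_cases k
      · exact fun h' => (e₀ h').elim
      · exact fun h' => (e₁ h').elim
      · exact fun h' => (e₂ h').elim
  · intro y
    rw [hm.rest _ (by decide) (by decide) (by decide) (by decide)]
    obtain ⟨b, hb, hb'⟩ := hE.edgeDart (ι y)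
    obtain hb'' | hb'' := (hE.edge_iff _ _).1 hb.symm
    · subst hb''
      exact ⟨y, rfl, hb'⟩
    · rw [h.twin] at hb''
      subst hb''
      exact ⟨T.twin y, hb, hb'⟩
  · intro y
    rw [hm.faceDart]
    obtain ⟨k, rfl⟩ | ⟨h₀, h₁, h₂⟩ := h.eq_iterate_or y
    · rw [joinLayout_face_iterate]
      exact ⟨x, joinLayout_face_iterate 0, by simp [joinLayout]⟩
    · rw [joinLayout_face_other h₁ h₂, Function.update_of_ne (show _ ≠ L.face (ι x) from
        (hne h₀ h₁ h₂ 0).symm)]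
      obtain ⟨b, hb, hb'⟩ := hE.faceDart (ι y)
      have hz : ∃ z, b = ι z := by
        rw [eq_comm, hE.face_iff, h.next_other y h₀ h₁ h₂, h.prev_other h₀ h₁ h₂] at hb
        obtain rfl | rfl | rfl := hb
        · exact ⟨_, rfl⟩
        · exact ⟨_, rfl⟩
        · exact ⟨_, rfl⟩
      obtain ⟨z, rfl⟩ := hz
      refine ⟨z, ?_, hb'⟩
      rw [joinLayout_face_other, hb]
      · rintro rfl
        exact hne h₀ h₁ h₂ 1 hb
      · rintro rfl
        exact hne h₀ h₁ h₂ 2 hb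
  · intro y j hj
    have hj' : j < vs'.length := hlen ▸ hj
    have : vs[j] y = vs'[j] (ι y) := (List.forall₂_iff_get.1 hvs).2 j hj' hj y
    rw [hm.rest _ (by decide) (by decide) (by decide) (by decide), ← hlen, this]
    exact hE.coord _ j hj'
  · intro i
    rw [hm.rest _ (by decide) (by decide) (by decide) (by decide), hE.curveLength,
      (hα i).length_eq]
  · intro i j hj
    have hj' : j < (α' i).length := (hα i).length_eq ▸ hj
    have : (α' i)[j] = ι (α i)[j] := (List.forall₂_iff_get.1 (hα i)).2 j hj' hj
    rw [hm.rest .curveEdge (by decide) (by decide) (by decide) (by decide),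
      hm.rest .curveStart (by decide) (by decide) (by decide) (by decide),
      hE.curveEdge i j hj', this]
    rfl
  · intro y
    rw [hsize]
    exact hE.dart_lt _
  · intro y
    rw [hsize]
    exact hE.vert_lt _
  · intro y
    rw [hsize]
    exact hE.edge_lt _
  · intro y
    rw [hsize]
    simp only [joinLayout]
    split_ifs
    · exact hE.face_lt _
    · exact hE.face_lt _
  · rw [hsize, hE.numVectors, hlen]
  · rw [hsize, hE.genus]

end IsSubdivision

/-! ### One program for the three moves -/

/-- The program distinguishes the three moves by their codes in register `0`. -/
def Prog.update : Prog :=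
  .seq (block [.const 60 1, .const 61 2])
    (.ifLt 0 60 flip (.ifLt 0 61 split join))

theorem Run.update {W c : ℕ} {s : State} {mv : Move} {Q : State → Prop} (hs : s.reg 0 = mv.code)
    (hW : 2 < 2 ^ W)
    (h : ∀ σ : State, σ.mem = s.mem → σ.reg 1 = s.reg 1 →
      Run W (match mv with | .flip => Prog.flip | .split => Prog.split | .join => Prog.join)
        σ c Q) : Run W Prog.update s (c + 5) Q := by
  refine (Run.seq (c := 3) (c' := c + 2) (Run.const (by omega) (Run.const hW (Run.nil ?_)))).mono
    (by omega) fun _ h => h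
  have h := h ((s.setReg 60 1).setReg 61 2) (by simp) (by simp)
  cases mv with
  | flip =>
    exact (Run.ifTrue (by simp [hs, Move.code]) h).mono (by omega) fun _ h => h
  | split =>
    exact Run.ifFalse (by simp [hs, Move.code]) (Run.ifTrue (by simp [hs, Move.code]) h)
  | join =>
    exact Run.ifFalse (by simp [hs, Move.code]) (Run.ifFalse (by simp [hs, Move.code]) h)

theorem Encodes.bounds {D : Type} [Fintype D] {T : Tri D} {g : ℕ} {α : Fin g → List D}
    {β : Fin g → D → ℕ} {st : Storage} {m : Arr → ℕ → ℕ} {L : Layout D}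
    (hE : Encodes T α (st.vectors β) m L) :
    Bounds m (st.vectors β) (memoryInUse m + ∑ y, Tri.total β y + 1) := by
  have h₄ := hE.numVectors
  simp only [memoryInUse, h₄]
  refine ⟨by omega, by omega, by omega, by omega, by omega, fun v hv x => ?_⟩
  have h₁ := st.le_total hv x
  have h₂ := Finset.single_le_sum (f := Tri.total β) (fun _ _ => Nat.zero_le _) (Finset.mem_univ x)
  omega

theorem exists_forall₂_of_mem {D D' : Type} {g : ℕ} {α : Fin g → List D} {R : D → D' → Prop}
    (h : ∀ i, ∀ a ∈ α i, ∃ b, R a b) :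
    ∃ α' : Fin g → List D', ∀ i, List.Forall₂ R (α i) (α' i) :=
  ⟨_, fun i => (Tri.exists_forall₂ (h i)).choose_spec⟩

theorem mainTheorem12 :
    ∃ (P : Prog) (C : ℕ),
      ∀ (D D' : Type) [Fintype D] [Fintype D'] (T : Tri D) (T' : Tri D') (g : ℕ)
        (α : Fin g → List D) (β : Fin g → D → ℕ) (mv : Move) (x : D) (R : D → D' → Prop),
        T.IsHeegaardDiagram g α β →
        PachnerMove T T' mv x R →
        -- the move deletes no edge of `α`
        (∀ i, ∀ a ∈ α i, ∃ b, R a b) →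
        -- a move (3,1) leaves `β` normal
        (mv = Move.join → T.StrandsJoinDistinctSides β R) →
        ∀ (st : Storage) (L : Layout D) (s : State) (W : ℕ),
          Encodes T α (st.vectors β) s.mem L →
          s.reg 0 = mv.code →
          s.reg 1 = L.dart x →
          -- the bit-size: the logarithm of the number of intersections and of the memory in use,
          -- up to an additive constant
          C * (memoryInUse s.mem + ∑ y, Tri.total β y + 1) ≤ 2 ^ W →
          ∃ (s' : State) (t : ℕ) (L' : Layout D') (α' : Fin g → List D') (β' : Fin g → D' → ℕ),
            Exec W P s s' t ∧
            t ≤ C * ((st.vectors β).length + 1) ∧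
            memoryInUse s'.mem ≤ memoryInUse s.mem + C * ((st.vectors β).length + 1) ∧
            Encodes T' α' (st.vectors β') s'.mem L' ∧
            T'.IsHeegaardDiagram g α' β' ∧
            (∀ i, List.Forall₂ R (α i) (α' i)) ∧
            T.IsotopicInPolygon T' β β' R ∧
            -- after a move (1,3), the coordinates of the new edges are the corner coordinates
            (mv = Move.split → ∀ k a b, (¬ ∃ c, R c b) → R a (T'.next b) →
              β' k b = T.corner (β k) a) := by
  -- each of the three programs takes at most `48 * K + 100` steps for `K` vectors, and the choice
  -- between them at most five
  refine ⟨Prog.update, 110, ?_⟩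
  intro D D' _ _ T T' g α β mv x R hT hR hα hst st L s W hE hs₀ hs₁ hW
  obtain ⟨B, hB, hW'⟩ : ∃ B, Bounds s.mem (st.vectors β) B ∧ 100 * B ≤ 2 ^ W :=
    ⟨_, hE.bounds, by omega⟩
  have hW₂ : 2 < 2 ^ W := by omega
  obtain ⟨α', hα'⟩ := exists_forall₂_of_mem hα
  cases hR with
  | flip T'' _ hF e _ hn ht =>
    have h := hF.isFlipAlong hn ht
    obtain ⟨β', hT', hiso, hc, hc'⟩ := h.exists_heegaard hT hα'
    obtain ⟨s', t, hex, htime, hupd⟩ := Run.update hs₀ hW₂ fun σ hm h₁ =>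
      hm ▸ run_flip (s := σ) h (hm ▸ hE) (h₁.trans hs₁) (hm ▸ hB) hW'
    have hsize : s'.mem .size = s.mem .size := hupd.rest _ (by decide) (by decide) (by decide)
      (by decide) (by decide) (by decide)
    exact ⟨s', t, _, α', β', hex, by omega, by simp only [memoryInUse, hsize]; omega,
      h.encodes hE hupd hα' (st.forall₂_vectors hc' hc), hT', hα', hiso, by simp⟩
  | split _ _ ι sp h =>
    obtain ⟨β', hT', hiso, hc, hc'⟩ := h.exists_heegaard hT hα'
    obtain ⟨s', t, hex, htime, hupd⟩ := Run.update hs₀ hW₂ fun σ hm h₁ =>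
      hm ▸ run_split (s := σ) (hm ▸ hE) (h₁.trans hs₁) (hm ▸ hB) hW'
    refine ⟨s', t, _, α', β', hex, by omega, ?_, h.encodes hE hupd hα' (st.forall₂_vectors hc' hc),
      hT', hα', hiso, ?_⟩
    · simp only [memoryInUse, hupd.size₀, hupd.size₁, hupd.size₂, hupd.size₃, hupd.size₄,
        hE.numVectors, Nat.add_mul]
      omega
    · rintro - k a b hb hab
      revert hb hab
      refine h.cases (P := fun b => (¬ ∃ c, b = ι c) → T'.next b = ι a →
        β' k b = T.corner (β k) a) (fun y hy => (hy ⟨y, rfl⟩).elim) (fun j _ hj => ?_)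
        (fun j _ hj => ?_) b
      -- a dart of a new edge whose successor is old is a spoke
      · rw [h.next_spoke] at hj
        rw [(hc' k).spoke, h.injective hj]
      · have := h.next_twin_spoke (j + 2)
        rw [show j + 2 + 1 = j by omega, hj] at this
        exact (h.ne_spoke _ _ this).elim
  | join _ y ι sp h =>
    obtain ⟨β', hT', hiso, hc, hc'⟩ := h.exists_heegaard_symm hT (hst rfl) hα'
    obtain ⟨s', t, hex, htime, hupd⟩ := Run.update hs₀ hW₂ fun σ hm h₁ =>
      hm ▸ h.run_join (σ := σ) (hm ▸ hE) (h₁.trans hs₁) (hm ▸ hB) hW'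
    have hsize : s'.mem .size = s.mem .size := hupd.rest _ (by decide) (by decide) (by decide)
      (by decide)
    exact ⟨s', t, _, α', β', hex, by omega, by simp only [memoryInUse, hsize]; omega,
      h.encodes_symm hE hupd hα' (st.forall₂_vectors hc' hc), hT', hα', hiso, by simp⟩
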